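/- **Setting.** Let $A\subset\mathbb R^d$ be compact, $E$ a finite set (of modes), $\delta>0$, $N\ge 2$, and let $e_1,\dots,e_N\in\mathbb R^m$ be nonzero vectors, no two of which are positive multiples of each other. Put $O=0$, $J_j=(0,1)e_j$ and $\overline{\mathcal G}=\bigcup_{j}[0,1]e_j$. For each $j$ let $E=E_j^{active}\cup E_j^{inactive}$ be a partition. Let $f_\gamma:\mathbb R^m\times A\to\mathbb R^m$, $\lambda:\mathbb R^m\times E\times A\to\mathbb R_+$, $Q:\mathbb R^m\times E^2\times A\to[0,1]$, $l_\gamma:\mathbb R^m\times A\to\mathbb R$ ($\gamma\in E$) satisfy, for some $C>0$: * $f_\gamma$ is uniformly continuous, $\langle f_\gamma(x,a)-f_\gamma(y,a),x-y\rangle\le C|x-y|^2$ and $|f_\gamma|\le C$; * $\lambda(\cdot,\gamma,\cdot)$ is uniformly continuous, $C$-Lipschitz in $x$, and $\lambda\le C$; * $\sum_{\gamma'}Q(x,\gamma,\gamma',a)=1$, $Q(x,\gamma,\gamma,a)=0$, and $Q$ is $C$-Lipschitz in $x$ (uniformly in the other variables) and Borel in $a$; * $l_\gamma$ is uniformly continuous,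 $C$-Lipschitz in $x$, and $|l_\gamma|\le C$. For a Borel $\alpha:\mathbb R_+\to A$ let $y_\gamma(\cdot;x,\alpha)$ be the solution of $\dot y=f_\gamma(y,\alpha(t))$, $y(0)=x$. For $x\in\overline{\mathcal G}$ let $\mathcal A_{\gamma,x}$ be the set of Borel $\alpha$ with $y_\gamma(t;x,\alpha)\in\overline{\mathcal G}$ for all $t\ge0$, and $A_{\gamma,x}$ the set of $a\in A$ such that, for some $\theta>0$, $y_\gamma(t;x,a)\in\overline{\mathcal G}$ for all $t\in[0,\theta]$. Policies are Borel maps $\alpha(t;x,\gamma)$ with values in $A$. A policy and an initial state $(x,\gamma)$ determine the switched piecewise deterministic Markov process $(X_t,\Gamma_t)$: starting from $(Y_0,\Upsilon_0)=(x,\gamma)$ at $\tau_0=0$, after the $n$-th jump $X$ follows $y_{\Upsilon_n}(t-\tau_n;Y_n,\alpha(\cdot;Y_n,\Upsilon_n))$ with $\Gamma=\Upsilon_n$, the next jump occurs at rate $\lambda$ evaluated along this trajectory and control, $X$ is continuous at the jump, and the new mode is drawn from $Q(X,\Upsilon_n,\cdot,\alpha)$ evaluated at the jump time. Let $\mathcal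 A_{ad}$ be the set of policies such that, for every initial state in $\overline{\mathcal G}\times E$, almost surely $X_t\in\overline{\mathcal G}$ for all $t\ge0$. **Assumptions.** There are nonempty sets $A^{\gamma,j}\subset A$ such that for all $\gamma\in E$, $1\le j\le N$: 1. $A_{\gamma,x}=A^{\gamma,j}$ for $x\in J_j$; $A_{\gamma,O}=\bigcup_k\{a\in A^{\gamma,k}: f_\gamma(O,a)\in\mathbb R_+e_k\}$; $A_{\gamma,e_j}=\{a\in A^{\gamma,j}:\langle f_\gamma(e_j,a),e_j\rangle\le0\}\ne\emptyset$; and either $A_{\gamma,e_j}=A^{\gamma,j}$ or $\langle f_\gamma(e_j,a),e_j\rangle<-\beta$ for some $\beta>0$, $a\in A^{\gamma,j}$. 2. If $\gamma\in E_j^{active}$, there are $\beta>0$ and $a^+,a^-\in A^{\gamma,j}$ with $\langle f_\gamma(O,a^+),e_j\rangle>\beta$ and $\langle f_\gamma(O,a^-),e_j\rangle<-\beta$. 3. If $\gamma\in E_j^{inactive}$, there are $\beta>0$, $\eta\in(0,1)$, $\kappa\in[0,1)$ and $a^-,a^0\in A^{\gamma,j}$ such that $f_\gamma(O,a^0)=0$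 and, for all $x\in J_j$ with $|x|\le\eta$, $\langle f_\gamma(x,a^-),e_j\rangle\le-\beta\langle x,e_j\rangle^\kappa$ and $\langle f_\gamma(x,a),e_j\rangle\le0$ for all $a\in A^{\gamma,j}$. 4. If $\gamma\in E_j^{inactive}$, then $l_\gamma(O,a)$, $\lambda(O,\gamma,a)$ and $Q(O,\gamma,\gamma',a)$ (for each $\gamma'\in E$) do not depend on $a\in A^{\gamma,j}$. 5. For every $x\in J_j$ there is $\theta>0$ such that every $\alpha\in\mathcal A_{ad}$ satisfies $\alpha(t;x,\gamma)\in A^{\gamma,j}$ for almost all $t\in[0,\theta]$. **Value functions.** For $(x,\gamma)\in\overline{\mathcal G}\times E$ put $$v_0^\delta(x,\gamma)=\inf_{\alpha\in\mathcal A_{\gamma,x}}\int_0^\infty e^{-\delta t}l_\gamma\big(y_\gamma(t;x,\alpha),\alpha(t)\big)\,dt$$ and, for $m\ge1$, $$v_m^\delta(x,\gamma)=\inf_{\alpha\in\mathcal A_{ad}}\mathbb E\Big[\int_0^{\tau_1}e^{-\delta t}l_\gamma\big(X_t,\alpha(t;x,\gamma)\big)\,dt+e^{-\delta\tau_1}v_{m-1}^\delta(Y_1,\Upsilon_1)\Big],$$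 where $\tau_1$ is the first jump time and $(Y_1,\Upsilon_1)$ the post-jump state of the process started at $(x,\gamma)$ with policy $\alpha$. **Theorem.** For every $m\ge0$ the functions $v_m^\delta(\cdot,\gamma)$ are uniformly continuous on $\overline{\mathcal G}$, uniformly with respect to $\gamma\in E$: for every $\varepsilon>0$ there is $\rho>0$ such that $|v_m^\delta(x,\gamma)-v_m^\delta(y,\gamma)|<\varepsilon$ for all $\gamma\in E$ and all $x,y\in\overline{\mathcal G}$ with $|x-y|<\rho$. -/

import Mathlib

open Set MeasureTheory
open scoped ENNReal NNReal

/-- The raw data of a controlled switched piecewise deterministic process on a star-shaped network: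
compact control set, end points of the edges, vector fields, jump rate, post-jump transition matrix,
running costs, the modes in which edge `j` is active (the other modes are those in which it is
inactive), and the sets of controls attached to the edges. All properties are imposed separately. -/
structure TrafficModel (d m N : ℕ) (E : Type*) where
  /-- the control set -/
  A : Set (EuclideanSpace ℝ (Fin d))
  /-- the vertices `e_j` -/
  e : Fin N → EuclideanSpace ℝ (Fin m)
  /-- the vector fields `f_γ(x,a)` -/
  f : E → EuclideanSpace ℝ (Fin m) → A → EuclideanSpace ℝ (Fin m)
  /-- the jump rate `lam(x,γ,a)` -/
  lam : EuclideanSpace ℝ (Fin m) → E → A → ℝ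
  /-- the post-jump transition matrix `Q(x,γ,γ₁,a)` -/
  Q : EuclideanSpace ℝ (Fin m) → E → E → A → ℝ
  /-- the running costs `l_γ(x,a)` -/
  l : E → EuclideanSpace ℝ (Fin m) → A → ℝ
  /-- the modes for which edge `j` is active -/
  active : Fin N → Set E
  /-- the controls `A^{γ,j}` available on the edge `j` in mode `γ` -/
  edgeCtrl : E → Fin N → Set A

namespace TrafficModel

variable {d m N : ℕ} {E : Type*}

/-! ### The network -/

/-- The open edge `J_j = (0,1) e_j`. -/
def edge (M : TrafficModel d m N E) (j : Fin N) : Set (EuclideanSpace ℝ (Fin m)) :=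
  (fun r : ℝ => r • M.e j) '' Ioo 0 1

/-- The closed network, the union of the segments `[0,1] e_j`. -/
def network (M : TrafficModel d m N E) : Set (EuclideanSpace ℝ (Fin m)) :=
  ⋃ j, (fun r : ℝ => r • M.e j) '' Icc 0 1

/-- Star shape: the edges are nondegenerate and two different edges meet at `O = 0` only. -/
def IsStar (M : TrafficModel d m N E) : Prop :=
  (∀ j, M.e j ≠ 0) ∧ ∀ j k, j ≠ k → ¬ SameRay ℝ (M.e j) (M.e k)

/-! ### Deterministic trajectories and deterministic controls -/

/-- `y` solves `y(t) = x + ∫₀ᵗ f_γ(y(s), α(s)) ds` for `t ≥ 0`. -/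
def IsTrajectory (M : TrafficModel d m N E) (γ : E) (x : EuclideanSpace ℝ (Fin m))
    (α : ℝ → M.A) (y : ℝ → EuclideanSpace ℝ (Fin m)) : Prop :=
  ContinuousOn y (Ici 0) ∧
    ∀ t : ℝ, 0 ≤ t → y t = x + ∫ s in (0 : ℝ)..t, M.f γ (y s) (α s)

open Classical in
/-- The trajectory `y_γ(t; x, α)`, used for `t ≥ 0` only. For a bounded uniformly continuous and
one-sided Lipschitz field and a measurable control the solution exists and is unique. -/
noncomputable def traj (M : TrafficModel d m N E) (γ : E) (x : EuclideanSpace ℝ (Fin m))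
    (α : ℝ → M.A) : ℝ → EuclideanSpace ℝ (Fin m) :=
  if h : ∃ y, M.IsTrajectory γ x α y then h.choose else fun _ => x

/-- The deterministic feasible controls `𝒜_{γ,x}`: Borel controls (only their values at times
`t ≥ 0` matter) that keep the trajectory on the network. -/
def detCtrl (M : TrafficModel d m N E) (γ : E) (x : EuclideanSpace ℝ (Fin m)) :
    Set (ℝ → M.A) :=
  {α | Measurable α ∧ ∀ t : ℝ, 0 ≤ t → M.traj γ x α t ∈ M.network}

/-- The constant, locally admissible controls `A_{γ,x}`. -/
def localCtrl (M : TrafficModel d m N E) (γ : E) (x : EuclideanSpace ℝ (Fin m)) : Set M.A :=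
  {a | ∃ θ : ℝ, 0 < θ ∧ ∀ t ∈ Icc 0 θ, M.traj γ x (fun _ => a) t ∈ M.network}

/-! ### The controlled switched process

A policy is a map `α(t; x, γ)`; it is restarted from the current position and mode after each
jump. The process is built on the Hilbert cube, that is from a sequence of independent random
variables that are uniform on `[0,1]`: the variable `2n` produces the waiting time for the jump
`n + 1` and the variable `2n + 1` the mode after that jump. -/

/-- The law of a sequence of independent uniform random variables. -/
noncomputable def cubeMeasure : Measure (ℕ → unitInterval) :=
  Measure.infinitePi fun _ => (volume : Measure unitInterval)

/-- The probability that no jump occurs before `t`: `exp (- ∫₀ᵗ lam(y(s), γ, α(s)) ds)`. -/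
noncomputable def survival (M : TrafficModel d m N E) (γ : E) (x : EuclideanSpace ℝ (Fin m))
    (α : ℝ → M.A) (t : ℝ) : ℝ :=
  Real.exp (-∫ s in (0 : ℝ)..t, M.lam (M.traj γ x α s) γ (α s))

/-- The waiting time with survival function `survival`, as a function of a uniform variable; it is
`∞` when no jump occurs. -/
noncomputable def waitingTime (M : TrafficModel d m N E) (γ : E)
    (x : EuclideanSpace ℝ (Fin m)) (α : ℝ → M.A) (u : unitInterval) : ℝ≥0∞ :=
  ⨅ (t : ℝ≥0) (_ : M.survival γ x α t ≤ u), (t : ℝ≥0∞)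

open Classical in
/-- A mode with distribution `Q(x,γ,·,a)`, as a function of a uniform variable: the modes are
enumerated, and `[0,1]` is cut into consecutive intervals of lengths `Q(x,γ,γ₁,a)`. (The remaining
case of the definition, `u = 0`, has probability zero.) -/
noncomputable def postMode [Fintype E] (M : TrafficModel d m N E) (γ : E)
    (x : EuclideanSpace ℝ (Fin m)) (a : M.A) (u : unitInterval) : E :=
  let rank := Fintype.equivFin E
  if h : ∃ γ₁ : E, (∑ γ₂ with rank γ₂ < rank γ₁, M.Q x γ γ₂ a) < u ∧
      (u : ℝ) ≤ ∑ γ₂ with rank γ₂ ≤ rank γ₁, M.Q x γ γ₂ a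
  then h.choose else γ

/-- The jump times and the post-jump positions and modes `(τ_n, Y_n, Υ_n)`, starting from
`(0, x, γ)`. The position is not changed by a jump. Once `τ_n = ∞` the position and mode carry
no meaning and are never used. -/
noncomputable def jumpChain [Fintype E] (M : TrafficModel d m N E)
    (α : ℝ → EuclideanSpace ℝ (Fin m) → E → M.A) (x : EuclideanSpace ℝ (Fin m)) (γ : E)
    (ω : ℕ → unitInterval) : ℕ → ℝ≥0∞ × EuclideanSpace ℝ (Fin m) × E
  | 0 => (0, x, γ)
  | n + 1 =>
    let T := (M.jumpChain α x γ ω n).1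
    let Y := (M.jumpChain α x γ ω n).2.1
    let G := (M.jumpChain α x γ ω n).2.2
    let c : ℝ → M.A := fun t => α t Y G
    let σ := M.waitingTime G Y c (ω (2 * n))
    let Z := M.traj G Y c σ.toReal
    (T + σ, Z, M.postMode G Z (c σ.toReal) (ω (2 * n + 1)))

/-- The time `τ_n` of the jump number `n` (with `τ_0 = 0`). -/
noncomputable def jumpTime [Fintype E] (M : TrafficModel d m N E)
    (α : ℝ → EuclideanSpace ℝ (Fin m) → E → M.A) (x : EuclideanSpace ℝ (Fin m)) (γ : E)
    (ω : ℕ → unitInterval) (n : ℕ) : ℝ≥0∞ :=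
  (M.jumpChain α x γ ω n).1

/-- The position `Y_n` at the jump number `n`. -/
noncomputable def postPos [Fintype E] (M : TrafficModel d m N E)
    (α : ℝ → EuclideanSpace ℝ (Fin m) → E → M.A) (x : EuclideanSpace ℝ (Fin m)) (γ : E)
    (ω : ℕ → unitInterval) (n : ℕ) : EuclideanSpace ℝ (Fin m) :=
  (M.jumpChain α x γ ω n).2.1

/-- The mode `Υ_n` after the jump number `n`. -/
noncomputable def postJumpMode [Fintype E] (M : TrafficModel d m N E)
    (α : ℝ → EuclideanSpace ℝ (Fin m) → E → M.A) (x : EuclideanSpace ℝ (Fin m)) (γ : E)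
    (ω : ℕ → unitInterval) (n : ℕ) : E :=
  (M.jumpChain α x γ ω n).2.2

open Classical in
/-- The process `(X_t, Γ_t)`: on `[τ_n, τ_{n+1})` it follows the trajectory started at `Y_n` in the
mode `Υ_n`. (Jump times do not accumulate almost surely, because the rate is bounded; on the
exceptional event the initial state is returned.) -/
noncomputable def process [Fintype E] (M : TrafficModel d m N E)
    (α : ℝ → EuclideanSpace ℝ (Fin m) → E → M.A) (x : EuclideanSpace ℝ (Fin m)) (γ : E)
    (ω : ℕ → unitInterval) (t : ℝ) : EuclideanSpace ℝ (Fin m) × E :=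
  if h : ∃ n, M.jumpTime α x γ ω n ≤ ENNReal.ofReal t ∧
      ENNReal.ofReal t < M.jumpTime α x γ ω (n + 1)
  then
    let n := h.choose
    let Y := M.postPos α x γ ω n
    let G := M.postJumpMode α x γ ω n
    (M.traj G Y (fun s => α s Y G) (t - (M.jumpTime α x γ ω n).toReal), G)
  else (x, γ)

/-- The admissible policies `𝒜_ad`: Borel measurable (the finite set of modes being discrete), and
keeping the process on the network almost surely, for every initial state on the network. Only the
values of a policy at times `t ≥ 0` and positions on the network matter. -/
def admissible [Fintype E] (M : TrafficModel d m N E) :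
    Set (ℝ → EuclideanSpace ℝ (Fin m) → E → M.A) :=
  {α | (∀ γ, Measurable fun p : ℝ × EuclideanSpace ℝ (Fin m) => α p.1 p.2 γ) ∧
    ∀ x ∈ M.network, ∀ γ, ∀ᵐ ω ∂cubeMeasure, ∀ t : ℝ, 0 ≤ t →
      (M.process α x γ ω t).1 ∈ M.network}

/-! ### Value functions -/

/-- The deterministic value function `v₀`. -/
noncomputable def detValue (M : TrafficModel d m N E) (δ : ℝ)
    (x : EuclideanSpace ℝ (Fin m)) (γ : E) : ℝ :=
  ⨅ α : M.detCtrl γ x,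
    ∫ t in Ioi (0 : ℝ), Real.exp (-δ * t) * M.l γ (M.traj γ x α.1 t) (α.1 t)

open Classical in
/-- The cost of the policy `α` up to the first jump, followed by the terminal cost `v`:
`𝔼[∫₀^{τ₁} e^{-δt} l_γ(X_t, α(t;x,γ)) dt + e^{-δτ₁} v(Y₁,Υ₁)]`, where `e^{-δτ₁} = 0` if
`τ₁ = ∞`. -/
noncomputable def firstJumpCost [Fintype E] (M : TrafficModel d m N E) (δ : ℝ)
    (v : EuclideanSpace ℝ (Fin m) → E → ℝ) (x : EuclideanSpace ℝ (Fin m)) (γ : E)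
    (α : ℝ → EuclideanSpace ℝ (Fin m) → E → M.A) : ℝ :=
  ∫ ω, ((∫ t in {t : ℝ | 0 ≤ t ∧ ENNReal.ofReal t < M.jumpTime α x γ ω 1},
        Real.exp (-δ * t) * M.l γ (M.process α x γ ω t).1 (α t x γ)) +
      (if M.jumpTime α x γ ω 1 = ∞ then 0
        else Real.exp (-δ * (M.jumpTime α x γ ω 1).toReal) *
          v (M.postPos α x γ ω 1) (M.postJumpMode α x γ ω 1))) ∂cubeMeasure

/-- The iterated value functions `v_k`. -/
noncomputable def iterValue [Fintype E] (M : TrafficModel d m N E) (δ : ℝ) :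
    ℕ → EuclideanSpace ℝ (Fin m) → E → ℝ
  | 0 => M.detValue δ
  | k + 1 => fun x γ => ⨅ α : M.admissible, M.firstJumpCost δ (M.iterValue δ k) x γ α.1

/-! ### Regularity of the coefficients -/

/-- The fields `f_γ` are uniformly continuous, one-sided Lipschitz in `x`, and bounded. -/
def FieldRegular (M : TrafficModel d m N E) : Prop :=
  (∀ γ, UniformContinuous fun p : EuclideanSpace ℝ (Fin m) × M.A => M.f γ p.1 p.2) ∧
    ∃ C : ℝ, 0 < C ∧ ∀ γ x y a,
      inner ℝ (M.f γ x a - M.f γ y a) (x - y) ≤ C * ‖x - y‖ ^ 2 ∧ ‖M.f γ x a‖ ≤ C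

/-- The jump rate is nonnegative, uniformly continuous, Lipschitz in `x`, and bounded. -/
def RateRegular (M : TrafficModel d m N E) : Prop :=
  (∀ γ, UniformContinuous fun p : EuclideanSpace ℝ (Fin m) × M.A => M.lam p.1 γ p.2) ∧
    (∀ x γ a, 0 ≤ M.lam x γ a) ∧
    ∃ C : ℝ, 0 < C ∧ ∀ γ x y a,
      |M.lam x γ a - M.lam y γ a| ≤ C * ‖x - y‖ ∧ M.lam x γ a ≤ C

/-- `Q` is a stochastic matrix with zero diagonal, Lipschitz in `x` and measurable in `a`. -/
def TransitionRegular [Fintype E] (M : TrafficModel d m N E) : Prop :=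
  (∀ x γ γ₁ a, M.Q x γ γ₁ a ∈ Icc (0 : ℝ) 1) ∧
    (∀ x γ a, ∑ γ₁, M.Q x γ γ₁ a = 1) ∧
    (∀ x γ a, M.Q x γ γ a = 0) ∧
    (∀ x γ γ₁, Measurable fun a => M.Q x γ γ₁ a) ∧
    ∃ C : ℝ, 0 < C ∧ ∀ γ γ₁ x y a, |M.Q x γ γ₁ a - M.Q y γ γ₁ a| ≤ C * ‖x - y‖

/-- The running costs are uniformly continuous, Lipschitz in `x`, and bounded. -/
def CostRegular (M : TrafficModel d m N E) : Prop :=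
  (∀ γ, UniformContinuous fun p : EuclideanSpace ℝ (Fin m) × M.A => M.l γ p.1 p.2) ∧
    ∃ C : ℝ, 0 < C ∧ ∀ γ x y a,
      |M.l γ x a - M.l γ y a| ≤ C * ‖x - y‖ ∧ |M.l γ x a| ≤ C

/-! ### Controllability and compatibility -/

/-- The locally admissible constant controls on the open edges, at `O` and at the end points, and
inward controllability at the end points. -/
def CtrlStructure (M : TrafficModel d m N E) : Prop :=
  (∀ γ j, (M.edgeCtrl γ j).Nonempty) ∧
    (∀ γ j, ∀ x ∈ M.edge j, M.localCtrl γ x = M.edgeCtrl γ j) ∧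
    (∀ γ, M.localCtrl γ 0 =
      ⋃ j, {a | a ∈ M.edgeCtrl γ j ∧ ∃ r : ℝ, 0 ≤ r ∧ M.f γ 0 a = r • M.e j}) ∧
    (∀ γ j, M.localCtrl γ (M.e j) =
      {a | a ∈ M.edgeCtrl γ j ∧ inner ℝ (M.f γ (M.e j) a) (M.e j) ≤ 0}) ∧
    (∀ γ j, (M.localCtrl γ (M.e j)).Nonempty) ∧
    ∀ γ j, M.localCtrl γ (M.e j) = M.edgeCtrl γ j ∨
      ∃ β : ℝ, 0 < β ∧ ∃ a ∈ M.edgeCtrl γ j, inner ℝ (M.f γ (M.e j) a) (M.e j) < -β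

/-- Active case: both directions are available at `O` with positive speed. -/
def ActiveCtrl (M : TrafficModel d m N E) : Prop :=
  ∀ j, ∀ γ ∈ M.active j, ∃ β : ℝ, 0 < β ∧
    ∃ a₁ ∈ M.edgeCtrl γ j, ∃ a₂ ∈ M.edgeCtrl γ j,
      β < inner ℝ (M.f γ 0 a₁) (M.e j) ∧ inner ℝ (M.f γ 0 a₂) (M.e j) < -β

/-- Inactive case: near `O` no control moves away from `O`, some control leads to `O` fast enough,
and some control stays at `O`. -/
def InactiveCtrl (M : TrafficModel d m N E) : Prop :=
  ∀ j, ∀ γ ∉ M.active j, ∃ β η κ : ℝ, 0 < β ∧ 0 < η ∧ η < 1 ∧ 0 ≤ κ ∧ κ < 1 ∧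
    (∃ a₁ ∈ M.edgeCtrl γ j, ∀ x ∈ M.edge j, ‖x‖ ≤ η →
      inner ℝ (M.f γ x a₁) (M.e j) ≤ -β * (inner ℝ x (M.e j)) ^ κ) ∧
    (∃ a₀ ∈ M.edgeCtrl γ j, M.f γ 0 a₀ = 0) ∧
    ∀ a ∈ M.edgeCtrl γ j, ∀ x ∈ M.edge j, ‖x‖ ≤ η → inner ℝ (M.f γ x a) (M.e j) ≤ 0

/-- On an inactive edge, the cost at `O` does not depend on the control of that edge. -/
def CostCompatible (M : TrafficModel d m N E) : Prop :=
  ∀ j, ∀ γ ∉ M.active j, ∀ a ∈ M.edgeCtrl γ j, ∀ b ∈ M.edgeCtrl γ j, M.l γ 0 a = M.l γ 0 b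

/-- On an inactive edge, the jump rate and the transition matrix at `O` do not depend on the
control of that edge. -/
def JumpCompatible (M : TrafficModel d m N E) : Prop :=
  ∀ j, ∀ γ ∉ M.active j, ∀ a ∈ M.edgeCtrl γ j, ∀ b ∈ M.edgeCtrl γ j,
    M.lam 0 γ a = M.lam 0 γ b ∧ ∀ γ₁, M.Q 0 γ γ₁ a = M.Q 0 γ γ₁ b

/-- From a point of the open edge `j`, admissible policies take values in `A^{γ,j}` during a short
initial period of time. -/
def EdgeAdmissible [Fintype E] (M : TrafficModel d m N E) : Prop :=
  ∀ j γ, ∀ x ∈ M.edge j, ∃ θ : ℝ, 0 < θ ∧ ∀ α ∈ M.admissible,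
    ∀ᵐ t ∂(volume.restrict (Icc (0 : ℝ) θ)), α t x γ ∈ M.edgeCtrl γ j

end TrafficModel

/-! A single continuity theorem, `continuousOn_discValue`, serves every stage. It concerns a
deterministic control problem whose discount rate and running cost may depend on position and
control. The function v_0 is of this kind, with rate δ and cost l_γ. For v_{k+1}, the first jump
time has the density λ exp(-∫λ) along the trajectory and the new mode has the law Q, so that the
expectation becomes a deterministic discounted cost with rate δ + λ and running cost l + λ Σ Q v_k
(`firstJumpCost_eq`). The infimum over policies is the infimum over feasible controls, because the
slices at (x,γ) of admissible policies are exactly the feasible controls. Indeed the process follows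
the deterministic trajectory until the first jump, which exceeds any given time with positive
probability (`detCtrl_of_admissible`); conversely a Borel feasible policy exists and may be altered
at one state (`exists_admissible_extending`). Continuity thus passes from v_k to v_{k+1}, and it is
uniform because the network is compact and E is finite.

Continuity of the deterministic value is local to an edge. To compare the points r e_j and s e_j, a
control feasible from the first is also applied from the second. It acts on both as a
one-dimensional control, since almost all its values lie in A^{γ,j} while the trajectory is on the
edge away from O (`ctrlOnEdges`). The one-sided Lipschitz condition keeps the trajectories close on
bounded time intervals (`AEDeriv.norm_sub_sq_le`), and discounting makes late times harmless.
Copying stops when either trajectory reaches O, or when the second reaches e_j and some control of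
the edge is forbidden there. What remains is to compare the values at two close points, one of which
is an end point (`exists_endpoint_modulus`).

This is where controllability enters. If one point is reached from the other in a short time, the
values differ in one direction by at most a multiple of that time (`discValue_le_of_reach`). The
speed is bounded away from zero in the active case and at e_j; in the inactive case a speed of at
least a multiple of r^κ towards O, with κ < 1, needs only a time of order r^(1-κ). The exception is
an inactive edge seen from O, along which O cannot be left. There the comparison control stays at O,
while the competing trajectory cannot move further away from O than it started; as rates and costs
at O do not depend on the control of the edge, both costs are nearly equal until the competitor
arrives at O (`value_zero_le_of_inactive`). -/

/-! ### Lipschitz curves with prescribed derivative almost everywhere -/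

section Curves

open Filter Topology

/-- `y` is `K`-Lipschitz on `[a,b]` and has the derivative `w` almost everywhere there. -/
def AEDeriv {H : Type*} [NormedAddCommGroup H] [NormedSpace ℝ H] (y w : ℝ → H) (K : ℝ≥0)
    (a b : ℝ) : Prop :=
  LipschitzOnWith K y (Icc a b) ∧ ∀ᵐ t, t ∈ Ioo a b → HasDerivAt y (w t) t

/-- The fundamental theorem of calculus for absolutely continuous functions. All later differential
inequalities, with measurable controls and hence only almost everywhere derivatives, reduce to it.
-/
lemma le_of_ae_hasDerivAt_nonpos {u : ℝ → ℝ} {a b : ℝ} (hab : a ≤ b)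
    (hu : AbsolutelyContinuousOnInterval u a b)
    (h : ∀ᵐ t, t ∈ Ioo a b → ∃ d ≤ 0, HasDerivAt u d t) : u b ≤ u a := by
  have h1 := hu.integral_deriv_eq_sub
  have h2 : ∫ x in a..b, deriv u x ≤ 0 := by
    rw [intervalIntegral.integral_of_le hab, integral_Ioc_eq_integral_Ioo]
    apply integral_nonpos_of_ae
    rw [Filter.EventuallyLE, ae_restrict_iff' measurableSet_Ioo]
    filter_upwards [h] with t ht hmem
    obtain ⟨d, hd, hd'⟩ := ht hmem
    rw [hd'.deriv]; exact hd
  linarith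

variable {H : Type*} [NormedAddCommGroup H] [NormedSpace ℝ H]

namespace AEDeriv

variable {y w : ℝ → H} {K : ℝ≥0} {a b : ℝ}

lemma continuousOn (h : AEDeriv y w K a b) : ContinuousOn y (Icc a b) := h.1.continuousOn

lemma mono (h : AEDeriv y w K a b) {a' b' : ℝ} (ha : a ≤ a') (hb : b' ≤ b) :
    AEDeriv y w K a' b' :=
  ⟨h.1.mono (Icc_subset_Icc ha hb), h.2.mono fun _ ht hm => ht (Ioo_subset_Ioo ha hb hm)⟩

lemma congr_deriv {w' : ℝ → H} (h : AEDeriv y w K a b)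
    (hw : ∀ᵐ t, t ∈ Ioo a b → w t = w' t) : AEDeriv y w' K a b :=
  ⟨h.1, by filter_upwards [h.2, hw] with t h1 h2 hm; rw [← h2 hm]; exact h1 hm⟩

lemma comp_add_left (h : AEDeriv y w K a b) (s : ℝ) :
    AEDeriv (fun t => y (s + t)) (fun t => w (s + t)) K (a - s) (b - s) := by
  refine ⟨?_, ?_⟩
  · rw [lipschitzOnWith_iff_dist_le_mul]
    intro t ht t' ht'
    have := h.1.dist_le_mul (s + t) (by constructor <;> linarith [ht.1, ht.2]) (s + t')
      (by constructor <;> linarith [ht'.1, ht'.2])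
    simpa using this
  · have := (measurePreserving_add_left volume s).quasiMeasurePreserving.ae h.2
    filter_upwards [this] with t ht hm
    exact (ht (by constructor <;> linarith [hm.1, hm.2])).comp_const_add s t

lemma of_integral {T : ℝ} {x : H} [CompleteSpace H] (hw : IntervalIntegrable w volume 0 T)
    (hT : 0 ≤ T)
    (hb : ∀ t, ‖w t‖ ≤ K) (hy : ∀ t ∈ Icc 0 T, y t = x + ∫ s in (0 : ℝ)..t, w s) :
    AEDeriv y w K 0 T := by
  have hii : ∀ s ∈ Icc 0 T, IntervalIntegrable w volume 0 s := fun s hs =>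
    hw.mono_set (by rw [uIcc_of_le hT, uIcc_of_le hs.1]; exact Icc_subset_Icc_right hs.2)
  refine ⟨?_, ?_⟩
  · rw [lipschitzOnWith_iff_dist_le_mul]
    intro s hs t ht
    rw [hy s hs, hy t ht, dist_add_left, dist_eq_norm,
      intervalIntegral.integral_interval_sub_left (hii s hs) (hii t ht)]
    exact intervalIntegral.norm_integral_le_of_norm_le_const fun r _ => hb r
  · filter_upwards [hw.ae_hasDerivAt_integral] with t ht hm
    have h1 := (ht (by rw [uIcc_of_le hT]; exact Ioo_subset_Icc_self hm) 0
      (by simp)).const_add x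
    refine h1.congr_of_eventuallyEq ?_
    filter_upwards [isOpen_Ioo.mem_nhds hm] with s hs
    exact hy s (Ioo_subset_Icc_self hs)

lemma absolutelyContinuous (h : AEDeriv y w K a b) (hab : a ≤ b) :
    AbsolutelyContinuousOnInterval y a b := by
  have := h.1
  rw [← uIcc_of_le hab] at this
  exact this.absolutelyContinuousOnInterval

/-- The difference between `y` and the primitive of `w` is absolutely continuous with derivative
zero almost everywhere, hence constant. -/
lemma eq_integral {T : ℝ} [CompleteSpace H] (h : AEDeriv y w K 0 T)
    (hw : IntervalIntegrable w volume 0 T) (hb : ∀ t, ‖w t‖ ≤ K) {t : ℝ} (ht : t ∈ Icc 0 T) :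
    y t = y 0 + ∫ s in (0 : ℝ)..t, w s := by
  have hT : 0 ≤ T := ht.1.trans ht.2
  have h2 := AEDeriv.of_integral (y := fun t => y 0 + ∫ s in (0 : ℝ)..t, w s) hw hT hb
    (fun t _ => rfl)
  have h3 := (h.absolutelyContinuous hT).sub (h2.absolutelyContinuous hT)
  obtain ⟨C, hC⟩ := h3.const_of_ae_hasDerivAt_zero (by
    have h0 : ∀ᵐ t : ℝ, t ≠ 0 := by simp [ae_iff]
    have hT' : ∀ᵐ t : ℝ, t ≠ T := by simp [ae_iff]
    filter_upwards [h.2, h2.2, h0, hT'] with s e1 e2 n1 n2 hs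
    rw [uIcc_of_le hT] at hs
    have hs' : s ∈ Ioo 0 T := ⟨lt_of_le_of_ne hs.1 (Ne.symm n1), lt_of_le_of_ne hs.2 n2⟩
    simpa using (e1 hs').sub (e2 hs'))
  have c0 := hC 0 (by simp)
  have ct := hC t (by rwa [uIcc_of_le hT])
  rw [← c0] at ct
  simp only [Pi.sub_apply, intervalIntegral.integral_same, add_zero, sub_self] at ct
  exact sub_eq_zero.1 ct

end AEDeriv

/-- Grönwall: exp(-2Cs) ‖y₁ - y₂‖² - 2cs does not increase. The defect `c` allows approximate
solutions; `c = 0` gives uniqueness and dependence on the initial point. -/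
lemma AEDeriv.norm_sub_sq_le {H : Type*} [NormedAddCommGroup H] [InnerProductSpace ℝ H]
    {y₁ y₂ w₁ w₂ : ℝ → H} {K₁ K₂ : ℝ≥0} {T C c : ℝ}
    (h₁ : AEDeriv y₁ w₁ K₁ 0 T) (h₂ : AEDeriv y₂ w₂ K₂ 0 T) (hC : 0 ≤ C) (hc : 0 ≤ c)
    (hd : ∀ᵐ t, t ∈ Ioo 0 T →
      inner ℝ (w₁ t - w₂ t) (y₁ t - y₂ t) ≤ C * ‖y₁ t - y₂ t‖ ^ 2 + c) {t : ℝ}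
    (ht : t ∈ Icc 0 T) :
    ‖y₁ t - y₂ t‖ ^ 2 ≤ Real.exp (2 * C * t) * (‖y₁ 0 - y₂ 0‖ ^ 2 + 2 * c * t) := by
  set u : ℝ → ℝ := fun s => Real.exp (-(2 * C * s)) * ‖y₁ s - y₂ s‖ ^ 2 - 2 * c * s with hu
  have hlip : LipschitzOnWith (K₁ + K₂) (fun s => ‖y₁ s - y₂ s‖) (Icc 0 t) := by
    have := (LipschitzOnWith.sub (h₁.1) (h₂.1)).mono (Icc_subset_Icc_right ht.2)
    simpa [Function.comp_def] using (lipschitzWith_one_norm (E := H)).comp_lipschitzOnWith this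
  have hac : AbsolutelyContinuousOnInterval (fun s => ‖y₁ s - y₂ s‖) 0 t := by
    rw [← uIcc_of_le ht.1] at hlip
    exact hlip.absolutelyContinuousOnInterval
  have hexp : AbsolutelyContinuousOnInterval (fun s => Real.exp (-(2 * C * s))) 0 t := by
    apply ContDiffOn.absolutelyContinuousOnInterval
    fun_prop
  have hlin : AbsolutelyContinuousOnInterval (fun s : ℝ => 2 * c * s) 0 t := by
    apply ContDiffOn.absolutelyContinuousOnInterval
    fun_prop
  have huac : AbsolutelyContinuousOnInterval u 0 t := by
    have := (hexp.fun_mul (hac.fun_mul hac)).sub hlin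
    have e : u = (fun s => Real.exp (-(2 * C * s)) * (‖y₁ s - y₂ s‖ * ‖y₁ s - y₂ s‖)) -
        fun s => 2 * c * s := by
      funext s
      simp only [hu, Pi.sub_apply, sq]
    rw [e]
    exact this
  have hmain : u t ≤ u 0 := by
    refine le_of_ae_hasDerivAt_nonpos ht.1 huac ?_
    filter_upwards [h₁.2, h₂.2, hd] with s e1 e2 e3 hs
    have hs' : s ∈ Ioo 0 T := ⟨hs.1, hs.2.trans_le ht.2⟩
    have d1 := ((e1 hs').sub (e2 hs')).norm_sq
    have d2 : HasDerivAt (fun s => Real.exp (-(2 * C * s)))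
        (Real.exp (-(2 * C * s)) * (-(2 * C * 1))) s :=
      (((hasDerivAt_id s).const_mul (2 * C)).neg).exp
    have d3 := (d2.mul d1).sub ((hasDerivAt_id s).const_mul (2 * c))
    refine ⟨_, ?_, d3⟩
    have e4 := e3 hs'
    have hE : 0 < Real.exp (-(2 * C * s)) := Real.exp_pos _
    have hE1 : Real.exp (-(2 * C * s)) ≤ 1 := by
      rw [Real.exp_le_one_iff]
      have := mul_nonneg hC hs.1.le
      linarith
    simp only [Pi.sub_apply]
    rw [real_inner_comm] at e4
    have := mul_le_mul_of_nonneg_left e4 hE.le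
    nlinarith [mul_le_mul_of_nonneg_right hE1 hc]
  simp only [hu, mul_zero, neg_zero, Real.exp_zero, one_mul, sub_zero] at hmain
  have h5 : ‖y₁ t - y₂ t‖ ^ 2
      = Real.exp (2 * C * t) * (Real.exp (-(2 * C * t)) * ‖y₁ t - y₂ t‖ ^ 2) := by
    rw [← mul_assoc, ← Real.exp_add]; simp
  rw [h5]
  apply mul_le_mul_of_nonneg_left _ (Real.exp_pos _).le
  linarith

/-- A curve cannot cross a level upwards if it does not increase above that level. -/
lemma AEDeriv.le_of_nonpos_above {ζ w : ℝ → ℝ} {K : ℝ≥0} {T b : ℝ} (h : AEDeriv ζ w K 0 T)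
    (h0 : ζ 0 ≤ b) (hw : ∀ᵐ t, t ∈ Ioo 0 T → b < ζ t → w t ≤ 0) {t : ℝ} (ht : t ∈ Icc 0 T) :
    ζ t ≤ b := by
  by_contra! hlt
  have hcl : IsClosed (Icc 0 t ∩ ζ ⁻¹' Iic b) :=
    (h.continuousOn.mono (Icc_subset_Icc_right ht.2)).preimage_isClosed_of_isClosed
      isClosed_Icc isClosed_Iic
  have hne : (Icc 0 t ∩ ζ ⁻¹' Iic b).Nonempty := ⟨0, ⟨le_rfl, ht.1⟩, h0⟩
  have hbdd : BddAbove (Icc 0 t ∩ ζ ⁻¹' Iic b) := bddAbove_Icc.mono inter_subset_left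
  -- The supremum is the last time before `t` at which the curve is at most `b`. From there to `t`
  -- the curve lies above `b`, so it does not increase, contrary to `b < ζ t`.
  have hs := hcl.csSup_mem hne hbdd
  set s := sSup (Icc 0 t ∩ ζ ⁻¹' Iic b)
  have hst : s ≤ t := hs.1.2
  have habove : ∀ r ∈ Ioc s t, b < ζ r := by
    intro r hr
    by_contra! hr'
    exact absurd (le_csSup hbdd ⟨⟨hs.1.1.trans hr.1.le, hr.2⟩, hr'⟩) (not_le.2 hr.1)
  have : ζ t ≤ ζ s := by
    refine le_of_ae_hasDerivAt_nonpos hst ((h.mono hs.1.1 ht.2).absolutelyContinuous hst) ?_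
    filter_upwards [h.2, hw] with r e1 e2 hr
    have hr' : r ∈ Ioo 0 T := ⟨hs.1.1.trans_lt hr.1, hr.2.trans_le ht.2⟩
    exact ⟨w r, e2 hr' (habove r ⟨hr.1, hr.2.le⟩), e1 hr'⟩
  exact absurd (this.trans hs.2) (not_le.2 hlt)

lemma AEDeriv.neg {ζ w : ℝ → ℝ} {K : ℝ≥0} {a b : ℝ} (h : AEDeriv ζ w K a b) :
    AEDeriv (fun t => -ζ t) (fun t => -w t) K a b :=
  ⟨by have := h.1
      rw [lipschitzOnWith_iff_dist_le_mul] at this ⊢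
      intro s hs t ht
      simpa [dist_neg_neg] using this s hs t ht,
    by filter_upwards [h.2] with t ht hm using (ht hm).neg⟩

lemma AEDeriv.ge_of_nonneg_below {ζ w : ℝ → ℝ} {K : ℝ≥0} {T b : ℝ} (h : AEDeriv ζ w K 0 T)
    (h0 : b ≤ ζ 0) (hw : ∀ᵐ t, t ∈ Ioo 0 T → ζ t < b → 0 ≤ w t) {t : ℝ} (ht : t ∈ Icc 0 T) :
    b ≤ ζ t := by
  have := h.neg.le_of_nonpos_above (b := -b) (by linarith)
    (by filter_upwards [hw] with r hr h1 h2; linarith [hr h1 (by linarith)]) ht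
  linarith

/-- Along a curve, the derivative vanishes almost everywhere on a level set. -/
lemma AEDeriv.ae_eq_zero_of_level {y w : ℝ → H} {K : ℝ≥0} {a b : ℝ} (h : AEDeriv y w K a b)
    (p : H) : ∀ᵐ t, t ∈ Ioo a b → y t = p → w t = 0 := by
  -- Only countably many points of the level set are isolated from the right in it. At any other
  -- point the derivative is the limit of slopes along the level set, and these vanish.
  have hcount : {t ∈ {t | t ∈ Ioo a b ∧ y t = p} |
      𝓝[{t | t ∈ Ioo a b ∧ y t = p} ∩ Ioi t] t = ⊥}.Countable :=
    countable_setOfPred_isolated_right_within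
  filter_upwards [h.2, hcount.ae_notMem volume] with t e1 e2 hm hp
  have hne : (𝓝[{t | t ∈ Ioo a b ∧ y t = p} ∩ Ioi t] t).NeBot := by
    rw [neBot_iff]
    intro hbot
    exact e2 ⟨⟨hm, hp⟩, hbot⟩
  have hslope := (hasDerivAt_iff_tendsto_slope.1 (e1 hm)).mono_left
    (nhdsWithin_mono t (show {t | t ∈ Ioo a b ∧ y t = p} ∩ Ioi t ⊆ {t}ᶜ from
      fun s hs => ne_of_gt hs.2))
  refine tendsto_nhds_unique hslope (tendsto_const_nhds.congr' ?_)
  filter_upwards [self_mem_nhdsWithin] with s hs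
  simp [slope, hs.1.2, hp]

lemma intervalIntegrable_of_bounded {H : Type*} [NormedAddCommGroup H] [MeasurableSpace H]
    [BorelSpace H] [SecondCountableTopology H] {C : ℝ≥0} {w : ℝ → H} (hw : Measurable w) (hb : ∀ t, ‖w t‖ ≤ C)
    (a b : ℝ) : IntervalIntegrable w volume a b := by
  rw [intervalIntegrable_iff]
  exact Measure.integrableOn_of_bounded (M := C) (by simp) hw.aestronglyMeasurable
    (Eventually.of_forall hb)

/-! ### Existence for dissipative equations with measurable time dependence -/

section Existence

variable {H : Type*} [NormedAddCommGroup H] [InnerProductSpace ℝ H] [MeasurableSpace H]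
  [BorelSpace H] [SecondCountableTopology H] {F : ℝ → H → H} {C : ℝ≥0}

/-- Here `u` is the step function of the nodes k h, and `y` integrates the field frozen at `u`.
Between two nodes `y` moves by at most `C * h`. -/
lemma exists_euler_polygon (hmeas : Measurable (Function.uncurry F)) (hb : ∀ t x, ‖F t x‖ ≤ C)
    (x₀ : H) {h : ℝ} (hh : 0 < h) : ∃ u y : ℝ → H, Measurable u ∧
      (∀ t, y t = x₀ + ∫ s in (0 : ℝ)..t, F s (u s)) ∧ ∀ t, 0 ≤ t → ‖u t - y t‖ ≤ C * h := by
  let p : ℕ → H := fun k => Nat.rec x₀ (fun k q =>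
    q + ∫ s in ((k : ℝ) * h)..((k + 1 : ℕ) * h), F s q) k
  have hp : ∀ k : ℕ, p (k + 1) = p k + ∫ s in ((k : ℝ) * h)..((k + 1 : ℕ) * h), F s (p k) :=
    fun k => rfl
  let u : ℝ → H := fun s => p ⌊s / h⌋₊
  have hu : Measurable u :=
    (measurable_from_nat (f := p)).comp (Nat.measurable_floor.comp (measurable_id.div_const h))
  have hFu : Measurable fun s => F s (u s) := hmeas.comp (measurable_id.prodMk hu)
  have hii : ∀ a b, IntervalIntegrable (fun s => F s (u s)) volume a b :=
    intervalIntegrable_of_bounded hFu fun s => hb s _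
  have hnode : ∀ k : ℕ, x₀ + ∫ s in (0 : ℝ)..(k * h), F s (u s) = p k := by
    intro k
    induction k with
    | zero => simp [p]
    | succ k ih =>
      rw [hp, ← ih, ← intervalIntegral.integral_add_adjacent_intervals (hii 0 (k * h)) (hii _ _),
        add_assoc, ih]
      congr 2
      have hle : (k : ℝ) * h ≤ (k + 1 : ℕ) * h := by push_cast; nlinarith
      rw [intervalIntegral.integral_of_le hle, intervalIntegral.integral_of_le hle,
        integral_Ioc_eq_integral_Ioo, integral_Ioc_eq_integral_Ioo]
      refine setIntegral_congr_fun measurableSet_Ioo fun s hs => ?_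
      have : ⌊s / h⌋₊ = k := by
        rw [Nat.floor_eq_iff (div_nonneg ((by positivity : (0 : ℝ) ≤ k * h).trans hs.1.le) hh.le),
          le_div_iff₀ hh, div_lt_iff₀ hh]
        exact ⟨hs.1.le, by simpa using hs.2⟩
      simp only [u, this]
  refine ⟨u, fun t => x₀ + ∫ s in (0 : ℝ)..t, F s (u s), hu, fun t => rfl, fun t ht => ?_⟩
  have h1 : ((⌊t / h⌋₊ : ℕ) : ℝ) * h ≤ t := by
    rw [← le_div_iff₀ hh]; exact Nat.floor_le (div_nonneg ht hh.le)
  have h2 : t < (⌊t / h⌋₊ + 1) * h := by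
    rw [← div_lt_iff₀ hh]; exact Nat.lt_floor_add_one _
  change ‖p ⌊t / h⌋₊ - (x₀ + ∫ s in (0 : ℝ)..t, F s (u s))‖ ≤ C * h
  rw [← hnode, add_sub_add_left_eq_sub,
    intervalIntegral.integral_interval_sub_left (hii _ _) (hii _ _)]
  refine (intervalIntegral.norm_integral_le_of_norm_le_const fun r _ => hb r _).trans ?_
  rw [abs_sub_comm, abs_of_nonneg (sub_nonneg.2 h1)]
  exact mul_le_mul_of_nonneg_left (by linarith) C.2

/-- The field need not be Lipschitz in the position, so Picard iteration is not available. Instead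
the one-sided condition makes the Euler polygons of step 1/(n+1) a Cauchy sequence at each time, and
dominated convergence passes to the limit in the integral equation. -/
theorem exists_integral_solution [CompleteSpace H] (hmeas : Measurable (Function.uncurry F))
    (hb : ∀ t x, ‖F t x‖ ≤ C)
    (hos : ∀ t x y, inner ℝ (F t x - F t y) (x - y) ≤ C * ‖x - y‖ ^ 2)
    (hmod : ∀ ε > 0, ∃ ρ > 0, ∀ t x y, ‖x - y‖ ≤ ρ → ‖F t x - F t y‖ ≤ ε) (x₀ : H) :
    ∃ y : ℝ → H, ContinuousOn y (Ici 0) ∧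
      ∀ t, 0 ≤ t → y t = x₀ + ∫ s in (0 : ℝ)..t, F s (y s) := by
  have hstep : ∀ n : ℕ, (0 : ℝ) < 1 / ((n : ℝ) + 1) := fun n => Nat.one_div_pos_of_nat
  choose u y hu hy huy using fun n : ℕ => exists_euler_polygon hmeas hb x₀ (hstep n)
  have hFu : ∀ n, Measurable fun s => F s (u n s) := fun n =>
    hmeas.comp (measurable_id.prodMk (hu n))
  have hii : ∀ n a b, IntervalIntegrable (fun s => F s (u n s)) volume a b := fun n =>
    intervalIntegrable_of_bounded (hFu n) fun s => hb s _
  have hcurve : ∀ n T, 0 ≤ T → AEDeriv (y n) (fun s => F s (u n s)) C 0 T := fun n T hT =>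
    AEDeriv.of_integral (hii n 0 T) hT (fun s => hb s _) fun t _ => hy n t
  have hstep0 : Tendsto (fun n : ℕ => (C : ℝ) * (1 / ((n : ℝ) + 1))) atTop (𝓝 0) := by
    simpa using (tendsto_one_div_add_atTop_nhds_zero_nat (𝕜 := ℝ)).const_mul (C : ℝ)
  have hcauchy : ∀ t, 0 ≤ t → CauchySeq fun n => y n t := by
    intro t ht
    rw [Metric.cauchySeq_iff']
    intro ε hε
    -- The Grönwall bound is at most κ r². The summand 1 gives κ ≥ 1, so that κ r = ε/2 forces r ≤
    -- ε/2 and κ r² < ε².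
    set κ : ℝ := Real.exp (2 * (C + 1) * t) * (2 * t) + 1 with hκ
    have hκ0 : 0 < κ := by positivity
    set r : ℝ := ε / (2 * κ) with hr
    have hr0 : 0 < r := by positivity
    obtain ⟨ρ, hρ, hFρ⟩ := hmod r hr0
    obtain ⟨n₀, hn₀⟩ := (hstep0.eventually (ge_mem_nhds hρ)).exists_forall_of_atTop
    refine ⟨n₀, fun n hn => ?_⟩
    -- Evaluating the field at `u` rather than at `y` costs at most `r` for each polygon. The
    -- resulting term 2r‖d‖ is at most ‖d‖² + r², whence the constants `C + 1` and `r ^ 2`.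
    have hd := (hcurve n t ht).norm_sub_sq_le (hcurve n₀ t ht) (C := C + 1) (c := r ^ 2)
      (by positivity) (by positivity) (Eventually.of_forall fun s hs => ?_)
      (t := t) ⟨ht, le_rfl⟩
    · rw [hy n 0, hy n₀ 0] at hd
      simp only [intervalIntegral.integral_same, sub_self, norm_zero] at hd
      rw [dist_eq_norm]
      have h1 : ‖y n t - y n₀ t‖ ^ 2 ≤ κ * r ^ 2 := by
        refine hd.trans ?_
        rw [hκ]
        nlinarith [sq_nonneg r]
      have h2 : κ * r ^ 2 < ε ^ 2 := by
        have h3 : (1 : ℝ) ≤ κ := by rw [hκ]; linarith [show 0 ≤ Real.exp (2 * (C + 1) * t) * (2 * t) by positivity]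
        have h4 : κ * r = ε / 2 := by rw [hr]; field_simp
        have h5 : r ≤ κ * r := le_mul_of_one_le_left hr0.le h3
        nlinarith
      exact lt_of_pow_lt_pow_left₀ 2 hε.le (h1.trans_lt h2)
    · have e1 : ‖F s (u n s) - F s (y n s)‖ ≤ r :=
        hFρ s _ _ ((huy n s hs.1.le).trans (hn₀ n hn))
      have e2 : ‖F s (u n₀ s) - F s (y n₀ s)‖ ≤ r :=
        hFρ s _ _ ((huy n₀ s hs.1.le).trans (hn₀ n₀ le_rfl))
      have e3 := hos s (y n s) (y n₀ s)
      set d := y n s - y n₀ s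
      have e4 : F s (u n s) - F s (u n₀ s) = (F s (y n s) - F s (y n₀ s)) +
          ((F s (u n s) - F s (y n s)) - (F s (u n₀ s) - F s (y n₀ s))) := by abel
      rw [e4, inner_add_left]
      have e5 := real_inner_le_norm
        ((F s (u n s) - F s (y n s)) - (F s (u n₀ s) - F s (y n₀ s))) d
      have e6 := norm_sub_le (F s (u n s) - F s (y n s)) (F s (u n₀ s) - F s (y n₀ s))
      nlinarith [norm_nonneg d, sq_nonneg (‖d‖ - r)]
  choose! z hz using fun t ht => cauchySeq_tendsto_of_complete (hcauchy t ht)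
  have huz : ∀ t, 0 ≤ t → Tendsto (fun n => u n t) atTop (𝓝 (z t)) := by
    intro t ht
    have h1 : Tendsto (fun n => u n t - y n t) atTop (𝓝 0) :=
      squeeze_zero_norm (fun n => huy n t ht) hstep0
    simpa using h1.add (hz t ht)
  have hFcont : ∀ t, Continuous (F t) := by
    intro t
    rw [Metric.continuous_iff]
    intro b ε hε
    obtain ⟨ρ, hρ, h⟩ := hmod (ε / 2) (half_pos hε)
    refine ⟨ρ, hρ, fun a ha => ?_⟩
    rw [dist_eq_norm] at ha ⊢
    linarith [h t a b ha.le]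
  refine ⟨z, ?_, fun t ht => ?_⟩
  · refine LipschitzOnWith.continuousOn (K := C) (LipschitzOnWith.of_dist_le_mul
      fun s hs t ht => ?_)
    refine le_of_tendsto ((hz s hs).dist (hz t ht)) (Eventually.of_forall fun n => ?_)
    exact (hcurve n (max s t) (le_max_of_le_left hs)).1.dist_le_mul s ⟨hs, le_max_left _ _⟩ t
      ⟨ht, le_max_right _ _⟩
  · refine tendsto_nhds_unique (hz t ht) ?_
    simp_rw [hy]
    refine tendsto_const_nhds.add ?_
    refine intervalIntegral.tendsto_integral_filter_of_dominated_convergence (fun _ => (C : ℝ))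
      (Eventually.of_forall fun n => (hFu n).aestronglyMeasurable)
      (Eventually.of_forall fun n => Eventually.of_forall fun s _ => hb s _)
      intervalIntegrable_const (Eventually.of_forall fun s hs => ?_)
    rw [uIoc_of_le ht] at hs
    exact ((hFcont s).tendsto _).comp (huz s hs.1.le)

end Existence

end Curves

namespace TrafficModel

section Trajectories

open Filter Topology

variable {d m N : ℕ} {E : Type*} {M : TrafficModel d m N E}

/-! ### Trajectories -/

/-- A constant in the assumptions on the vector fields. -/
noncomputable def FieldRegular.const (hf : M.FieldRegular) : ℝ≥0 := hf.2.choose.toNNReal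

lemma FieldRegular.inner_le (hf : M.FieldRegular) (γ : E) (x y : EuclideanSpace ℝ (Fin m))
    (a : M.A) :
    inner ℝ (M.f γ x a - M.f γ y a) (x - y) ≤ hf.const * ‖x - y‖ ^ 2 := by
  rw [FieldRegular.const, Real.coe_toNNReal _ hf.2.choose_spec.1.le]
  exact (hf.2.choose_spec.2 γ x y a).1

lemma FieldRegular.norm_le (hf : M.FieldRegular) (γ : E) (x : EuclideanSpace ℝ (Fin m))
    (a : M.A) : ‖M.f γ x a‖ ≤ hf.const := by
  rw [FieldRegular.const, Real.coe_toNNReal _ hf.2.choose_spec.1.le]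
  exact (hf.2.choose_spec.2 γ x x a).2

lemma FieldRegular.continuous (hf : M.FieldRegular) (γ : E) :
    Continuous fun p : EuclideanSpace ℝ (Fin m) × M.A => M.f γ p.1 p.2 :=
  (hf.1 γ).continuous

lemma FieldRegular.continuous_left (hf : M.FieldRegular) (γ : E) (a : M.A) :
    Continuous fun x => M.f γ x a :=
  (hf.continuous γ).comp (continuous_id.prodMk continuous_const)

lemma FieldRegular.modulus (hf : M.FieldRegular) (γ : E) {ε : ℝ} (hε : 0 < ε) :
    ∃ ρ > 0, ∀ x y a, ‖x - y‖ ≤ ρ → ‖M.f γ x a - M.f γ y a‖ ≤ ε := by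
  obtain ⟨ρ, hρ, h⟩ := Metric.uniformContinuous_iff.1 (hf.1 γ) ε hε
  refine ⟨ρ / 2, half_pos hρ, fun x y a hxy => ?_⟩
  rw [← dist_eq_norm]
  refine (h (a := (x, a)) (b := (y, a)) ?_).le
  rw [Prod.dist_eq, dist_self, dist_eq_norm]
  exact (max_le hxy (half_pos hρ).le).trans_lt (half_lt_self hρ)

lemma measurable_field (hf : M.FieldRegular) (γ : E) {y : ℝ → EuclideanSpace ℝ (Fin m)}
    (hy : Measurable y) {α : ℝ → M.A} (hα : Measurable α) :
    Measurable fun t => M.f γ (y t) (α t) :=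
  (hf.continuous γ).measurable.comp (hy.prodMk hα)

/-- Trajectories are meaningful at nonnegative times only. Freezing them at negative times makes
them continuous, hence measurable, on the whole line without changing any integral over positive
times. -/
lemma continuous_comp_max {X : Type*} [TopologicalSpace X] {y : ℝ → X}
    (hy : ContinuousOn y (Ici 0)) : Continuous fun t => y (max 0 t) :=
  hy.comp_continuous (by fun_prop) fun t => le_max_left 0 t

lemma traj_isTrajectory (hf : M.FieldRegular) (γ : E) (x : EuclideanSpace ℝ (Fin m))
    {α : ℝ → M.A} (hα : Measurable α) : M.IsTrajectory γ x α (M.traj γ x α) := by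
  have h : ∃ y, M.IsTrajectory γ x α y := by
    refine exists_integral_solution (F := fun t x => M.f γ x (α t)) (C := hf.const) ?_
      (fun t x => hf.norm_le γ x _) (fun t x y => hf.inner_le γ x y _) ?_ x
    · exact (hf.continuous γ).measurable.comp
        (measurable_snd.prodMk (hα.comp measurable_fst))
    · intro ε hε
      obtain ⟨ρ, hρ, h⟩ := hf.modulus γ hε
      exact ⟨ρ, hρ, fun t x y hxy => h x y _ hxy⟩
  rw [traj, dif_pos h]
  exact h.choose_spec

lemma IsTrajectory.zero {γ : E} {x : EuclideanSpace ℝ (Fin m)} {α : ℝ → M.A}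
    {y : ℝ → EuclideanSpace ℝ (Fin m)} (h : M.IsTrajectory γ x α y) : y 0 = x := by
  simpa using h.2 0 le_rfl

lemma IsTrajectory.aeDeriv (hf : M.FieldRegular) {γ : E} {x : EuclideanSpace ℝ (Fin m)}
    {α : ℝ → M.A} (hα : Measurable α) {y : ℝ → EuclideanSpace ℝ (Fin m)}
    (h : M.IsTrajectory γ x α y) {T : ℝ} (hT : 0 ≤ T) :
    AEDeriv y (fun t => M.f γ (y t) (α t)) hf.const 0 T := by
  have hmeas : Measurable fun t => M.f γ (y (max 0 t)) (α t) :=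
    measurable_field hf γ (continuous_comp_max h.1).measurable hα
  have h1 := AEDeriv.of_integral (y := y) (x := x)
    (intervalIntegrable_of_bounded hmeas (fun t => hf.norm_le γ _ _) 0 T) hT
    (fun t => hf.norm_le γ _ _) (fun t ht => by
      rw [h.2 t ht.1]
      congr 1
      refine intervalIntegral.integral_congr fun s hs => ?_
      rw [uIcc_of_le ht.1] at hs
      simp only [max_eq_right hs.1])
  exact h1.congr_deriv (Eventually.of_forall fun t ht => by simp only [max_eq_right ht.1.le])

lemma traj_zero (hf : M.FieldRegular) (γ : E) (x : EuclideanSpace ℝ (Fin m))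
    {α : ℝ → M.A} (hα : Measurable α) : M.traj γ x α 0 = x :=
  (traj_isTrajectory hf γ x hα).zero

lemma traj_aeDeriv (hf : M.FieldRegular) (γ : E) (x : EuclideanSpace ℝ (Fin m))
    {α : ℝ → M.A} (hα : Measurable α) {T : ℝ} (hT : 0 ≤ T) :
    AEDeriv (M.traj γ x α) (fun t => M.f γ (M.traj γ x α t) (α t)) hf.const 0 T :=
  (traj_isTrajectory hf γ x hα).aeDeriv hf hα hT

lemma traj_continuousOn (hf : M.FieldRegular) (γ : E) (x : EuclideanSpace ℝ (Fin m))
    {α : ℝ → M.A} (hα : Measurable α) : ContinuousOn (M.traj γ x α) (Ici 0) :=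
  (traj_isTrajectory hf γ x hα).1

lemma norm_sub_le_of_aeDeriv (hf : M.FieldRegular) {γ : E} {α : ℝ → M.A}
    {y₁ y₂ : ℝ → EuclideanSpace ℝ (Fin m)} {K₁ K₂ : ℝ≥0} {T : ℝ}
    (h₁ : AEDeriv y₁ (fun t => M.f γ (y₁ t) (α t)) K₁ 0 T)
    (h₂ : AEDeriv y₂ (fun t => M.f γ (y₂ t) (α t)) K₂ 0 T) {t : ℝ} (ht : t ∈ Icc 0 T) :
    ‖y₁ t - y₂ t‖ ≤ Real.exp (hf.const * t) * ‖y₁ 0 - y₂ 0‖ := by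
  have h := h₁.norm_sub_sq_le h₂ (C := hf.const) (c := 0) hf.const.2 le_rfl
    (Eventually.of_forall fun s _ => by simpa using hf.inner_le γ (y₁ s) (y₂ s) (α s)) ht
  refine le_of_sq_le_sq ?_ (by positivity)
  refine h.trans (le_of_eq ?_)
  rw [mul_pow, ← Real.exp_nat_mul]
  push_cast
  ring_nf

/-- Uniqueness, by the Grönwall estimate. Every identification of a trajectory below exhibits a
curve with the right derivative almost everywhere and appeals to this. -/
lemma traj_eq_of_aeDeriv (hf : M.FieldRegular) {γ : E} {x : EuclideanSpace ℝ (Fin m)}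
    {α : ℝ → M.A} (hα : Measurable α) {y : ℝ → EuclideanSpace ℝ (Fin m)} {K : ℝ≥0} {T : ℝ}
    (h : AEDeriv y (fun t => M.f γ (y t) (α t)) K 0 T) (h0 : y 0 = x) {t : ℝ}
    (ht : t ∈ Icc 0 T) : M.traj γ x α t = y t := by
  have := norm_sub_le_of_aeDeriv hf (traj_aeDeriv hf γ x hα (ht.1.trans ht.2)) h ht
  rw [traj_zero hf γ x hα, h0, sub_self, norm_zero, mul_zero] at this
  exact sub_eq_zero.1 (norm_le_zero_iff.1 this)

lemma norm_traj_sub_le (hf : M.FieldRegular) (γ : E) (x z : EuclideanSpace ℝ (Fin m))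
    {α : ℝ → M.A} (hα : Measurable α) {t : ℝ} (ht : 0 ≤ t) :
    ‖M.traj γ x α t - M.traj γ z α t‖ ≤ Real.exp (hf.const * t) * ‖x - z‖ := by
  have := norm_sub_le_of_aeDeriv hf (traj_aeDeriv hf γ x hα ht) (traj_aeDeriv hf γ z hα ht)
    ⟨ht, le_rfl⟩
  rwa [traj_zero hf γ x hα, traj_zero hf γ z hα] at this

lemma traj_congr (hf : M.FieldRegular) {γ : E} {x : EuclideanSpace ℝ (Fin m)}
    {α β : ℝ → M.A} (hα : Measurable α) (hβ : Measurable β) {T : ℝ}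
    (h : ∀ᵐ t, t ∈ Ioo 0 T → α t = β t) {t : ℝ} (ht : t ∈ Icc 0 T) :
    M.traj γ x α t = M.traj γ x β t :=
  traj_eq_of_aeDeriv hf hα ((traj_aeDeriv hf γ x hβ (ht.1.trans ht.2)).congr_deriv (by
    filter_upwards [h] with s hs hm
    rw [hs hm])) (traj_zero hf γ x hβ) ht

lemma measurable_shift {α : ℝ → M.A} (hα : Measurable α) (s : ℝ) :
    Measurable fun t => α (s + t) := hα.comp (measurable_const_add s)

lemma traj_shift (hf : M.FieldRegular) (γ : E) (x : EuclideanSpace ℝ (Fin m))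
    {α : ℝ → M.A} (hα : Measurable α) {s t : ℝ} (hs : 0 ≤ s) (ht : 0 ≤ t) :
    M.traj γ (M.traj γ x α s) (fun r => α (s + r)) t = M.traj γ x α (s + t) := by
  have h := (traj_aeDeriv hf γ x hα (add_nonneg hs ht)).comp_add_left s
  exact traj_eq_of_aeDeriv hf (measurable_shift hα s) (h.mono (by linarith) (by linarith))
    (by simp) (y := fun r => M.traj γ x α (s + r)) ⟨ht, le_rfl⟩

/-- Follow the control `α` up to the time `θ` and then `β`. -/
noncomputable def concat (θ : ℝ) (α β : ℝ → M.A) (t : ℝ) : M.A :=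
  if t < θ then α t else β (t - θ)

lemma measurable_concat {θ : ℝ} {α β : ℝ → M.A} (hα : Measurable α) (hβ : Measurable β) :
    Measurable (concat θ α β) :=
  Measurable.ite measurableSet_Iio hα (hβ.comp (measurable_id.sub_const θ))

lemma concat_of_lt {θ t : ℝ} (α β : ℝ → M.A) (h : t < θ) : concat θ α β t = α t := if_pos h

lemma concat_add {θ t : ℝ} (α β : ℝ → M.A) (h : 0 ≤ t) : concat θ α β (θ + t) = β t := by
  rw [concat, if_neg (by linarith), add_sub_cancel_left]

lemma traj_concat_left (hf : M.FieldRegular) (γ : E) (x : EuclideanSpace ℝ (Fin m))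
    {α β : ℝ → M.A} (hα : Measurable α) (hβ : Measurable β) {θ t : ℝ} (ht : t ∈ Icc 0 θ) :
    M.traj γ x (concat θ α β) t = M.traj γ x α t :=
  traj_congr hf (measurable_concat hα hβ) hα
    (Eventually.of_forall fun _ hs => concat_of_lt α β hs.2) ht

lemma traj_concat_right (hf : M.FieldRegular) (γ : E) (x : EuclideanSpace ℝ (Fin m))
    {α β : ℝ → M.A} (hα : Measurable α) (hβ : Measurable β) {θ t : ℝ} (hθ : 0 ≤ θ)
    (ht : 0 ≤ t) :
    M.traj γ x (concat θ α β) (θ + t) = M.traj γ (M.traj γ x α θ) β t := by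
  rw [← traj_shift hf γ x (measurable_concat hα hβ) hθ ht,
    traj_concat_left hf γ x hα hβ ⟨hθ, le_rfl⟩]
  exact traj_congr hf (measurable_shift (measurable_concat hα hβ) θ) hβ
    (Eventually.of_forall fun s hs => concat_add α β hs.1.le) ⟨ht, le_rfl⟩

lemma shift_mem_detCtrl (hf : M.FieldRegular) {γ : E} {x : EuclideanSpace ℝ (Fin m)}
    {α : ℝ → M.A} (hα : α ∈ M.detCtrl γ x) {s : ℝ} (hs : 0 ≤ s) :
    (fun t => α (s + t)) ∈ M.detCtrl γ (M.traj γ x α s) :=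
  ⟨measurable_shift hα.1 s, fun t ht => by
    rw [traj_shift hf γ x hα.1 hs ht]; exact hα.2 _ (add_nonneg hs ht)⟩

lemma concat_mem_detCtrl (hf : M.FieldRegular) {γ : E} {x : EuclideanSpace ℝ (Fin m)}
    {α β : ℝ → M.A} (hα : Measurable α) {θ : ℝ} (hθ : 0 ≤ θ)
    (h : ∀ t ∈ Icc 0 θ, M.traj γ x α t ∈ M.network) (hβ : β ∈ M.detCtrl γ (M.traj γ x α θ)) :
    concat θ α β ∈ M.detCtrl γ x := by
  refine ⟨measurable_concat hα hβ.1, fun t ht => ?_⟩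
  rcases le_total t θ with h1 | h1
  · rw [traj_concat_left hf γ x hα hβ.1 ⟨ht, h1⟩]
    exact h t ⟨ht, h1⟩
  · obtain ⟨r, rfl⟩ : ∃ r, t = θ + r := ⟨t - θ, by ring⟩
    rw [traj_concat_right hf γ x hα hβ.1 hθ (by linarith)]
    exact hβ.2 r (by linarith)

/-! ### The geometry of the network -/

/-- The closed edge `[0,1] e_j`. -/
def seg (M : TrafficModel d m N E) (j : Fin N) : Set (EuclideanSpace ℝ (Fin m)) :=
  (fun r : ℝ => r • M.e j) '' Icc 0 1

lemma smul_mem_seg (M : TrafficModel d m N E) (j : Fin N) {r : ℝ} (hr : r ∈ Icc (0 : ℝ) 1) :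
    r • M.e j ∈ M.seg j :=
  mem_image_of_mem (fun r : ℝ => r • M.e j) hr

lemma seg_subset_network (M : TrafficModel d m N E) (j : Fin N) : M.seg j ⊆ M.network :=
  subset_iUnion (fun j => M.seg j) j

lemma isCompact_seg (M : TrafficModel d m N E) (j : Fin N) : IsCompact (M.seg j) :=
  isCompact_Icc.image (by fun_prop)

lemma isCompact_network (M : TrafficModel d m N E) : IsCompact M.network :=
  isCompact_iUnion fun j => M.isCompact_seg j

lemma eq_zero_of_mem_seg (hstar : M.IsStar) {j k : Fin N} (hjk : j ≠ k)
    {x : EuclideanSpace ℝ (Fin m)} (hj : x ∈ M.seg j) (hk : x ∈ M.seg k) : x = 0 := by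
  obtain ⟨r, hr, rfl⟩ := hj
  obtain ⟨s, hs, h⟩ := hk
  by_contra hne
  refine hstar.2 j k hjk (Or.inr (Or.inr ⟨r, s, ?_, ?_, h.symm⟩))
  · refine lt_of_le_of_ne hr.1 fun h0 => hne ?_
    simp [← h0]
  · refine lt_of_le_of_ne hs.1 fun h0 => hne ?_
    simp only [← h0, zero_smul] at h
    exact h.symm

lemma isClosed_other_segs (M : TrafficModel d m N E) (j : Fin N) :
    IsClosed (⋃ k ∈ {k | k ≠ j}, M.seg k) :=
  (Set.toFinite _).isClosed_biUnion fun k _ => (M.isCompact_seg k).isClosed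

/-- The closed edge `j` and the union of the other closed edges are closed sets that meet at `O`
only, so a connected piece of curve that touches both passes through `O`. The final time is added by
closedness; the curve may be at `O` then. -/
lemma mem_seg_of_ne_zero (hstar : M.IsStar) {j : Fin N} {τ : ℝ} (hτ : 0 ≤ τ)
    {y : ℝ → EuclideanSpace ℝ (Fin m)} (hy : ContinuousOn y (Icc 0 τ))
    (hnet : ∀ t ∈ Icc 0 τ, y t ∈ M.network) (hne : ∀ t ∈ Ico 0 τ, y t ≠ 0)
    (h0 : y 0 ∈ M.seg j) {t : ℝ} (ht : t ∈ Icc 0 τ) : y t ∈ M.seg j := by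
  rcases hτ.eq_or_lt with rfl | hτ
  · rwa [le_antisymm ht.2 ht.1]
  have hIco : ∀ t ∈ Ico 0 τ, y t ∈ M.seg j := by
    intro t ht
    by_contra hnot
    have hc : IsPreconnected (y '' Icc 0 t) :=
      isPreconnected_Icc.image y (hy.mono (Icc_subset_Icc_right ht.2.le))
    have := isPreconnected_closed_iff.1 hc (M.seg j) (⋃ k ∈ {k | k ≠ j}, M.seg k)
      (M.isCompact_seg j).isClosed (M.isClosed_other_segs j) (by
        rintro _ ⟨s, hs, rfl⟩
        obtain ⟨k, hk⟩ := mem_iUnion.1 (hnet s ⟨hs.1, hs.2.trans ht.2.le⟩)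
        by_cases hkj : k = j
        · exact Or.inl (hkj ▸ hk)
        · exact Or.inr (mem_biUnion (show k ∈ {k | k ≠ j} from hkj) hk))
      ⟨y 0, mem_image_of_mem y ⟨le_rfl, ht.1⟩, h0⟩ ⟨y t, mem_image_of_mem y ⟨ht.1, le_rfl⟩, by
        obtain ⟨k, hk⟩ := mem_iUnion.1 (hnet t ⟨ht.1, ht.2.le⟩)
        exact mem_biUnion (show k ∈ {k | k ≠ j} from fun hkj => hnot (hkj ▸ hk)) hk⟩
    obtain ⟨_, ⟨s, hs, rfl⟩, hs1, hs2⟩ := this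
    obtain ⟨k, hk, hsk⟩ := mem_iUnion₂.1 hs2
    exact hne s ⟨hs.1, hs.2.trans_lt ht.2⟩ (eq_zero_of_mem_seg hstar (Ne.symm hk) hs1 hsk)
  have hcl : IsClosed (Icc 0 τ ∩ y ⁻¹' M.seg j) :=
    hy.preimage_isClosed_of_isClosed isClosed_Icc (M.isCompact_seg j).isClosed
  have : closure (Ico 0 τ) ⊆ Icc 0 τ ∩ y ⁻¹' M.seg j :=
    hcl.closure_subset_iff.2 fun s hs => ⟨Ico_subset_Icc_self hs, hIco s hs⟩
  rw [closure_Ico hτ.ne] at this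
  exact (this ht).2

/-! ### One-dimensional dynamics on an edge -/

/-- The speed along the edge `j` at the point `r e_j`. -/
noncomputable def speed (M : TrafficModel d m N E) (γ : E) (j : Fin N) (r : ℝ) (a : M.A) : ℝ :=
  inner ℝ (M.f γ (r • M.e j) a) (M.e j) / ‖M.e j‖ ^ 2

lemma continuous_speed (hf : M.FieldRegular) (γ : E) (j : Fin N) :
    Continuous fun p : ℝ × M.A => M.speed γ j p.1 p.2 := by
  have := hf.continuous γ
  have h1 : Continuous fun p : ℝ × M.A => M.f γ (p.1 • M.e j) p.2 :=
    this.comp ((continuous_fst.smul continuous_const).prodMk continuous_snd)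
  exact (h1.inner continuous_const).div_const _

/-- At a point of the open edge the constant control `a` is locally admissible, so for a short time
its trajectory remains on the edge. Its right derivative is therefore a limit of vectors of the line
spanned by `e j`. Continuity of the field extends the identity to both end points. -/
lemma field_eq_speed_smul (hf : M.FieldRegular) (hstar : M.IsStar) (hctrl : M.CtrlStructure)
    {γ : E} {j : Fin N} {a : M.A} (ha : a ∈ M.edgeCtrl γ j) {r : ℝ} (hr : r ∈ Icc (0 : ℝ) 1) :
    M.f γ (r • M.e j) a = M.speed γ j r a • M.e j := by
  have he : ‖M.e j‖ ^ 2 ≠ 0 := by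
    have := norm_pos_iff.2 (hstar.1 j)
    positivity
  have hopen : ∀ r ∈ Ioo (0 : ℝ) 1, M.f γ (r • M.e j) a = M.speed γ j r a • M.e j := by
    intro r hr
    have hx : r • M.e j ∈ M.edge j := mem_image_of_mem (fun r : ℝ => r • M.e j) hr
    set x := r • M.e j with hxdef
    have hx0 : x ≠ 0 := smul_ne_zero hr.1.ne' (hstar.1 j)
    rw [← hctrl.2.1 γ j x hx] at ha
    obtain ⟨θ, hθ, hnet⟩ := ha
    set y := M.traj γ x (fun _ => a) with hy
    have hT := traj_isTrajectory hf γ x (α := fun _ => a) measurable_const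
    have hcont := continuous_comp_max hT.1
    have hF : Continuous fun s => M.f γ (y (max 0 s)) a := (hf.continuous_left γ a).comp hcont
    have hder : HasDerivAt (fun t => x + ∫ s in (0 : ℝ)..t, M.f γ (y (max 0 s)) a)
        (M.f γ x a) 0 := by
      have := (hF.integral_hasStrictDerivAt 0 0).hasDerivAt.const_add x
      rw [max_self, hy, traj_zero hf γ x measurable_const] at this
      exact this
    have hW : IsClosed ((Submodule.span ℝ {M.e j} : Submodule ℝ _) : Set (EuclideanSpace ℝ (Fin m))) :=
      Submodule.closed_of_finiteDimensional _
    have hslope := (hasDerivAt_iff_tendsto_slope.1 hder).mono_left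
      (nhdsWithin_mono 0 (show Ioi (0 : ℝ) ⊆ {0}ᶜ from fun s hs => ne_of_gt hs))
    have hmem : M.f γ x a ∈ (Submodule.span ℝ {M.e j} : Submodule ℝ _) := by
      refine hW.mem_of_tendsto hslope ?_
      have hnot : x ∉ ⋃ k ∈ {k | k ≠ j}, M.seg k := by
        intro hmem
        obtain ⟨k, hk, hxk⟩ := mem_iUnion₂.1 hmem
        exact hx0 (eq_zero_of_mem_seg hstar (Ne.symm hk)
          (M.smul_mem_seg j (Ioo_subset_Icc_self hr)) hxk)
      have h1 : ∀ᶠ t in 𝓝[>] (0 : ℝ), y (max 0 t) ∉ ⋃ k ∈ {k | k ≠ j}, M.seg k := by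
        refine (hcont.tendsto 0).mono_left nhdsWithin_le_nhds
          ((M.isClosed_other_segs j).isOpen_compl.mem_nhds ?_)
        rw [max_self, mem_compl_iff, traj_zero hf γ x measurable_const]
        exact hnot
      filter_upwards [h1, Ioo_mem_nhdsGT hθ] with t h1 h2
      have hyt : y t ∈ M.seg j := by
        rw [max_eq_right h2.1.le] at h1
        obtain ⟨k, hk⟩ := mem_iUnion.1 (hnet t ⟨h2.1.le, h2.2.le⟩)
        by_cases hkj : k = j
        · exact hkj ▸ hk
        · exact absurd (mem_biUnion (show k ∈ {k | k ≠ j} from hkj) hk) h1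
      have hint : x + ∫ s in (0 : ℝ)..t, M.f γ (y (max 0 s)) a = y t := by
        rw [hy, hT.2 t h2.1.le]
        congr 1
        refine intervalIntegral.integral_congr fun s hs => ?_
        rw [uIcc_of_le h2.1.le] at hs
        simp only [max_eq_right hs.1]
      simp only [slope, vsub_eq_sub, hint, intervalIntegral.integral_same, add_zero]
      obtain ⟨q, -, hq⟩ := hyt
      refine Submodule.smul_mem _ _ (Submodule.sub_mem _ ?_ ?_)
      · rw [← hq]; exact Submodule.smul_mem _ _ (Submodule.mem_span_singleton_self _)
      · exact Submodule.smul_mem _ _ (Submodule.mem_span_singleton_self _)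
    obtain ⟨q, hq⟩ := Submodule.mem_span_singleton.1 hmem
    rw [speed, ← hxdef, ← hq, inner_smul_left, real_inner_self_eq_norm_sq]
    simp [he]
  have hcl : IsClosed {r : ℝ | M.f γ (r • M.e j) a = M.speed γ j r a • M.e j} := by
    refine isClosed_eq ((hf.continuous_left γ a).comp (by fun_prop)) ?_
    exact ((continuous_speed hf γ j).comp (continuous_id.prodMk continuous_const)).smul
      continuous_const
  have := hcl.closure_subset_iff.2 hopen
  rw [closure_Ioo zero_ne_one] at this
  exact this hr

lemma speed_sub_mul_le (hf : M.FieldRegular) (hstar : M.IsStar) (γ : E) (j : Fin N)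
    (r s : ℝ) (a : M.A) :
    (M.speed γ j r a - M.speed γ j s a) * (r - s) ≤ hf.const * (r - s) ^ 2 := by
  have he : 0 < ‖M.e j‖ ^ 2 := by
    have := norm_pos_iff.2 (hstar.1 j)
    positivity
  have h := hf.inner_le γ (r • M.e j) (s • M.e j) a
  rw [← sub_smul, inner_smul_right, norm_smul, mul_pow, Real.norm_eq_abs, sq_abs,
    inner_sub_left, ← mul_assoc] at h
  rw [speed, speed, ← sub_div, div_mul_eq_mul_div, div_le_iff₀ he]
  linarith

/-- A bound for the speeds along the edge `j`, and for their one-sided Lipschitz constants. -/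
noncomputable def speedBound (hf : M.FieldRegular) (j : Fin N) : ℝ≥0 :=
  max hf.const (hf.const / ‖M.e j‖₊)

lemma abs_speed_le (hf : M.FieldRegular) (hstar : M.IsStar) (γ : E) (j : Fin N)
    (r : ℝ) (a : M.A) : |M.speed γ j r a| ≤ speedBound hf j := by
  have he : 0 < ‖M.e j‖ := norm_pos_iff.2 (hstar.1 j)
  have h1 : |M.speed γ j r a| ≤ hf.const / ‖M.e j‖ := by
    rw [speed, abs_div, abs_of_pos (by positivity : 0 < ‖M.e j‖ ^ 2),
      div_le_div_iff₀ (by positivity) he]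
    have h2 := (abs_real_inner_le_norm (M.f γ (r • M.e j) a) (M.e j)).trans
      (mul_le_mul_of_nonneg_right (hf.norm_le γ (r • M.e j) a) he.le)
    nlinarith
  refine h1.trans ?_
  rw [speedBound]
  push_cast
  exact le_max_right _ _

/-- The projection of the real line to `[0,1]`. -/
noncomputable def clip (r : ℝ) : ℝ := max 0 (min r 1)

lemma clip_of_mem {r : ℝ} (hr : r ∈ Icc (0 : ℝ) 1) : clip r = r := by
  rw [clip, min_eq_left hr.2, max_eq_right hr.1]

lemma clip_of_nonpos {r : ℝ} (hr : r ≤ 0) : clip r = 0 := by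
  rw [clip, max_eq_left ((min_le_left _ _).trans hr)]

lemma clip_of_one_le {r : ℝ} (hr : 1 ≤ r) : clip r = 1 := by
  rw [clip, min_eq_right hr, max_eq_right zero_le_one]

lemma continuous_clip : Continuous clip := by unfold clip; fun_prop

lemma clip_sub_le {r s : ℝ} (h : s ≤ r) : 0 ≤ clip r - clip s ∧ clip r - clip s ≤ r - s := by
  unfold clip
  constructor
  · have : min s 1 ≤ min r 1 := min_le_min_right 1 h
    linarith [max_le_max_left 0 this]
  · rcases max_cases 0 (min r 1) with h1 | h1 <;> rcases max_cases 0 (min s 1) with h2 | h2 <;>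
    rcases min_cases r 1 with h3 | h3 <;> rcases min_cases s 1 with h4 | h4 <;> linarith

lemma abs_clip_sub_le (r s : ℝ) : |clip r - clip s| ≤ |r - s| := by
  rcases le_total s r with h | h
  · obtain ⟨h1, h2⟩ := clip_sub_le h
    rwa [abs_of_nonneg h1, abs_of_nonneg (sub_nonneg.2 h)]
  · obtain ⟨h1, h2⟩ := clip_sub_le h
    rwa [abs_sub_comm, abs_of_nonneg h1, abs_sub_comm, abs_of_nonneg (sub_nonneg.2 h)]

lemma continuous_speed_clip (hf : M.FieldRegular) (γ : E) (j : Fin N) :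
    Continuous fun p : ℝ × M.A => M.speed γ j (clip p.1) p.2 :=
  (continuous_speed hf γ j).comp ((continuous_clip.comp continuous_fst).prodMk continuous_snd)

/-- The projection `clip` is monotone and nonexpansive, so it preserves the one-sided Lipschitz
condition. -/
lemma speed_clip_sub_mul_le (hf : M.FieldRegular) (hstar : M.IsStar) (γ : E) (j : Fin N)
    (r s : ℝ) (a : M.A) :
    (M.speed γ j (clip r) a - M.speed γ j (clip s) a) * (r - s)
      ≤ speedBound hf j * (r - s) ^ 2 := by
  wlog hrs : s ≤ r generalizing r s
  · linarith [this s r (le_of_not_ge hrs)]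
  obtain ⟨h1, h2⟩ := clip_sub_le hrs
  have hC : (hf.const : ℝ) ≤ speedBound hf j := by
    rw [speedBound]; push_cast; exact le_max_left _ _
  rcases h1.eq_or_lt with h3 | h3
  · rw [← sub_eq_zero.1 h3.symm, sub_self, zero_mul]
    positivity
  · have h4 := speed_sub_mul_le hf hstar γ j (clip r) (clip s) a
    have h5 : M.speed γ j (clip r) a - M.speed γ j (clip s) a
        ≤ hf.const * (clip r - clip s) := by
      refine le_of_mul_le_mul_right ?_ h3
      linarith
    have h6 : M.speed γ j (clip r) a - M.speed γ j (clip s) a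
        ≤ speedBound hf j * (r - s) :=
      h5.trans (mul_le_mul hC h2 h1 (NNReal.coe_nonneg _))
    linarith [mul_le_mul_of_nonneg_right h6 (sub_nonneg.2 hrs)]

lemma speed_clip_modulus (hf : M.FieldRegular) (hstar : M.IsStar) (γ : E) (j : Fin N)
    {ε : ℝ} (hε : 0 < ε) : ∃ ρ > 0, ∀ (r s : ℝ) (a : M.A), |r - s| ≤ ρ →
      |M.speed γ j (clip r) a - M.speed γ j (clip s) a| ≤ ε := by
  have he : 0 < ‖M.e j‖ := norm_pos_iff.2 (hstar.1 j)
  obtain ⟨ρ, hρ, h⟩ := hf.modulus γ (mul_pos hε he)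
  refine ⟨ρ / ‖M.e j‖, by positivity, fun r s a hrs => ?_⟩
  have h1 : ‖clip r • M.e j - clip s • M.e j‖ ≤ ρ := by
    rw [← sub_smul, norm_smul, Real.norm_eq_abs]
    rw [le_div_iff₀ he] at hrs
    exact (mul_le_mul_of_nonneg_right (abs_clip_sub_le r s) he.le).trans hrs
  have h2 := h _ _ a h1
  rw [speed, speed, ← sub_div, ← inner_sub_left, abs_div,
    abs_of_pos (by positivity : 0 < ‖M.e j‖ ^ 2), div_le_iff₀ (by positivity)]
  calc _ ≤ _ := abs_real_inner_le_norm _ _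
    _ ≤ ε * ‖M.e j‖ * ‖M.e j‖ := mul_le_mul_of_nonneg_right h2 he.le
    _ = _ := by ring

lemma measurable_comp_pair {X : Type*} [MeasurableSpace X] {g : ℝ × M.A → ℝ}
    (hg : Measurable g) {α : X → M.A} (hα : Measurable α) {y : X → ℝ} (hy : Measurable y) :
    Measurable fun p => g (y p, α p) :=
  hg.comp (hy.prodMk hα)

/-- The solution of the one-dimensional dynamics on the edge `j`, the speed being extended to the
real line by its values at the end points. -/
lemma exists_edge_curve (hf : M.FieldRegular) (hstar : M.IsStar) (γ : E) (j : Fin N)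
    {α : ℝ → M.A} (hα : Measurable α) (s : ℝ) : ∃ ζ : ℝ → ℝ, ζ 0 = s ∧
      ∀ T, 0 ≤ T → AEDeriv ζ (fun t => M.speed γ j (clip (ζ t)) (α t)) (speedBound hf j) 0 T := by
  have hb : ∀ t r : ℝ, ‖M.speed γ j (clip r) (α t)‖ ≤ speedBound hf j := fun t r =>
    abs_speed_le hf hstar γ j _ _
  have hF : Measurable fun p : ℝ × ℝ => M.speed γ j (clip p.2) (α p.1) :=
    measurable_comp_pair (continuous_speed_clip hf γ j).measurable
      (hα.comp measurable_fst) measurable_snd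
  have hos : ∀ t r s : ℝ,
      inner ℝ (M.speed γ j (clip r) (α t) - M.speed γ j (clip s) (α t)) (r - s)
        ≤ speedBound hf j * ‖r - s‖ ^ 2 := fun t r s => by
    have h := speed_clip_sub_mul_le hf hstar γ j r s (α t)
    rw [Real.norm_eq_abs, sq_abs, real_inner_comm]
    exact h
  have hmod : ∀ ε > 0, ∃ ρ > 0, ∀ t r s : ℝ, ‖r - s‖ ≤ ρ →
      ‖M.speed γ j (clip r) (α t) - M.speed γ j (clip s) (α t)‖ ≤ ε := fun ε hε => by
    obtain ⟨ρ, hρ, h⟩ := speed_clip_modulus hf hstar γ j hε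
    exact ⟨ρ, hρ, fun t r s hrs => h r s (α t) hrs⟩
  obtain ⟨ζ, hζc, hζ⟩ := exists_integral_solution hF hb hos hmod s
  refine ⟨ζ, by simpa using hζ 0 le_rfl, fun T hT => ?_⟩
  have hmeas : Measurable fun t => M.speed γ j (clip (ζ (max 0 t))) (α t) :=
    measurable_comp_pair (continuous_speed_clip hf γ j).measurable hα
      (continuous_comp_max hζc).measurable
  have h1 := AEDeriv.of_integral (y := ζ) (x := s)
    (intervalIntegrable_of_bounded hmeas (fun t => hb t _) 0 T) hT (fun t => hb t _)
    (fun t ht => by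
      rw [hζ t ht.1]
      congr 1
      refine intervalIntegral.integral_congr fun r hr => ?_
      rw [uIcc_of_le ht.1] at hr
      simp only [max_eq_right hr.1])
  exact h1.congr_deriv (Filter.Eventually.of_forall fun t ht => by simp only [max_eq_right ht.1.le])

/-- The field is tangent to the edge for controls of that edge, so the one-dimensional curve solves
the equation of the network as long as it stays in [0,1]. This carries comparison and hitting
arguments on the real line over to trajectories. -/
lemma traj_eq_smul (hf : M.FieldRegular) (hstar : M.IsStar) (hctrl : M.CtrlStructure) {γ : E}
    {j : Fin N} {α : ℝ → M.A} (hα : Measurable α) {ζ : ℝ → ℝ} {K : ℝ≥0} {T : ℝ}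
    (hζ : AEDeriv ζ (fun t => M.speed γ j (clip (ζ t)) (α t)) K 0 T)
    (hmem : ∀ t ∈ Icc 0 T, ζ t ∈ Icc (0 : ℝ) 1)
    (hctl : ∀ᵐ t, t ∈ Ioo 0 T → α t ∈ M.edgeCtrl γ j) {t : ℝ} (ht : t ∈ Icc 0 T) :
    M.traj γ (ζ 0 • M.e j) α t = ζ t • M.e j := by
  refine traj_eq_of_aeDeriv hf hα (K := K * ‖M.e j‖₊) (y := fun t => ζ t • M.e j) ⟨?_, ?_⟩
    rfl ht
  · refine LipschitzOnWith.of_dist_le_mul fun s hs t ht => ?_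
    have := hζ.1.dist_le_mul s hs t ht
    rw [dist_eq_norm, ← sub_smul, norm_smul, ← dist_eq_norm]
    push_cast
    nlinarith [norm_nonneg (M.e j)]
  · filter_upwards [hζ.2, hctl] with s h1 h2 hs
    have hm := hmem s (Ioo_subset_Icc_self hs)
    rw [field_eq_speed_smul hf hstar hctrl (h2 hs) hm]
    have := h1 hs
    rw [clip_of_mem hm] at this
    exact this.smul_const _

end Trajectories

end TrafficModel

namespace TrafficModel

section Viability

open Filter Topology

variable {d m N : ℕ} {E : Type*} {M : TrafficModel d m N E}

/-! ### The survival function and the first jump -/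

lemma RateRegular.continuous (hlam : M.RateRegular) (γ : E) :
    Continuous fun p : EuclideanSpace ℝ (Fin m) × M.A => M.lam p.1 γ p.2 :=
  (hlam.1 γ).continuous

/-- A constant in the assumptions on the jump rate. -/
noncomputable def RateRegular.const (hlam : M.RateRegular) : ℝ≥0 := hlam.2.2.choose.toNNReal

lemma RateRegular.le_const (hlam : M.RateRegular) (x : EuclideanSpace ℝ (Fin m)) (γ : E)
    (a : M.A) : M.lam x γ a ≤ hlam.const := by
  rw [RateRegular.const, Real.coe_toNNReal _ hlam.2.2.choose_spec.1.le]
  exact (hlam.2.2.choose_spec.2 γ x x a).2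

lemma RateRegular.abs_sub_le (hlam : M.RateRegular) (x y : EuclideanSpace ℝ (Fin m)) (γ : E)
    (a : M.A) : |M.lam x γ a - M.lam y γ a| ≤ hlam.const * ‖x - y‖ := by
  rw [RateRegular.const, Real.coe_toNNReal _ hlam.2.2.choose_spec.1.le]
  exact (hlam.2.2.choose_spec.2 γ x y a).1

lemma measurable_lam (hlam : M.RateRegular) (γ : E) {y : ℝ → EuclideanSpace ℝ (Fin m)}
    (hy : Measurable y) {α : ℝ → M.A} (hα : Measurable α) :
    Measurable fun t => M.lam (y t) γ (α t) :=
  (hlam.continuous γ).measurable.comp (hy.prodMk hα)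

lemma intervalIntegrable_lam (hf : M.FieldRegular) (hlam : M.RateRegular) (γ : E)
    (x : EuclideanSpace ℝ (Fin m)) {α : ℝ → M.A} (hα : Measurable α) {a b : ℝ} (ha : 0 ≤ a)
    (hb : 0 ≤ b) :
    IntervalIntegrable (fun s => M.lam (M.traj γ x α s) γ (α s)) volume a b := by
  have h1 : Measurable fun s => M.lam (M.traj γ x α (max 0 s)) γ (α s) :=
    measurable_lam hlam γ (continuous_comp_max (traj_continuousOn hf γ x hα)).measurable hα
  refine (intervalIntegrable_of_bounded (C := hlam.const) h1 (fun t => ?_) a b).congr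
    fun s hs => ?_
  · rw [Real.norm_eq_abs, abs_of_nonneg (hlam.2.1 _ _ _)]
    exact hlam.le_const _ _ _
  · have : 0 ≤ s := (le_min ha hb).trans hs.1.le
    simp only [max_eq_right this]

lemma survival_pos (γ : E) (x : EuclideanSpace ℝ (Fin m)) (α : ℝ → M.A) (t : ℝ) :
    0 < M.survival γ x α t := Real.exp_pos _

lemma survival_antitone (hf : M.FieldRegular) (hlam : M.RateRegular) (γ : E)
    (x : EuclideanSpace ℝ (Fin m)) {α : ℝ → M.A} (hα : Measurable α) {s t : ℝ} (hs : 0 ≤ s)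
    (hst : s ≤ t) : M.survival γ x α t ≤ M.survival γ x α s := by
  refine Real.exp_le_exp.2 (neg_le_neg ?_)
  rw [← intervalIntegral.integral_add_adjacent_intervals
    (intervalIntegrable_lam hf hlam γ x hα le_rfl hs)
    (intervalIntegrable_lam hf hlam γ x hα hs (hs.trans hst))]
  exact le_add_of_nonneg_right
    (intervalIntegral.integral_nonneg hst fun r _ => hlam.2.1 _ _ _)

lemma survival_zero (γ : E) (x : EuclideanSpace ℝ (Fin m)) (α : ℝ → M.A) :
    M.survival γ x α 0 = 1 := by simp [survival]

lemma survival_le_one (hf : M.FieldRegular) (hlam : M.RateRegular) (γ : E)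
    (x : EuclideanSpace ℝ (Fin m)) {α : ℝ → M.A} (hα : Measurable α) {t : ℝ} (ht : 0 ≤ t) :
    M.survival γ x α t ≤ 1 :=
  (survival_antitone hf hlam γ x hα le_rfl ht).trans_eq (survival_zero γ x α)

lemma le_waitingTime (hf : M.FieldRegular) (hlam : M.RateRegular) (γ : E)
    (x : EuclideanSpace ℝ (Fin m)) {α : ℝ → M.A} (hα : Measurable α) {t : ℝ}
    {u : unitInterval} (hu : (u : ℝ) < M.survival γ x α t) :
    ENNReal.ofReal t ≤ M.waitingTime γ x α u := by
  refine le_iInf₂ fun s hs => ?_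
  by_contra! hlt
  have h1 : (s : ℝ) ≤ t := by
    rw [← ENNReal.ofReal_coe_nnreal] at hlt
    exact (ENNReal.ofReal_lt_ofReal_iff_of_nonneg s.2).1 hlt |>.le
  exact absurd (hs.trans_lt hu) (not_lt.2 (survival_antitone hf hlam γ x hα s.2 h1))

section FirstJumpTime

variable [Fintype E]

lemma jumpTime_zero (α : ℝ → EuclideanSpace ℝ (Fin m) → E → M.A)
    (x : EuclideanSpace ℝ (Fin m)) (γ : E) (ω : ℕ → unitInterval) :
    M.jumpTime α x γ ω 0 = 0 := rfl

lemma jumpTime_one (α : ℝ → EuclideanSpace ℝ (Fin m) → E → M.A)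
    (x : EuclideanSpace ℝ (Fin m)) (γ : E) (ω : ℕ → unitInterval) :
    M.jumpTime α x γ ω 1 = M.waitingTime γ x (fun t => α t x γ) (ω 0) := by
  simp [jumpTime, jumpChain]

lemma monotone_jumpTime (α : ℝ → EuclideanSpace ℝ (Fin m) → E → M.A)
    (x : EuclideanSpace ℝ (Fin m)) (γ : E) (ω : ℕ → unitInterval) :
    Monotone (M.jumpTime α x γ ω) :=
  monotone_nat_of_le_succ fun _ => le_self_add

lemma process_of_lt (α : ℝ → EuclideanSpace ℝ (Fin m) → E → M.A)
    (x : EuclideanSpace ℝ (Fin m)) (γ : E) (ω : ℕ → unitInterval) {t : ℝ}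
    (ht : ENNReal.ofReal t < M.jumpTime α x γ ω 1) :
    M.process α x γ ω t = (M.traj γ x (fun s => α s x γ) t, γ) := by
  have h : ∃ n, M.jumpTime α x γ ω n ≤ ENNReal.ofReal t ∧
      ENNReal.ofReal t < M.jumpTime α x γ ω (n + 1) :=
    ⟨0, by rw [jumpTime_zero]; exact zero_le, ht⟩
  have h0 : h.choose = 0 := by
    by_contra hne
    exact absurd (ht.trans_le (monotone_jumpTime α x γ ω (Nat.one_le_iff_ne_zero.2 hne)))
      (not_lt.2 h.choose_spec.1)
  rw [process, dif_pos h, h0]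
  simp [postPos, postJumpMode, jumpTime, jumpChain]

lemma postPos_mem_network {α : ℝ → EuclideanSpace ℝ (Fin m) → E → M.A}
    (hα : ∀ x ∈ M.network, ∀ γ, (fun t => α t x γ) ∈ M.detCtrl γ x)
    {x : EuclideanSpace ℝ (Fin m)} (hx : x ∈ M.network) (γ : E) (ω : ℕ → unitInterval) (n : ℕ) :
    M.postPos α x γ ω n ∈ M.network := by
  induction n with
  | zero => exact hx
  | succ n ih => exact (hα _ ih _).2 _ ENNReal.toReal_nonneg

/-- Each piece of the process between two jumps is a feasible deterministic trajectory that starts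
at a point of the network. -/
lemma mem_admissible_of_detCtrl {α : ℝ → EuclideanSpace ℝ (Fin m) → E → M.A}
    (hmeas : ∀ γ, Measurable fun p : ℝ × EuclideanSpace ℝ (Fin m) => α p.1 p.2 γ)
    (hα : ∀ x ∈ M.network, ∀ γ, (fun t => α t x γ) ∈ M.detCtrl γ x) : α ∈ M.admissible := by
  refine ⟨hmeas, fun x hx γ => Eventually.of_forall fun ω t ht => ?_⟩
  by_cases h : ∃ n, M.jumpTime α x γ ω n ≤ ENNReal.ofReal t ∧
      ENNReal.ofReal t < M.jumpTime α x γ ω (n + 1)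
  · rw [process, dif_pos h]
    refine (hα _ (postPos_mem_network hα hx γ ω _) _).2 _ (sub_nonneg.2 ?_)
    exact ENNReal.toReal_le_of_le_ofReal ht h.choose_spec.1
  -- If the jump times accumulate before `t`, the process takes its default value, the initial
  -- state, which is on the network. The property therefore holds for every `ω`.
  · rw [process, dif_neg h]
    exact hx

lemma measurable_slice {α : ℝ → EuclideanSpace ℝ (Fin m) → E → M.A} (hα : α ∈ M.admissible)
    (x : EuclideanSpace ℝ (Fin m)) (γ : E) : Measurable fun t => α t x γ :=
  (hα.1 γ).comp (measurable_id.prodMk measurable_const)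

/-- The rate is bounded, so with positive probability no jump occurs up to a given time. On that
event the process is the deterministic trajectory, and a deterministic statement true with positive
probability is true. -/
lemma detCtrl_of_admissible (hf : M.FieldRegular) (hlam : M.RateRegular)
    {α : ℝ → EuclideanSpace ℝ (Fin m) → E → M.A} (hα : α ∈ M.admissible)
    {x : EuclideanSpace ℝ (Fin m)} (hx : x ∈ M.network) (γ : E) :
    (fun t => α t x γ) ∈ M.detCtrl γ x := by
  have hmeas := measurable_slice hα x γ
  refine ⟨hmeas, fun t ht => ?_⟩
  -- The time `t + 1` replaces `t` because `le_waitingTime` is not strict, whereas the process is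
  -- known to follow the trajectory strictly before the first jump.
  set c := M.survival γ x (fun t => α t x γ) (t + 1) with hc
  have hpos : cubeMeasure {ω : ℕ → unitInterval | (ω 0 : ℝ) < c} ≠ 0 := by
    have hmp : MeasurePreserving (fun ω : ℕ → unitInterval => ω 0) cubeMeasure volume :=
      measurePreserving_eval_infinitePi _ 0
    have hc1 : c ≤ 1 := survival_le_one hf hlam γ x hmeas (by linarith)
    have h1 := hmp.measure_preimage
      (measurableSet_Iio (a := (⟨c, (survival_pos γ x _ _).le, hc1⟩ : unitInterval))).nullMeasurableSet
    rw [unitInterval.volume_Iio] at h1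
    exact h1.trans_ne (ENNReal.ofReal_pos.2 (survival_pos γ x _ _)).ne'
  obtain ⟨ω, hω1, hω2⟩ : ∃ ω : ℕ → unitInterval, (ω 0 : ℝ) < c ∧
      ∀ t : ℝ, 0 ≤ t → (M.process α x γ ω t).1 ∈ M.network := by
    by_contra! hno
    refine hpos (measure_mono_null (fun ω hω => ?_) (hα.2 x hx γ))
    obtain ⟨t, ht, h⟩ := hno ω hω
    exact fun hall => h (hall t ht)
  have h1 := le_waitingTime hf hlam γ x hmeas hω1
  rw [← jumpTime_one] at h1
  have h2 := hω2 t ht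
  rwa [process_of_lt α x γ ω
    (lt_of_lt_of_le ((ENNReal.ofReal_lt_ofReal_iff (by linarith)).2 (by linarith)) h1)] at h2

end FirstJumpTime

/-! ### Existence of admissible policies -/

lemma speed_zero_eq (M : TrafficModel d m N E) (γ : E) (j : Fin N) (a : M.A) :
    M.speed γ j 0 a = inner ℝ (M.f γ 0 a) (M.e j) / ‖M.e j‖ ^ 2 := by
  rw [speed, zero_smul]

lemma speed_one_eq (M : TrafficModel d m N E) (γ : E) (j : Fin N) (a : M.A) :
    M.speed γ j 1 a = inner ℝ (M.f γ (M.e j) a) (M.e j) / ‖M.e j‖ ^ 2 := by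
  rw [speed, one_smul]

lemma exists_ctrl_speed_zero_nonneg (hact : M.ActiveCtrl) (hinact : M.InactiveCtrl) (γ : E)
    (j : Fin N) : ∃ a ∈ M.edgeCtrl γ j, 0 ≤ M.speed γ j 0 a := by
  by_cases h : γ ∈ M.active j
  · obtain ⟨β, hβ, a, ha, -, -, h1, -⟩ := hact j γ h
    refine ⟨a, ha, ?_⟩
    rw [speed_zero_eq]
    exact div_nonneg (hβ.trans h1).le (by positivity)
  · obtain ⟨β, η, κ, -, -, -, -, -, -, ⟨a, ha, h0⟩, -⟩ := hinact j γ h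
    refine ⟨a, ha, ?_⟩
    rw [speed_zero_eq, h0, inner_zero_left, zero_div]

lemma exists_ctrl_speed_one_nonpos (hctrl : M.CtrlStructure) (γ : E) (j : Fin N) :
    ∃ a ∈ M.edgeCtrl γ j, M.speed γ j 1 a ≤ 0 := by
  obtain ⟨a, ha⟩ := hctrl.2.2.2.2.1 γ j
  rw [hctrl.2.2.2.1 γ j] at ha
  refine ⟨a, ha.1, ?_⟩
  rw [speed_one_eq]
  exact div_nonpos_of_nonpos_of_nonneg ha.2 (by positivity)

lemma edge_curve_abs_sub_le {ζ w : ℝ → ℝ} {K : ℝ≥0} {T t : ℝ} (h : AEDeriv ζ w K 0 T)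
    (ht : t ∈ Icc 0 T) : |ζ t - ζ 0| ≤ K * t := by
  have := h.1.dist_le_mul t ht 0 ⟨le_rfl, ht.1.trans ht.2⟩
  rwa [Real.dist_eq, Real.dist_eq, sub_zero, abs_of_nonneg ht.1] at this

/-- The clipped speed is nonnegative below 0, so the curve cannot leave at `O`; starting in the
lower half, it has no time to pass the other end. -/
lemma traj_mem_seg_of_lower_half (hf : M.FieldRegular) (hstar : M.IsStar)
    (hctrl : M.CtrlStructure) {γ : E} {j : Fin N} {a : M.A} (ha : a ∈ M.edgeCtrl γ j)
    (h0 : 0 ≤ M.speed γ j 0 a) {r : ℝ} (hr : r ∈ Icc (0 : ℝ) (1 / 2)) {h : ℝ}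
    (hh : speedBound hf j * h ≤ 1 / 2) {t : ℝ} (ht : t ∈ Icc 0 h) :
    M.traj γ (r • M.e j) (fun _ => a) t ∈ M.seg j := by
  obtain ⟨ζ, rfl, hζ⟩ := exists_edge_curve hf hstar γ j (α := fun _ => a) measurable_const r
  have hζ := hζ h (ht.1.trans ht.2)
  have hmem : ∀ t ∈ Icc 0 h, ζ t ∈ Icc (0 : ℝ) 1 := fun t ht => by
    refine ⟨hζ.ge_of_nonneg_below hr.1 (Eventually.of_forall fun s _ hs => ?_) ht, ?_⟩
    · simpa only [clip_of_nonpos hs.le] using h0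
    · have h1 := (abs_le.1 (edge_curve_abs_sub_le hζ ht)).2
      have h2 := mul_le_mul_of_nonneg_left ht.2 (speedBound hf j).2
      have h3 := hr.2
      simp only [NNReal.val_eq_coe] at h2
      linarith
  rw [traj_eq_smul hf hstar hctrl measurable_const hζ hmem
    (Eventually.of_forall fun _ _ => ha) ht]
  exact M.smul_mem_seg j (hmem t ht)

lemma traj_mem_seg_of_upper_half (hf : M.FieldRegular) (hstar : M.IsStar)
    (hctrl : M.CtrlStructure) {γ : E} {j : Fin N} {a : M.A} (ha : a ∈ M.edgeCtrl γ j)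
    (h0 : M.speed γ j 1 a ≤ 0) {r : ℝ} (hr : r ∈ Icc (1 / 2 : ℝ) 1) {h : ℝ}
    (hh : speedBound hf j * h ≤ 1 / 2) {t : ℝ} (ht : t ∈ Icc 0 h) :
    M.traj γ (r • M.e j) (fun _ => a) t ∈ M.seg j := by
  obtain ⟨ζ, rfl, hζ⟩ := exists_edge_curve hf hstar γ j (α := fun _ => a) measurable_const r
  have hζ := hζ h (ht.1.trans ht.2)
  have hmem : ∀ t ∈ Icc 0 h, ζ t ∈ Icc (0 : ℝ) 1 := fun t ht => by
    refine ⟨?_, hζ.le_of_nonpos_above hr.2 (Eventually.of_forall fun s _ hs => ?_) ht⟩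
    · have h1 := (abs_le.1 (edge_curve_abs_sub_le hζ ht)).1
      have h2 := mul_le_mul_of_nonneg_left ht.2 (speedBound hf j).2
      have h3 := hr.1
      simp only [NNReal.val_eq_coe] at h2
      linarith
    · simpa only [clip_of_one_le hs.le] using h0
  rw [traj_eq_smul hf hstar hctrl measurable_const hζ hmem
    (Eventually.of_forall fun _ _ => ha) ht]
  exact M.smul_mem_seg j (hmem t ht)

lemma exists_measurable_index {X ι : Type*} [MeasurableSpace X] [MeasurableSpace ι] [Finite ι]
    [Nonempty ι] {S : ι → Set X} (hS : ∀ i, MeasurableSet (S i)) :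
    ∃ s : X → ι, Measurable s ∧ ∀ x ∈ ⋃ i, S i, x ∈ S (s x) := by
  classical
  have := Fintype.ofFinite ι
  have key : ∀ F : Finset ι, ∃ s : X → ι, Measurable s ∧ ∀ i ∈ F, ∀ x ∈ S i, x ∈ S (s x) := by
    intro F
    induction F using Finset.induction_on with
    | empty => exact ⟨fun _ => Classical.arbitrary ι, measurable_const, by simp⟩
    | insert a F _ ih =>
      obtain ⟨s, hs, h⟩ := ih
      refine ⟨fun x => if x ∈ S a then a else s x, Measurable.ite (hS a) measurable_const hs,
        fun i hi x hx => ?_⟩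
      by_cases hxa : x ∈ S a
      · simp [hxa]
      · simp only [hxa, if_false]
        rcases Finset.mem_insert.1 hi with rfl | hi
        · exact absurd hx hxa
        · exact h i hi x hx
  obtain ⟨s, hs, h⟩ := key Finset.univ
  refine ⟨s, hs, fun x hx => ?_⟩
  obtain ⟨i, hi⟩ := mem_iUnion.1 hx
  exact h i (Finset.mem_univ i) x hi

lemma continuous_traj_const (hf : M.FieldRegular) (γ : E) (a : M.A) {t : ℝ} (ht : 0 ≤ t) :
    Continuous fun x => M.traj γ x (fun _ => a) t := by
  refine (LipschitzWith.of_dist_le_mul (K := (Real.exp (hf.const * t)).toNNReal)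
    fun x y => ?_).continuous
  rw [dist_eq_norm, dist_eq_norm, Real.coe_toNNReal _ (Real.exp_pos _).le]
  exact norm_traj_sub_le hf γ x y measurable_const ht

/-- Over a short period of time, a constant control taken from a finite list, depending measurably
on the position, keeps the trajectory on the network. -/
lemma exists_short_time_feedback (hN : 2 ≤ N) (hf : M.FieldRegular) (hstar : M.IsStar)
    (hctrl : M.CtrlStructure) (hact : M.ActiveCtrl) (hinact : M.InactiveCtrl) (γ : E) :
    ∃ h : ℝ, 0 < h ∧ ∃ (c : Fin N × Bool → M.A)
      (s : EuclideanSpace ℝ (Fin m) → Fin N × Bool), Measurable s ∧ ∀ x ∈ M.network,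
        ∀ t ∈ Icc 0 h, M.traj γ x (fun _ => c (s x)) t ∈ M.network := by
  choose b hb hb0 using exists_ctrl_speed_zero_nonneg hact hinact γ
  choose c hc hc1 using exists_ctrl_speed_one_nonpos hctrl γ
  set B : ℝ := ∑ j, (speedBound hf j : ℝ) with hB
  have hB0 : 0 ≤ B := Finset.sum_nonneg fun j _ => NNReal.coe_nonneg _
  have hBj : ∀ j, (speedBound hf j : ℝ) ≤ B := fun j =>
    Finset.single_le_sum (f := fun j => (speedBound hf j : ℝ)) (fun j _ => NNReal.coe_nonneg _)
      (Finset.mem_univ j)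
  -- One step length for all edges: during it no curve covers more than half of an edge.
  have hh : ∀ j, speedBound hf j * (1 / (2 * (B + 1))) ≤ 1 / 2 := fun j => by
    rw [mul_one_div, div_le_div_iff₀ (by positivity) two_pos]
    linarith [hBj j]
  have : Nonempty (Fin N × Bool) := ⟨(⟨0, by omega⟩, true)⟩
  let S : Fin N × Bool → Set (EuclideanSpace ℝ (Fin m)) := fun i =>
    (fun r : ℝ => r • M.e i.1) '' (if i.2 then Icc 0 (1 / 2) else Icc (1 / 2) 1)
  have hS : ∀ i, MeasurableSet (S i) := fun i => by
    refine (IsCompact.image ?_ (by fun_prop)).isClosed.measurableSet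
    split_ifs <;> exact isCompact_Icc
  obtain ⟨s, hs, hsel⟩ := exists_measurable_index hS
  refine ⟨1 / (2 * (B + 1)), by positivity, fun i => if i.2 then b i.1 else c i.1, s, hs,
    fun x hx t ht => ?_⟩
  have hxS : x ∈ ⋃ i, S i := by
    obtain ⟨j, r, hr, rfl⟩ := mem_iUnion.1 hx
    rcases le_total r (1 / 2) with h | h
    · exact mem_iUnion.2 ⟨(j, true), mem_image_of_mem _ (by simpa using ⟨hr.1, by simpa using h⟩)⟩
    · exact mem_iUnion.2 ⟨(j, false), mem_image_of_mem _ (by simpa using ⟨by simpa using h, hr.2⟩)⟩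
  have hmem := hsel x hxS
  generalize s x = i at hmem
  obtain ⟨j, bo⟩ := i
  refine M.seg_subset_network j ?_
  cases bo with
  | true =>
    obtain ⟨r, hr, rfl⟩ := hmem
    exact traj_mem_seg_of_lower_half hf hstar hctrl (hb j) (hb0 j) (by simpa using hr) (hh j) ht
  | false =>
    obtain ⟨r, hr, rfl⟩ := hmem
    exact traj_mem_seg_of_upper_half hf hstar hctrl (hc j) (hc1 j) (by simpa using hr) (hh j) ht

/-- The short-time feedback is chosen anew at the times k h, where the position is the k-th iterate
of the flow map `Φ`. Measurability in the position survives because only finitely many constant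
controls occur and the flow of each one is continuous in the starting point. -/
lemma exists_measurable_feasible (hN : 2 ≤ N) (hf : M.FieldRegular) (hstar : M.IsStar)
    (hctrl : M.CtrlStructure) (hact : M.ActiveCtrl) (hinact : M.InactiveCtrl) (γ : E) :
    ∃ π : ℝ → EuclideanSpace ℝ (Fin m) → M.A,
      (Measurable fun p : ℝ × EuclideanSpace ℝ (Fin m) => π p.1 p.2) ∧
      ∀ x ∈ M.network, (fun t => π t x) ∈ M.detCtrl γ x := by
  obtain ⟨h, hh, c, s, hs, hfeas⟩ := exists_short_time_feedback hN hf hstar hctrl hact hinact γ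
  let Φ : EuclideanSpace ℝ (Fin m) → EuclideanSpace ℝ (Fin m) := fun x =>
    M.traj γ x (fun _ => c (s x)) h
  have hΦ : Measurable Φ := by
    have : Measurable fun p : (Fin N × Bool) × EuclideanSpace ℝ (Fin m) =>
        M.traj γ p.2 (fun _ => c p.1) h :=
      measurable_from_prod_countable_right fun i => (continuous_traj_const hf γ (c i) hh.le).measurable
    exact this.comp (hs.prodMk measurable_id)
  have hΦk : ∀ k : ℕ, Measurable (Φ^[k]) := fun k => hΦ.iterate k
  let π : ℝ → EuclideanSpace ℝ (Fin m) → M.A := fun t x => c (s (Φ^[⌊t / h⌋₊] x))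
  have hπ : Measurable fun p : ℝ × EuclideanSpace ℝ (Fin m) => π p.1 p.2 := by
    have h1 : Measurable fun p : ℕ × EuclideanSpace ℝ (Fin m) => c (s (Φ^[p.1] p.2)) :=
      measurable_from_prod_countable_right fun k => (measurable_of_finite c).comp (hs.comp (hΦk k))
    have h2 : Measurable fun p : ℝ × EuclideanSpace ℝ (Fin m) => (⌊p.1 / h⌋₊, p.2) :=
      (Nat.measurable_floor.comp (measurable_fst.div_const h)).prodMk measurable_snd
    exact h1.comp h2
  refine ⟨π, hπ, fun x hx => ?_⟩
  have hα : Measurable fun t => π t x := hπ.comp (measurable_id.prodMk measurable_const)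
  have hnet : ∀ k : ℕ, Φ^[k] x ∈ M.network := by
    intro k
    induction k with
    | zero => exact hx
    | succ k ih =>
      rw [Function.iterate_succ_apply']
      exact hfeas _ ih h ⟨hh.le, le_rfl⟩
  have hloc : ∀ k : ℕ, M.traj γ x (fun t => π t x) (k * h) = Φ^[k] x →
      ∀ t ∈ Icc 0 h, M.traj γ x (fun t => π t x) (k * h + t) =
        M.traj γ (Φ^[k] x) (fun _ => c (s (Φ^[k] x))) t := by
    intro k hk t ht
    rw [← traj_shift hf γ x hα (by positivity) ht.1, hk]
    refine traj_congr hf (measurable_shift hα _) measurable_const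
      (Eventually.of_forall fun r hr => ?_) ht
    have : ⌊(k * h + r) / h⌋₊ = k := by
      rw [Nat.floor_eq_iff (div_nonneg (by nlinarith [hr.1, hh, k.cast_nonneg (α := ℝ)]) hh.le),
        le_div_iff₀ hh, div_lt_iff₀ hh]
      exact ⟨by linarith [hr.1], by linarith [hr.2]⟩
    simp only [π, this]
  have hnode : ∀ k : ℕ, M.traj γ x (fun t => π t x) (k * h) = Φ^[k] x := by
    intro k
    induction k with
    | zero => simpa using traj_zero hf γ x hα
    | succ k ih =>
      rw [Function.iterate_succ_apply', show ((k + 1 : ℕ) : ℝ) * h = k * h + h by push_cast; ring,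
        hloc k ih h ⟨hh.le, le_rfl⟩]
  refine ⟨hα, fun t ht => ?_⟩
  have h1 : ((⌊t / h⌋₊ : ℕ) : ℝ) * h ≤ t := by
    rw [← le_div_iff₀ hh]; exact Nat.floor_le (div_nonneg ht hh.le)
  have h2 : t < (⌊t / h⌋₊ + 1) * h := by
    rw [← div_lt_iff₀ hh]; exact Nat.lt_floor_add_one _
  have hmem : t - ⌊t / h⌋₊ * h ∈ Icc 0 h := ⟨by linarith, by linarith⟩
  have h3 := hloc _ (hnode ⌊t / h⌋₊) _ hmem
  rw [add_sub_cancel] at h3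
  rw [h3]
  exact hfeas _ (hnet _) _ hmem

/-- A Borel feasible policy is replaced by `α` at the single state (x,γ). Points are measurable
sets, and a process that jumps back into this state merely restarts `α`, which is feasible there. -/
lemma exists_admissible_extending [Fintype E] (hN : 2 ≤ N) (hf : M.FieldRegular)
    (hstar : M.IsStar) (hctrl : M.CtrlStructure) (hact : M.ActiveCtrl) (hinact : M.InactiveCtrl)
    {γ : E} {x : EuclideanSpace ℝ (Fin m)} {α : ℝ → M.A} (hα : α ∈ M.detCtrl γ x) :
    ∃ π ∈ M.admissible, (fun t => π t x γ) = α := by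
  classical
  choose π hπ hπd using exists_measurable_feasible hN hf hstar hctrl hact hinact
  refine ⟨fun t x' γ' => if x' = x ∧ γ' = γ then α t else π γ' t x',
    mem_admissible_of_detCtrl (fun γ' => ?_) (fun x' hx' γ' => ?_), by simp⟩
  · by_cases h : γ' = γ
    · simp only [h, and_true]
      exact Measurable.ite (measurableSet_eq_fun measurable_snd measurable_const)
        (hα.1.comp measurable_fst) (hπ γ)
    · simp only [h, and_false, if_false]
      exact hπ γ'
  · by_cases h : x' = x ∧ γ' = γ
    · obtain ⟨rfl, rfl⟩ := h
      simpa using hα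
    · simp only [h, if_false]
      exact hπd γ' x' hx'

lemma detCtrl_nonempty (hN : 2 ≤ N) (hf : M.FieldRegular)
    (hstar : M.IsStar) (hctrl : M.CtrlStructure) (hact : M.ActiveCtrl) (hinact : M.InactiveCtrl)
    (γ : E) {x : EuclideanSpace ℝ (Fin m)} (hx : x ∈ M.network) : (M.detCtrl γ x).Nonempty := by
  obtain ⟨π, -, hπ⟩ := exists_measurable_feasible hN hf hstar hctrl hact hinact γ
  exact ⟨_, hπ x hx⟩

/-! ### Controls along an edge -/

/-- Feasible controls take almost all their values on an edge among the controls of that edge. -/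
def CtrlOnEdges (M : TrafficModel d m N E) : Prop :=
  ∀ (γ : E) (x : EuclideanSpace ℝ (Fin m)), ∀ α ∈ M.detCtrl γ x, ∀ j, ∀ᵐ t, 0 < t →
    M.traj γ x α t ∈ M.seg j → M.traj γ x α t ≠ 0 → α t ∈ M.edgeCtrl γ j

/-- Such a control keeps the trajectory at the vertex, so it is locally admissible there, and all
locally admissible controls at the vertex belong to the edge. -/
lemma mem_edgeCtrl_of_field_eq_zero (hf : M.FieldRegular) (hctrl : M.CtrlStructure) {γ : E}
    {j : Fin N} {a : M.A} (h : M.f γ (M.e j) a = 0) : a ∈ M.edgeCtrl γ j := by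
  have hloc : a ∈ M.localCtrl γ (M.e j) := by
    refine ⟨1, one_pos, fun t ht => ?_⟩
    rw [traj_eq_of_aeDeriv hf (y := fun _ => M.e j) (K := 0) measurable_const
      ⟨fun s _ t _ => by simp, Eventually.of_forall fun s _ => by
        simpa [h] using hasDerivAt_const s (M.e j)⟩ rfl ht]
    exact M.seg_subset_network j (by simpa using M.smul_mem_seg j (r := 1) ⟨zero_le_one, le_rfl⟩)
  rw [hctrl.2.2.2.1 γ j] at hloc
  exact hloc.1

/-- A set is negligible if each of its points has a negligible right neighbourhood in it. -/
lemma measure_eq_zero_of_right_locally_null {s : Set ℝ} {θ : ℝ → ℝ} (hθ : ∀ t ∈ s, 0 < θ t)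
    (h : ∀ t ∈ s, volume (s ∩ Ioo t (t + θ t)) = 0) : volume s = 0 := by
  set U : Set ℝ := ⋃ t ∈ s, Ioo t (t + θ t) with hU
  have h1 : volume (s ∩ U) = 0 := by
    refine measure_null_of_locally_null _ fun x hx => ?_
    obtain ⟨t, ht, hxt⟩ := mem_iUnion₂.1 hx.2
    refine ⟨s ∩ Ioo t (t + θ t), ?_, h t ht⟩
    have := inter_mem (self_mem_nhdsWithin (s := s ∩ U) (a := x))
      (mem_nhdsWithin_of_mem_nhds (isOpen_Ioo.mem_nhds hxt))
    exact mem_of_superset this fun y hy => ⟨hy.1.1, hy.2⟩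
  -- A point of `s` outside `U` has no other such point shortly to its right, so `s \ U` is
  -- countable.
  have h2 : volume (s \ U) = 0 := by
    refine Set.Countable.measure_zero ?_ _
    refine (countable_setOfPred_isolated_right_within (s := s \ U)).mono fun t ht => ?_
    refine mem_ofPred.2 ⟨ht, ?_⟩
    rw [← empty_mem_iff_bot, mem_nhdsWithin]
    refine ⟨Iio (t + θ t), isOpen_Iio, by simpa using hθ t ht.1, fun r hr => ?_⟩
    exact hr.2.1.2 (mem_biUnion ht.1 ⟨hr.2.2, hr.1⟩)
  rw [← inter_union_sdiff s U]
  exact measure_union_null h1 h2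

/-- The hypothesis on admissible policies controls only a short time after the start. It is applied
afresh from each time at which the trajectory is on the open edge, which makes the exceptional set
negligible to the right of each of its points. Times spent at the vertex are treated separately. -/
lemma ctrlOnEdges [Fintype E] (hN : 2 ≤ N) (hf : M.FieldRegular) (hstar : M.IsStar)
    (hctrl : M.CtrlStructure) (hact : M.ActiveCtrl) (hinact : M.InactiveCtrl)
    (hedge : M.EdgeAdmissible) : M.CtrlOnEdges := by
  intro γ x α hα j
  have hinterior : ∀ᵐ t, 0 < t → M.traj γ x α t ∈ M.edge j → α t ∈ M.edgeCtrl γ j := by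
    choose! θ hθ hθα using hedge j γ
    rw [ae_iff]
    refine measure_eq_zero_of_right_locally_null (θ := fun t => θ (M.traj γ x α t)) ?_ ?_
    · intro t ht
      simp only [mem_ofPred_eq, Classical.not_imp] at ht
      exact hθ _ ht.2.1
    · intro t ht
      simp only [mem_ofPred_eq, Classical.not_imp] at ht
      obtain ⟨ht0, hte, -⟩ := ht
      -- The control shifted by `t` is feasible from the position at time `t`, hence a slice of an
      -- admissible policy, to which `EdgeAdmissible` applies.
      obtain ⟨π, hπ, hπα⟩ := exists_admissible_extending hN hf hstar hctrl hact hinact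
        (shift_mem_detCtrl hf hα ht0.le)
      have h1 := hθα _ hte π hπ
      rw [ae_restrict_iff' measurableSet_Icc] at h1
      have h2 := (measurePreserving_sub_right volume t).quasiMeasurePreserving.ae h1
      refine measure_mono_null (fun r hr => ?_) h2
      simp only [mem_compl_iff, mem_ofPred_eq]
      simp only [mem_inter_iff, mem_ofPred_eq, Classical.not_imp] at hr
      intro hcon
      refine hr.1.2.2 ?_
      have h3 := hcon ⟨by linarith [hr.2.1], by linarith [hr.2.2]⟩
      have h4 := congrFun hπα (r - t)
      rw [h4] at h3
      simpa using h3
  have hend : ∀ᵐ t, 0 < t → M.traj γ x α t = M.e j → α t ∈ M.edgeCtrl γ j := by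
    -- While the trajectory rests at the vertex its velocity vanishes almost everywhere, so the
    -- field vanishes there for the control in use.
    have h1 : ∀ n : ℕ, ∀ᵐ t, t ∈ Ioo (0 : ℝ) n → M.traj γ x α t = M.e j →
        M.f γ (M.traj γ x α t) (α t) = 0 := fun n =>
      (traj_aeDeriv hf γ x hα.1 n.cast_nonneg).ae_eq_zero_of_level (M.e j)
    filter_upwards [ae_all_iff.2 h1] with t ht h0 he
    obtain ⟨n, hn⟩ := exists_nat_gt t
    have := ht n ⟨h0, hn⟩ he
    rw [he] at this
    exact mem_edgeCtrl_of_field_eq_zero hf hctrl this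
  filter_upwards [hinterior, hend] with t h1 h2 h0 hseg hne
  obtain ⟨r, hr, hrt⟩ := hseg
  rcases hr.2.eq_or_lt with h | h
  · refine h2 h0 ?_
    rw [← hrt, h]; simp
  · refine h1 h0 ⟨r, ⟨lt_of_le_of_ne hr.1 fun h0 => hne ?_, h⟩, hrt⟩
    rw [← hrt, ← h0]; simp

end Viability

end TrafficModel

namespace TrafficModel

section DiscountedControl

open Filter Topology

variable {d m N : ℕ} {E : Type*} {M : TrafficModel d m N E}

/-! ### Deterministic control problems with state-dependent discount rate -/

/-- A function of position and control that is bounded by `B` and uniformly continuous in the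
position on the network, measurable along curves on the network, and does not depend at `O` on the
controls of an inactive edge. -/
structure RegularCost (M : TrafficModel d m N E) (γ : E)
    (g : EuclideanSpace ℝ (Fin m) → M.A → ℝ) (B : ℝ) : Prop where
  abs_le : ∀ x ∈ M.network, ∀ a, |g x a| ≤ B
  modulus : ∀ ε > 0, ∃ ρ > 0, ∀ x ∈ M.network, ∀ z ∈ M.network, ‖x - z‖ ≤ ρ →
    ∀ a, |g x a - g z a| ≤ ε
  measurable : ∀ y : ℝ → EuclideanSpace ℝ (Fin m), Continuous y → (∀ t, y t ∈ M.network) →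
    ∀ α : ℝ → M.A, Measurable α → Measurable fun t => g (y t) (α t)
  compatible : ∀ j, γ ∉ M.active j → ∀ a ∈ M.edgeCtrl γ j, ∀ b ∈ M.edgeCtrl γ j, g 0 a = g 0 b

/-- The discount factor with rate `q` along a trajectory. -/
noncomputable def disc (M : TrafficModel d m N E) (γ : E)
    (q : EuclideanSpace ℝ (Fin m) → M.A → ℝ) (x : EuclideanSpace ℝ (Fin m)) (α : ℝ → M.A)
    (t : ℝ) : ℝ :=
  Real.exp (-∫ s in (0 : ℝ)..t, q (M.traj γ x α s) (α s))

/-- The discounted cost of a control. -/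
noncomputable def discCost (M : TrafficModel d m N E) (γ : E)
    (q L : EuclideanSpace ℝ (Fin m) → M.A → ℝ) (x : EuclideanSpace ℝ (Fin m))
    (α : ℝ → M.A) : ℝ :=
  ∫ t in Ioi (0 : ℝ), M.disc γ q x α t * L (M.traj γ x α t) (α t)

/-- The value function of the discounted control problem. -/
noncomputable def discValue (M : TrafficModel d m N E) (γ : E)
    (q L : EuclideanSpace ℝ (Fin m) → M.A → ℝ) (x : EuclideanSpace ℝ (Fin m)) : ℝ :=
  ⨅ α : M.detCtrl γ x, M.discCost γ q L x α.1

variable {γ : E} {q L g : EuclideanSpace ℝ (Fin m) → M.A → ℝ} {B C δ : ℝ}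
  {x z : EuclideanSpace ℝ (Fin m)} {α β : ℝ → M.A}

lemma mem_network_of_detCtrl (hf : M.FieldRegular) (hα : α ∈ M.detCtrl γ x) :
    x ∈ M.network := by
  have := hα.2 0 le_rfl
  rwa [traj_zero hf γ x hα.1] at this

namespace RegularCost

lemma nonneg (hg : M.RegularCost γ g B) (hx : x ∈ M.network) (a : M.A) : 0 ≤ B :=
  (abs_nonneg _).trans (hg.abs_le x hx a)

lemma measurable_along (hg : M.RegularCost γ g B) (hf : M.FieldRegular)
    (hα : α ∈ M.detCtrl γ x) : Measurable fun t => g (M.traj γ x α (max 0 t)) (α t) :=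
  hg.measurable _ (continuous_comp_max (traj_continuousOn hf γ x hα.1))
    (fun _ => hα.2 _ (le_max_left _ _)) α hα.1

lemma abs_along_le (hg : M.RegularCost γ g B) (hα : α ∈ M.detCtrl γ x) (t : ℝ) :
    |g (M.traj γ x α (max 0 t)) (α t)| ≤ B :=
  hg.abs_le _ (hα.2 _ (le_max_left _ _)) _

lemma intervalIntegrable_along (hg : M.RegularCost γ g B) (hf : M.FieldRegular)
    (hα : α ∈ M.detCtrl γ x) (a b : ℝ) :
    IntervalIntegrable (fun t => g (M.traj γ x α (max 0 t)) (α t)) volume a b := by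
  have hB : 0 ≤ B := hg.nonneg (mem_network_of_detCtrl hf hα) (α 0)
  exact intervalIntegrable_of_bounded (C := ⟨B, hB⟩) (hg.measurable_along hf hα)
    (hg.abs_along_le hα) a b

lemma intervalIntegrable (hg : M.RegularCost γ g B) (hf : M.FieldRegular)
    (hα : α ∈ M.detCtrl γ x) {a b : ℝ} (ha : 0 ≤ a) (hb : 0 ≤ b) :
    IntervalIntegrable (fun t => g (M.traj γ x α t) (α t)) volume a b := by
  refine (hg.intervalIntegrable_along hf hα a b).congr fun s hs => ?_
  have : 0 ≤ s := (le_min ha hb).trans hs.1.le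
  simp only [max_eq_right this]

end RegularCost

lemma disc_pos (t : ℝ) : 0 < M.disc γ q x α t := Real.exp_pos _

lemma disc_eq_along {t : ℝ} (ht : 0 ≤ t) : M.disc γ q x α t =
    Real.exp (-∫ s in (0 : ℝ)..t, q (M.traj γ x α (max 0 s)) (α s)) := by
  rw [disc]
  congr 2
  refine intervalIntegral.integral_congr fun s hs => ?_
  rw [uIcc_of_le ht] at hs
  simp only [max_eq_right hs.1]

lemma disc_le_exp (hf : M.FieldRegular) (hq : M.RegularCost γ q C) (hδ : ∀ x a, δ ≤ q x a)
    (hα : α ∈ M.detCtrl γ x) {t : ℝ} (ht : 0 ≤ t) :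
    M.disc γ q x α t ≤ Real.exp (-(δ * t)) := by
  refine Real.exp_le_exp.2 (neg_le_neg ?_)
  have := intervalIntegral.integral_mono_on (μ := volume) ht (f := fun _ => δ)
    (g := fun s => q (M.traj γ x α s) (α s)) intervalIntegrable_const
    (hq.intervalIntegrable hf hα le_rfl ht) fun s _ => hδ _ _
  simpa [mul_comm] using this

lemma disc_le_one (hf : M.FieldRegular) (hq : M.RegularCost γ q C) (hδ : ∀ x a, δ ≤ q x a)
    (hδ0 : 0 ≤ δ) (hα : α ∈ M.detCtrl γ x) {t : ℝ} (ht : 0 ≤ t) : M.disc γ q x α t ≤ 1 :=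
  (disc_le_exp hf hq hδ hα ht).trans
    (Real.exp_le_one_iff.2 (neg_nonpos.2 (mul_nonneg hδ0 ht)))

lemma one_sub_le_disc (hq : M.RegularCost γ q C) (hα : α ∈ M.detCtrl γ x) {t : ℝ}
    (ht : 0 ≤ t) : 1 - C * t ≤ M.disc γ q x α t := by
  have h1 : ∫ s in (0 : ℝ)..t, q (M.traj γ x α s) (α s) ≤ C * t := by
    refine (le_abs_self _).trans ?_
    rw [← Real.norm_eq_abs]
    refine (intervalIntegral.norm_integral_le_of_norm_le_const (C := C) fun s hs => ?_).trans_eq ?_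
    · rw [uIoc_of_le ht] at hs
      exact hq.abs_le _ (hα.2 s hs.1.le) _
    · rw [sub_zero, abs_of_nonneg ht]
  have := Real.add_one_le_exp (-∫ s in (0 : ℝ)..t, q (M.traj γ x α s) (α s))
  rw [disc]
  linarith

lemma disc_add (hf : M.FieldRegular) (hq : M.RegularCost γ q C) (hα : α ∈ M.detCtrl γ x)
    {s t : ℝ} (hs : 0 ≤ s) (ht : 0 ≤ t) : M.disc γ q x α (s + t) =
      M.disc γ q x α s * M.disc γ q (M.traj γ x α s) (fun r => α (s + r)) t := by
  rw [disc, disc, disc, ← Real.exp_add, ← neg_add,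
    ← intervalIntegral.integral_add_adjacent_intervals
      (hq.intervalIntegrable hf hα le_rfl hs)
      (hq.intervalIntegrable hf hα hs (add_nonneg hs ht))]
  congr 3
  have := intervalIntegral.integral_comp_add_left (a := 0) (b := t)
    (fun r => q (M.traj γ x α r) (α r)) s
  rw [add_zero] at this
  rw [← this]
  refine intervalIntegral.integral_congr fun r hr => ?_
  rw [uIcc_of_le ht] at hr
  rw [traj_shift hf γ x hα.1 hs hr.1]

lemma measurable_disc_along (hf : M.FieldRegular) (hq : M.RegularCost γ q C)
    (hα : α ∈ M.detCtrl γ x) : Measurable fun t =>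
      Real.exp (-∫ s in (0 : ℝ)..t, q (M.traj γ x α (max 0 s)) (α s)) :=
  (Real.continuous_exp.comp (intervalIntegral.continuous_primitive
    (hq.intervalIntegrable_along hf hα) 0).neg).measurable

lemma integrableOn_disc_mul (hf : M.FieldRegular) (hq : M.RegularCost γ q C)
    (hδ : ∀ x a, δ ≤ q x a) (hδ0 : 0 < δ) (hL : M.RegularCost γ L B)
    (hα : α ∈ M.detCtrl γ x) :
    IntegrableOn (fun t => M.disc γ q x α t * L (M.traj γ x α t) (α t)) (Ioi 0) := by
  have hB : 0 ≤ B := hL.nonneg (mem_network_of_detCtrl hf hα) (α 0)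
  have hdom : IntegrableOn (fun t => Real.exp (-δ * t) * B) (Ioi 0) :=
    (integrableOn_exp_mul_Ioi (by linarith) 0).mul_const B
  refine Integrable.mono' hdom ?_ ?_
  · refine (((measurable_disc_along hf hq hα).mul
      (hL.measurable_along hf hα)).aestronglyMeasurable).congr ?_
    filter_upwards [ae_restrict_mem measurableSet_Ioi] with t ht
    rw [disc_eq_along (le_of_lt ht)]
    simp only [Pi.mul_apply, max_eq_right (le_of_lt (mem_Ioi.1 ht))]
  · filter_upwards [ae_restrict_mem measurableSet_Ioi] with t ht
    rw [norm_mul, Real.norm_eq_abs, Real.norm_eq_abs, abs_of_pos (disc_pos t)]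
    refine mul_le_mul ?_ (hL.abs_le _ (hα.2 t (le_of_lt ht)) _) (abs_nonneg _) (Real.exp_pos _).le
    rw [neg_mul]
    exact disc_le_exp hf hq hδ hα (le_of_lt ht)

lemma abs_discCost_le (hf : M.FieldRegular) (hq : M.RegularCost γ q C)
    (hδ : ∀ x a, δ ≤ q x a) (hδ0 : 0 < δ) (hL : M.RegularCost γ L B)
    (hα : α ∈ M.detCtrl γ x) : |M.discCost γ q L x α| ≤ B / δ := by
  have hdom : IntegrableOn (fun t => Real.exp (-δ * t) * B) (Ioi 0) :=
    (integrableOn_exp_mul_Ioi (by linarith) 0).mul_const B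
  rw [← Real.norm_eq_abs, discCost]
  refine (norm_integral_le_of_norm_le hdom ?_).trans_eq ?_
  · filter_upwards [ae_restrict_mem measurableSet_Ioi] with t ht
    rw [norm_mul, Real.norm_eq_abs, Real.norm_eq_abs, abs_of_pos (disc_pos t)]
    refine mul_le_mul ?_ (hL.abs_le _ (hα.2 t (le_of_lt ht)) _) (abs_nonneg _) (Real.exp_pos _).le
    rw [neg_mul]
    exact disc_le_exp hf hq hδ hα (le_of_lt ht)
  · rw [integral_mul_const, integral_exp_mul_Ioi (by linarith : -δ < 0) 0]
    simp
    ring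

lemma discCost_split (hf : M.FieldRegular) (hq : M.RegularCost γ q C)
    (hδ : ∀ x a, δ ≤ q x a) (hδ0 : 0 < δ) (hL : M.RegularCost γ L B)
    (hα : α ∈ M.detCtrl γ x) {τ : ℝ} (hτ : 0 ≤ τ) : M.discCost γ q L x α =
      (∫ t in (0 : ℝ)..τ, M.disc γ q x α t * L (M.traj γ x α t) (α t)) +
        M.disc γ q x α τ * M.discCost γ q L (M.traj γ x α τ) (fun r => α (τ + r)) := by
  have hint := integrableOn_disc_mul hf hq hδ hδ0 hL hα
  rw [discCost, ← Ioc_union_Ioi_eq_Ioi hτ, setIntegral_union (Ioc_disjoint_Ioi le_rfl)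
    measurableSet_Ioi (hint.mono_set Ioc_subset_Ioi_self)
    (hint.mono_set (Ioi_subset_Ioi hτ)), intervalIntegral.integral_of_le hτ]
  congr 1
  rw [discCost, ← integral_const_mul]
  have hshift := (measurePreserving_add_left volume τ).setIntegral_preimage_emb
    (measurableEmbedding_addLeft τ)
    (fun t => M.disc γ q x α t * L (M.traj γ x α t) (α t)) (Ioi τ)
  rw [← hshift]
  have hpre : (fun t => τ + t) ⁻¹' Ioi τ = Ioi 0 := by
    ext t; simp
  rw [hpre]
  refine setIntegral_congr_fun measurableSet_Ioi fun t ht => ?_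
  have ht' : 0 ≤ t := le_of_lt ht
  rw [disc_add hf hq hα hτ ht', traj_shift hf γ x hα.1 hτ ht', mul_assoc]

lemma bddBelow_discCost (hf : M.FieldRegular) (hq : M.RegularCost γ q C)
    (hδ : ∀ x a, δ ≤ q x a) (hδ0 : 0 < δ) (hL : M.RegularCost γ L B) :
    BddBelow (range fun α : M.detCtrl γ x => M.discCost γ q L x α.1) :=
  ⟨-(B / δ), by
    rintro _ ⟨α, rfl⟩
    exact (abs_le.1 (abs_discCost_le hf hq hδ hδ0 hL α.2)).1⟩

lemma discValue_le (hf : M.FieldRegular) (hq : M.RegularCost γ q C)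
    (hδ : ∀ x a, δ ≤ q x a) (hδ0 : 0 < δ) (hL : M.RegularCost γ L B)
    (hα : α ∈ M.detCtrl γ x) : M.discValue γ q L x ≤ M.discCost γ q L x α :=
  ciInf_le (bddBelow_discCost hf hq hδ hδ0 hL) ⟨α, hα⟩

lemma exists_discCost_lt (hne : ∀ x ∈ M.network, (M.detCtrl γ x).Nonempty)
    (hx : x ∈ M.network) {ε : ℝ} (hε : 0 < ε) :
    ∃ α ∈ M.detCtrl γ x, M.discCost γ q L x α < M.discValue γ q L x + ε := by
  have := (hne x hx).to_subtype
  obtain ⟨α, hα⟩ := exists_lt_of_ciInf_lt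
    (show ⨅ α : M.detCtrl γ x, M.discCost γ q L x α.1 < M.discValue γ q L x + ε from
      lt_add_of_pos_right _ hε)
  exact ⟨α.1, α.2, hα⟩

lemma abs_discValue_le (hf : M.FieldRegular) (hq : M.RegularCost γ q C)
    (hδ : ∀ x a, δ ≤ q x a) (hδ0 : 0 < δ) (hL : M.RegularCost γ L B)
    (hne : ∀ x ∈ M.network, (M.detCtrl γ x).Nonempty) (hx : x ∈ M.network) :
    |M.discValue γ q L x| ≤ B / δ := by
  have := (hne x hx).to_subtype
  obtain ⟨α, hα⟩ := hne x hx
  refine abs_le.2 ⟨le_ciInf fun α => (abs_le.1 (abs_discCost_le hf hq hδ hδ0 hL α.2)).1, ?_⟩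
  exact (discValue_le hf hq hδ hδ0 hL hα).trans (abs_le.1 (abs_discCost_le hf hq hδ hδ0 hL hα)).2

/-- Dynamic programming: it is not better to follow a given control up to the time `τ`. -/
lemma discValue_le_split (hf : M.FieldRegular) (hq : M.RegularCost γ q C)
    (hδ : ∀ x a, δ ≤ q x a) (hδ0 : 0 < δ) (hL : M.RegularCost γ L B)
    (hne : ∀ x ∈ M.network, (M.detCtrl γ x).Nonempty)
    (hα : α ∈ M.detCtrl γ x) {τ : ℝ} (hτ : 0 ≤ τ) : M.discValue γ q L x ≤
      (∫ t in (0 : ℝ)..τ, M.disc γ q x α t * L (M.traj γ x α t) (α t)) +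
        M.disc γ q x α τ * M.discValue γ q L (M.traj γ x α τ) := by
  refine le_of_forall_pos_le_add fun ε hε => ?_
  -- After `τ` the given control is continued by an ε-optimal one; the discount factor is at most 1,
  -- so the loss remains at most ε.
  obtain ⟨β, hβ, hlt⟩ := exists_discCost_lt (q := q) (L := L) hne (hα.2 τ hτ) hε
  have hc := concat_mem_detCtrl hf hα.1 hτ (fun t ht => hα.2 t ht.1) hβ
  have h1 := discValue_le hf hq hδ hδ0 hL hc
  rw [discCost_split hf hq hδ hδ0 hL hc hτ,
    traj_concat_left hf γ x hα.1 hβ.1 ⟨hτ, le_rfl⟩] at h1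
  have hae : ∀ s ∈ Ioo 0 τ, M.traj γ x (concat τ α β) s = M.traj γ x α s ∧
      concat τ α β s = α s := fun s hs =>
    ⟨traj_concat_left hf γ x hα.1 hβ.1 ⟨hs.1.le, hs.2.le⟩, concat_of_lt α β hs.2⟩
  have hd : ∀ t ∈ Icc 0 τ, M.disc γ q x (concat τ α β) t = M.disc γ q x α t := by
    intro t ht
    rw [disc, disc]
    congr 2
    rw [intervalIntegral.integral_of_le ht.1, intervalIntegral.integral_of_le ht.1,
      integral_Ioc_eq_integral_Ioo, integral_Ioc_eq_integral_Ioo]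
    refine setIntegral_congr_fun measurableSet_Ioo fun s hs => ?_
    have := hae s ⟨hs.1, hs.2.trans_le ht.2⟩
    simp only [this.1, this.2]
  have hI : ∫ t in (0 : ℝ)..τ, M.disc γ q x (concat τ α β) t *
        L (M.traj γ x (concat τ α β) t) (concat τ α β t) =
      ∫ t in (0 : ℝ)..τ, M.disc γ q x α t * L (M.traj γ x α t) (α t) := by
    rw [intervalIntegral.integral_of_le hτ, intervalIntegral.integral_of_le hτ,
      integral_Ioc_eq_integral_Ioo, integral_Ioc_eq_integral_Ioo]
    refine setIntegral_congr_fun measurableSet_Ioo fun s hs => ?_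
    have := hae s hs
    simp only [this.1, this.2, hd s (Ioo_subset_Icc_self hs)]
  have hcost : M.discCost γ q L (M.traj γ x α τ) (fun r => concat τ α β (τ + r)) =
      M.discCost γ q L (M.traj γ x α τ) β := by
    rw [discCost, discCost]
    refine setIntegral_congr_fun measurableSet_Ioi fun t ht => ?_
    have hs := measurable_shift (measurable_concat (θ := τ) hα.1 hβ.1) τ
    have htr : ∀ s, 0 ≤ s → M.traj γ (M.traj γ x α τ) (fun r => concat τ α β (τ + r)) s =
        M.traj γ (M.traj γ x α τ) β s := fun s hs0 =>
      traj_congr hf hs hβ.1 (Eventually.of_forall fun r hr => concat_add α β hr.1.le)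
        ⟨hs0, le_rfl⟩
    have ht' : 0 ≤ t := le_of_lt ht
    rw [htr t ht', concat_add α β ht', disc, disc]
    congr 3
    refine intervalIntegral.integral_congr fun s hs => ?_
    rw [uIcc_of_le ht'] at hs
    rw [htr s hs.1, concat_add α β hs.1]
  rw [hI, hd τ ⟨hτ, le_rfl⟩, hcost] at h1
  have h2 := disc_le_one hf hq hδ hδ0.le hα hτ
  have h3 := disc_pos (M := M) (γ := γ) (q := q) (x := x) (α := α) τ
  nlinarith [mul_le_mul_of_nonneg_left hlt.le h3.le]

lemma abs_exp_neg_sub_le {a b : ℝ} (ha : 0 ≤ a) (hb : 0 ≤ b) :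
    |Real.exp (-a) - Real.exp (-b)| ≤ |a - b| := by
  wlog hab : a ≤ b generalizing a b
  · rw [abs_sub_comm, abs_sub_comm a]; exact this hb ha (le_of_not_ge hab)
  rw [abs_of_nonneg (sub_nonneg.2 (Real.exp_le_exp.2 (neg_le_neg hab))), abs_sub_comm,
    abs_of_nonneg (sub_nonneg.2 hab)]
  have h1 : Real.exp (-b) = Real.exp (-a) * Real.exp (-(b - a)) := by
    rw [← Real.exp_add]; congr 1; ring
  have h2 := Real.add_one_le_exp (-(b - a))
  have h3 : Real.exp (-a) ≤ 1 := Real.exp_le_one_iff.2 (by linarith)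
  have h4 := Real.exp_pos (-a)
  rw [h1]
  nlinarith [mul_le_mul_of_nonneg_left h2 h4.le]

lemma abs_disc_sub_le (hf : M.FieldRegular) (hq : M.RegularCost γ q C)
    (hδ : ∀ x a, δ ≤ q x a) (hδ0 : 0 < δ) (hα : α ∈ M.detCtrl γ x) (hβ : β ∈ M.detCtrl γ z)
    {τ η : ℝ} (h : ∀ᵐ t, t ∈ Ioo 0 τ →
      |q (M.traj γ z β t) (β t) - q (M.traj γ x α t) (α t)| ≤ η) {t : ℝ} (ht : t ∈ Icc 0 τ) :
    |M.disc γ q z β t - M.disc γ q x α t| ≤ η * t := by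
  have hnn : ∀ x (α : ℝ → M.A), 0 ≤ ∫ s in (0 : ℝ)..t, q (M.traj γ x α s) (α s) := fun x α =>
    intervalIntegral.integral_nonneg ht.1 fun s _ => hδ0.le.trans (hδ _ _)
  refine (abs_exp_neg_sub_le (hnn z β) (hnn x α)).trans ?_
  rw [← intervalIntegral.integral_sub (hq.intervalIntegrable hf hβ le_rfl ht.1)
    (hq.intervalIntegrable hf hα le_rfl ht.1), ← Real.norm_eq_abs]
  refine (intervalIntegral.norm_integral_le_of_norm_le_const_ae (C := η) ?_).trans_eq ?_
  · have hne : ∀ᵐ s : ℝ, s ≠ t := by simp [ae_iff]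
    filter_upwards [h, hne] with s hs hst hm
    rw [uIoc_of_le ht.1] at hm
    exact hs ⟨hm.1, (lt_of_le_of_ne hm.2 hst).trans_le ht.2⟩
  · rw [sub_zero, abs_of_nonneg ht.1]

/-- Comparison of the value at `z` with the cost of a control at `x`, when along two trajectories
the discount rates and the running costs are close up to the time `τ`. -/
lemma discValue_le_discCost_add (hf : M.FieldRegular) (hq : M.RegularCost γ q C)
    (hδ : ∀ x a, δ ≤ q x a) (hδ0 : 0 < δ) (hL : M.RegularCost γ L B)
    (hne : ∀ x ∈ M.network, (M.detCtrl γ x).Nonempty)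
    (hα : α ∈ M.detCtrl γ x) (hβ : β ∈ M.detCtrl γ z) {τ T η ε : ℝ} (hτ : 0 ≤ τ) (hτT : τ ≤ T)
    (hη : 0 ≤ η) (hε : 0 ≤ ε)
    (hqη : ∀ᵐ t, t ∈ Ioo 0 τ →
      |q (M.traj γ z β t) (β t) - q (M.traj γ x α t) (α t)| ≤ η)
    (hLη : ∀ᵐ t, t ∈ Ioo 0 τ →
      |L (M.traj γ z β t) (β t) - L (M.traj γ x α t) (α t)| ≤ η)
    (hend : Real.exp (-(δ * τ)) *
      (M.discValue γ q L (M.traj γ z β τ) - M.discValue γ q L (M.traj γ x α τ)) ≤ ε) :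
    M.discValue γ q L z ≤
      M.discCost γ q L x α + (η * (T * (1 + T * B) + T * (B / δ)) + ε) := by
  have hB : 0 ≤ B := hL.nonneg (mem_network_of_detCtrl hf hα) (α 0)
  have hT : 0 ≤ T := hτ.trans hτT
  have h1 := discValue_le_split hf hq hδ hδ0 hL hne hβ hτ
  have h2 := discCost_split hf hq hδ hδ0 hL hα hτ
  have h3 := discValue_le hf hq hδ hδ0 hL (shift_mem_detCtrl hf hα hτ)
  have hdd := fun t (ht : t ∈ Icc 0 τ) => abs_disc_sub_le hf hq hδ hδ0 hα hβ hqη ht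
  have hii : ∀ {x : EuclideanSpace ℝ (Fin m)} {α : ℝ → M.A}, α ∈ M.detCtrl γ x →
      IntervalIntegrable (fun t => M.disc γ q x α t * L (M.traj γ x α t) (α t)) volume 0 τ :=
    fun hα => (intervalIntegrable_iff_integrableOn_Ioc_of_le hτ).2
      ((integrableOn_disc_mul hf hq hδ hδ0 hL hα).mono_set Ioc_subset_Ioi_self)
  -- The discount factors differ by at most ηT, which multiplies a cost of size B, and the running
  -- costs differ by at most η. Integration over a time of at most T gives this bound.
  have hI : (∫ t in (0 : ℝ)..τ, M.disc γ q z β t * L (M.traj γ z β t) (β t)) -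
      (∫ t in (0 : ℝ)..τ, M.disc γ q x α t * L (M.traj γ x α t) (α t)) ≤
        η * (T * (1 + T * B)) := by
    rw [← intervalIntegral.integral_sub (hii hβ) (hii hα)]
    refine (le_abs_self _).trans ?_
    rw [← Real.norm_eq_abs]
    refine (intervalIntegral.norm_integral_le_of_norm_le_const_ae
      (C := η * (1 + T * B)) ?_).trans ?_
    · have hne : ∀ᵐ s : ℝ, s ≠ τ := by simp [ae_iff]
      filter_upwards [hLη, hne] with s hs hst hm
      rw [uIoc_of_le hτ] at hm
      have hs := hs ⟨hm.1, lt_of_le_of_ne hm.2 hst⟩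
      have e1 := hdd s ⟨hm.1.le, hm.2⟩
      have e2 := hL.abs_le _ (hβ.2 s hm.1.le) (β s)
      have e3 := disc_le_one hf hq hδ hδ0.le hα hm.1.le
      have e4 := disc_pos (M := M) (γ := γ) (q := q) (x := x) (α := α) s
      rw [Real.norm_eq_abs]
      have e5 : M.disc γ q z β s * L (M.traj γ z β s) (β s) -
          M.disc γ q x α s * L (M.traj γ x α s) (α s) =
          (M.disc γ q z β s - M.disc γ q x α s) * L (M.traj γ z β s) (β s) +
          M.disc γ q x α s * (L (M.traj γ z β s) (β s) - L (M.traj γ x α s) (α s)) := by ring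
      rw [e5]
      refine (abs_add_le _ _).trans ?_
      rw [abs_mul, abs_mul, abs_of_pos e4]
      have e6 : |M.disc γ q z β s - M.disc γ q x α s| * |L (M.traj γ z β s) (β s)| ≤
          (η * T) * B :=
        mul_le_mul (e1.trans (mul_le_mul_of_nonneg_left (hm.2.trans hτT) hη)) e2 (abs_nonneg _)
          (by positivity)
      have e7 : M.disc γ q x α s * |L (M.traj γ z β s) (β s) - L (M.traj γ x α s) (α s)| ≤
          1 * η := mul_le_mul e3 hs (abs_nonneg _) zero_le_one
      linarith
    · rw [sub_zero, abs_of_nonneg hτ]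
      have : 0 ≤ η * (1 + T * B) := by positivity
      nlinarith [mul_le_mul_of_nonneg_left hτT this]
  set vz := M.discValue γ q L (M.traj γ z β τ)
  set vx := M.discValue γ q L (M.traj γ x α τ)
  have hvx : |vx| ≤ B / δ := abs_discValue_le hf hq hδ hδ0 hL hne (hα.2 τ hτ)
  have hpos := disc_pos (M := M) (γ := γ) (q := q) (x := x) (α := α) τ
  have hposz := disc_pos (M := M) (γ := γ) (q := q) (x := z) (α := β) τ
  -- Enlarging the discount factor to exp(-δτ) is legitimate only for a nonnegative difference;
  -- otherwise the product is already nonpositive.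
  have h4 : M.disc γ q z β τ * (vz - vx) ≤ ε := by
    rcases le_total vz vx with h | h
    · nlinarith
    · refine le_trans (mul_le_mul_of_nonneg_right ?_ (sub_nonneg.2 h)) hend
      exact disc_le_exp hf hq hδ hβ hτ
  have h5 : (M.disc γ q z β τ - M.disc γ q x α τ) * vx ≤ η * (T * (B / δ)) := by
    refine (le_abs_self _).trans ?_
    rw [abs_mul]
    have := mul_le_mul (hdd τ ⟨hτ, le_rfl⟩) hvx (abs_nonneg _) (by positivity)
    refine this.trans ?_
    rw [mul_assoc]
    refine mul_le_mul_of_nonneg_left (mul_le_mul_of_nonneg_right hτT (by positivity)) hη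
  have h6 := mul_le_mul_of_nonneg_left h3 hpos.le
  nlinarith

/-- If a point `p` can be reached from `x` in the time `θ`, then the value at `x` exceeds the
value at `p` at most by a multiple of `θ`. -/
lemma discValue_le_of_reach (hf : M.FieldRegular) (hq : M.RegularCost γ q C)
    (hδ : ∀ x a, δ ≤ q x a) (hδ0 : 0 < δ) (hL : M.RegularCost γ L B)
    (hne : ∀ x ∈ M.network, (M.detCtrl γ x).Nonempty) (hα : Measurable α) {θ : ℝ} (hθ : 0 ≤ θ)
    (hnet : ∀ t ∈ Icc 0 θ, M.traj γ x α t ∈ M.network) :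
    M.discValue γ q L x ≤
      M.discValue γ q L (M.traj γ x α θ) + θ * (B + C * (B / δ)) := by
  obtain ⟨β, hβ⟩ := hne _ (hnet θ ⟨hθ, le_rfl⟩)
  have hc := concat_mem_detCtrl hf hα hθ hnet hβ
  have h1 := discValue_le_split hf hq hδ hδ0 hL hne hc hθ
  rw [traj_concat_left hf γ x hα hβ.1 ⟨hθ, le_rfl⟩] at h1
  have h2 : ∫ t in (0 : ℝ)..θ, M.disc γ q x (concat θ α β) t *
      L (M.traj γ x (concat θ α β) t) (concat θ α β t) ≤ B * θ := by
    refine (le_abs_self _).trans ?_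
    rw [← Real.norm_eq_abs]
    refine (intervalIntegral.norm_integral_le_of_norm_le_const (C := B) fun s hs => ?_).trans_eq ?_
    · rw [uIoc_of_le hθ] at hs
      rw [norm_mul, Real.norm_eq_abs, Real.norm_eq_abs, abs_of_pos (disc_pos s), ← one_mul B]
      exact mul_le_mul (disc_le_one hf hq hδ hδ0.le hc hs.1.le)
        (hL.abs_le _ (hc.2 s hs.1.le) _) (abs_nonneg _) zero_le_one
    · rw [sub_zero, abs_of_nonneg hθ]
  have hv := abs_discValue_le hf hq hδ hδ0 hL hne (hnet θ ⟨hθ, le_rfl⟩)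
  have h3 := disc_le_one hf hq hδ hδ0.le hc hθ
  have h4 := one_sub_le_disc hq hc hθ
  set D := M.disc γ q x (concat θ α β) θ
  set v := M.discValue γ q L (M.traj γ x α θ)
  -- The discount factor at `θ` is at least 1 - Cθ, and values are bounded by B/δ.
  have h5 : (D - 1) * v ≤ C * θ * (B / δ) := by
    refine (le_abs_self _).trans ?_
    rw [abs_mul]
    exact mul_le_mul (abs_le.2 ⟨by linarith, by linarith⟩) hv (abs_nonneg _) (by linarith)
  nlinarith

end DiscountedControl

end TrafficModel

/-! ### Hitting times of curves on the line -/

section Hitting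

open Filter Topology

lemma exists_first_mem {S : Set ℝ} (hS : IsClosed S) (hne : S.Nonempty) (h0 : ∀ t ∈ S, 0 ≤ t) :
    ∃ τ ∈ S, ∀ t, t < τ → t ∉ S :=
  ⟨sInf S, hS.csInf_mem hne ⟨0, h0⟩, fun _ ht hmem =>
    absurd (csInf_le ⟨0, h0⟩ hmem) (not_le.2 ht)⟩

lemma mem_Icc_of_mem_Ico {X : Type*} [TopologicalSpace X] {y : ℝ → X} {τ : ℝ} {S : Set X}
    (hy : ContinuousOn y (Icc 0 τ)) (hS : IsClosed S) (h0 : y 0 ∈ S)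
    (h : ∀ t ∈ Ico 0 τ, y t ∈ S) {t : ℝ} (ht : t ∈ Icc 0 τ) : y t ∈ S := by
  rcases (ht.1.trans ht.2).eq_or_lt with rfl | hτ
  · rwa [le_antisymm ht.2 ht.1]
  have hcl : IsClosed (Icc 0 τ ∩ y ⁻¹' S) := hy.preimage_isClosed_of_isClosed isClosed_Icc hS
  have : closure (Ico 0 τ) ⊆ Icc 0 τ ∩ y ⁻¹' S :=
    hcl.closure_subset_iff.2 fun s hs => ⟨Ico_subset_Icc_self hs, h s hs⟩
  rw [closure_Ico hτ.ne] at this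
  exact (this ht).2

namespace AEDeriv

variable {ζ w : ℝ → ℝ} {K : ℝ≥0} {T θ b b' p r β κ : ℝ}

lemma clm_comp {H : Type*} [NormedAddCommGroup H] [NormedSpace ℝ H] {y w : ℝ → H} {a b : ℝ}
    (h : AEDeriv y w K a b) (φ : H →L[ℝ] ℝ) :
    AEDeriv (fun t => φ (y t)) (fun t => φ (w t)) (‖φ‖₊ * K) a b :=
  ⟨φ.lipschitz.comp_lipschitzOnWith h.1, by
    filter_upwards [h.2] with t ht hm using φ.hasFDerivAt.comp_hasDerivAt t (ht hm)⟩

/-- A curve that does not increase slightly above a level remains below this level. -/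
lemma le_of_nonpos_slightly_above (h : AEDeriv ζ w K 0 T) (h0 : ζ 0 ≤ b) (hb : b < b')
    (hw : ∀ᵐ t, t ∈ Ioo 0 T → b < ζ t → ζ t < b' → w t ≤ 0) {t : ℝ} (ht : t ∈ Icc 0 T) :
    ζ t ≤ b := by
  by_contra! hlt
  -- Up to the first time at which the level `c` is attained, the curve stays below `b'`. The
  -- hypothesis is then in force whenever the curve is above `b`, so the level `c > b` could not be
  -- attained.
  obtain ⟨c, hc1, hc2⟩ := exists_between (lt_min hb hlt)
  have hcl : IsClosed (Icc 0 t ∩ ζ ⁻¹' Ici c) :=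
    (h.continuousOn.mono (Icc_subset_Icc_right ht.2)).preimage_isClosed_of_isClosed
      isClosed_Icc isClosed_Ici
  obtain ⟨τ, hτ, hfirst⟩ := exists_first_mem hcl
    ⟨t, ⟨ht.1, le_rfl⟩, (hc2.le.trans (min_le_right _ _))⟩ fun s hs => hs.1.1
  have hle := (h.mono le_rfl (hτ.1.2.trans ht.2)).le_of_nonpos_above h0 (by
    filter_upwards [hw] with s hs hm hbs
    refine hs ⟨hm.1, hm.2.trans_le (hτ.1.2.trans ht.2)⟩ hbs ?_
    by_contra! hge
    exact hfirst s hm.2 ⟨⟨hm.1.le, hm.2.le.trans hτ.1.2⟩,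
      (hc2.le.trans (min_le_left _ _)).trans hge⟩) (t := τ) ⟨hτ.1.1, le_rfl⟩
  exact absurd (hτ.2.trans hle) (not_le.2 hc1)

lemma exists_first_hit (h : ContinuousOn ζ (Icc 0 θ)) (h0 : ζ 0 ≤ p)
    (hne : ∃ t ∈ Icc 0 θ, p ≤ ζ t) : ∃ τ ∈ Icc 0 θ, ζ τ = p ∧ ∀ t ∈ Icc 0 τ, ζ t ≤ p := by
  have hcl : IsClosed (Icc 0 θ ∩ ζ ⁻¹' Ici p) :=
    h.preimage_isClosed_of_isClosed isClosed_Icc isClosed_Ici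
  obtain ⟨τ, hτ, hfirst⟩ := exists_first_mem hcl hne fun s hs => hs.1.1
  have hle : ∀ t ∈ Icc 0 τ, ζ t ∈ Iic p := fun t ht =>
    mem_Icc_of_mem_Ico (h.mono (Icc_subset_Icc_right hτ.1.2)) isClosed_Iic h0
      (fun s hs => by
        by_contra hgt
        have hgt : p < ζ s := not_le.1 hgt
        exact hfirst s hs.2 ⟨⟨hs.1, hs.2.le.trans hτ.1.2⟩, hgt.le⟩) ht
  exact ⟨τ, hτ.1, le_antisymm (hle τ ⟨hτ.1.1, le_rfl⟩) hτ.2, hle⟩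

/-- A curve that increases with speed at least `β` below the level `p` reaches this level. -/
lemma exists_hit_of_le (h : AEDeriv ζ w K 0 θ) (hθ : 0 ≤ θ) (h0 : ζ 0 ≤ p)
    (hp : p - ζ 0 ≤ β * θ) (hw : ∀ᵐ t, t ∈ Ioo 0 θ → ζ t < p → β ≤ w t) :
    ∃ τ ∈ Icc 0 θ, ζ τ = p ∧ ∀ t ∈ Icc 0 τ, ζ t ≤ p := by
  refine exists_first_hit h.continuousOn h0 ?_
  by_contra! hno
  have hlin : AbsolutelyContinuousOnInterval (fun s : ℝ => β * s) 0 θ := by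
    apply ContDiffOn.absolutelyContinuousOnInterval
    fun_prop
  have := le_of_ae_hasDerivAt_nonpos hθ (hlin.sub (h.absolutelyContinuous hθ)) (by
    filter_upwards [h.2, hw] with t h1 h2 hm
    refine ⟨_, ?_, ((hasDerivAt_id t).const_mul β).sub (h1 hm)⟩
    have := h2 hm (hno t (Ioo_subset_Icc_self hm))
    linarith)
  simp only [Pi.sub_apply, mul_zero] at this
  have := hno θ ⟨hθ, le_rfl⟩
  linarith

/-- A curve that decreases with speed at least `β` above the level `p` reaches this level. -/
lemma exists_hit_of_ge (h : AEDeriv ζ w K 0 θ) (hθ : 0 ≤ θ) (h0 : p ≤ ζ 0)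
    (hp : ζ 0 - p ≤ β * θ) (hw : ∀ᵐ t, t ∈ Ioo 0 θ → p < ζ t → w t ≤ -β) :
    ∃ τ ∈ Icc 0 θ, ζ τ = p ∧ ∀ t ∈ Icc 0 τ, p ≤ ζ t := by
  obtain ⟨τ, hτ, h1, h2⟩ := h.neg.exists_hit_of_le (p := -p) hθ (by linarith)
    (by linarith : -p - -ζ 0 ≤ β * θ)
    (by filter_upwards [hw] with t ht hm hlt; linarith [ht hm (by linarith)])
  exact ⟨τ, hτ, by linarith, fun t ht => by linarith [h2 t ht]⟩

/-- A curve that decreases with speed at least `β ζ ^ κ` for some `κ < 1` reaches `0`. -/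
lemma exists_hit_zero (h : AEDeriv ζ w K 0 θ) (hθ : 0 ≤ θ) (h0 : 0 ≤ ζ 0) (hκ : κ < 1)
    (hp : ζ 0 ^ (1 - κ) ≤ (1 - κ) * β * θ)
    (hw : ∀ᵐ t, t ∈ Ioo 0 θ → 0 < ζ t → w t ≤ -β * ζ t ^ κ) :
    ∃ τ ∈ Icc 0 θ, ζ τ = 0 ∧ ∀ t ∈ Icc 0 τ, 0 ≤ ζ t := by
  obtain ⟨τ, hτ, h1, h2⟩ := exists_first_hit (ζ := fun t => -ζ t) (p := 0) h.continuousOn.neg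
    (by linarith) (by
      by_contra! hno
      replace hno : ∀ t ∈ Icc 0 θ, 0 < ζ t := fun t ht => by linarith [hno t ht]
      -- If the curve stayed positive it would be bounded below by some c > 0, and the power 1 - κ
      -- is Lipschitz on bounded intervals above c.
      obtain ⟨t₀, ht₀, hmin⟩ := isCompact_Icc.exists_isMinOn ⟨0, le_rfl, hθ⟩ h.continuousOn
      set c := ζ t₀
      have hc : 0 < c := hno t₀ ht₀
      have hκ' : 0 < 1 - κ := by linarith
      have hmaps : MapsTo ζ (Icc 0 θ) (Icc c (ζ 0 + K * θ)) := fun t ht => by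
        refine ⟨hmin ht, ?_⟩
        have := h.1.dist_le_mul t ht 0 ⟨le_rfl, hθ⟩
        rw [Real.dist_eq, Real.dist_eq, sub_zero, abs_of_nonneg ht.1] at this
        have h2 := mul_le_mul_of_nonneg_left ht.2 K.coe_nonneg
        linarith [(abs_le.1 this).2]
      have hpow : ContDiffOn ℝ 1 (fun x : ℝ => x ^ (1 - κ)) (Icc c (ζ 0 + K * θ)) := fun x hx =>
        (Real.contDiffAt_rpow_const_of_ne (hc.trans_le hx.1).ne').contDiffWithinAt
      obtain ⟨K', hK'⟩ := hpow.exists_lipschitzOnWith one_ne_zero (convex_Icc _ _) isCompact_Icc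
      have hac := (hK'.comp h.1 hmaps)
      rw [← uIcc_of_le hθ] at hac
      have hlin : AbsolutelyContinuousOnInterval (fun s : ℝ => (1 - κ) * β * s) 0 θ := by
        apply ContDiffOn.absolutelyContinuousOnInterval
        fun_prop
      -- The function ζ^(1-κ) + (1-κ)βt does not increase, so at time `θ` the power is at most zero
      -- by the choice of `θ`, which is absurd.
      have := le_of_ae_hasDerivAt_nonpos hθ (hac.absolutelyContinuousOnInterval.add hlin) (by
        filter_upwards [h.2, hw] with t h1 h2 hm
        have hpos := hno t (Ioo_subset_Icc_self hm)
        refine ⟨_, ?_, ((h1 hm).rpow_const (Or.inl hpos.ne')).add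
          ((hasDerivAt_id t).const_mul ((1 - κ) * β))⟩
        have e1 := h2 hm hpos
        have e2 : ζ t ^ κ * ζ t ^ (1 - κ - 1) = 1 := by
          rw [← Real.rpow_add hpos]; simp
        have e3 : 0 < ζ t ^ (1 - κ - 1) := Real.rpow_pos_of_pos hpos _
        have e4 := mul_le_mul_of_nonneg_right e1 (mul_pos hκ' e3).le
        have e5 : -β * ζ t ^ κ * ((1 - κ) * ζ t ^ (1 - κ - 1)) = -((1 - κ) * β) := by
          linear_combination (-β * (1 - κ)) * e2
        linarith)
      simp only [Pi.add_apply, Function.comp_apply, mul_zero, add_zero] at this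
      have h3 := Real.rpow_pos_of_pos (hno θ ⟨hθ, le_rfl⟩) (1 - κ)
      linarith)
  exact ⟨τ, hτ, by linarith, fun t ht => by linarith [h2 t ht]⟩

end AEDeriv

end Hitting

namespace TrafficModel

section EdgeContinuity

open Filter Topology

variable {d m N : ℕ} {E : Type*} {M : TrafficModel d m N E}
  {γ : E} {q L : EuclideanSpace ℝ (Fin m) → M.A → ℝ} {B C δ : ℝ} {j : Fin N}

/-! ### Local comparison of values near the end points of an edge -/

lemma zero_mem_network (M : TrafficModel d m N E) (j : Fin N) :
    (0 : EuclideanSpace ℝ (Fin m)) ∈ M.network :=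
  M.seg_subset_network j (by simpa using M.smul_mem_seg j (r := 0) ⟨le_rfl, zero_le_one⟩)

lemma reachConst_nonneg (hq : M.RegularCost γ q C) (hδ0 : 0 < δ) (hL : M.RegularCost γ L B)
    (j : Fin N) (a : M.A) : 0 ≤ B + C * (B / δ) := by
  have hB := hL.nonneg (M.zero_mem_network j) a
  have hC := hq.nonneg (M.zero_mem_network j) a
  positivity

/-- Reaching a point of the edge with a constant control. -/
lemma discValue_le_of_edge_curve (hf : M.FieldRegular) (hstar : M.IsStar)
    (hctrl : M.CtrlStructure) (hq : M.RegularCost γ q C)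
    (hδ : ∀ x a, δ ≤ q x a) (hδ0 : 0 < δ) (hL : M.RegularCost γ L B)
    (hne : ∀ x ∈ M.network, (M.detCtrl γ x).Nonempty) {a : M.A} (ha : a ∈ M.edgeCtrl γ j)
    {ζ : ℝ → ℝ} {K : ℝ≥0} {τ θ p : ℝ}
    (hζ : AEDeriv ζ (fun t => M.speed γ j (clip (ζ t)) a) K 0 θ) (hτ : τ ∈ Icc 0 θ)
    (hp : ζ τ = p) (hmem : ∀ t ∈ Icc 0 τ, ζ t ∈ Icc (0 : ℝ) 1) :
    M.discValue γ q L (ζ 0 • M.e j) ≤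
      M.discValue γ q L (p • M.e j) + θ * (B + C * (B / δ)) := by
  have htr := fun t (ht : t ∈ Icc 0 τ) => traj_eq_smul (α := fun _ => a) hf hstar hctrl
    measurable_const (hζ.mono le_rfl hτ.2) hmem (Eventually.of_forall fun _ _ => ha) ht
  have h := discValue_le_of_reach hf hq hδ hδ0 hL hne (α := fun _ => a) measurable_const hτ.1
    (fun t ht => by
      rw [htr t ht]
      exact M.seg_subset_network j (M.smul_mem_seg j (hmem t ht)))
  rw [htr τ ⟨hτ.1, le_rfl⟩, hp] at h
  refine h.trans (add_le_add le_rfl ?_)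
  exact mul_le_mul_of_nonneg_right hτ.2 (reachConst_nonneg hq hδ0 hL j a)

/-- In both the active and the inactive case, some control of the edge leads to `O`. -/
lemma exists_ctrl_toward_zero (hf : M.FieldRegular) (hstar : M.IsStar)
    (hact : M.ActiveCtrl) (hinact : M.InactiveCtrl) (γ : E) (j : Fin N) :
    ∃ a ∈ M.edgeCtrl γ j, ∃ β η κ : ℝ, 0 < β ∧ 0 < η ∧ η ≤ 1 ∧ 0 ≤ κ ∧ κ < 1 ∧
      ∀ r : ℝ, 0 < r → r < η → M.speed γ j r a ≤ -β * r ^ κ := by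
  have he : 0 < ‖M.e j‖ := norm_pos_iff.2 (hstar.1 j)
  by_cases h : γ ∈ M.active j
  · obtain ⟨β, hβ, -, -, a, ha, -, h2⟩ := hact j γ h
    set b := β / ‖M.e j‖ ^ 2 with hb
    have hb0 : 0 < b := by positivity
    obtain ⟨ρ, hρ, hmod⟩ := speed_clip_modulus hf hstar γ j (half_pos hb0)
    -- In the active case the speed is bounded away from zero near `O`, half of its bound at `O`;
    -- this is the estimate with exponent 0.
    refine ⟨a, ha, b / 2, min ρ 1, 0, half_pos hb0, lt_min hρ one_pos, min_le_right _ _, le_rfl,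
      one_pos, fun r hr hrη => ?_⟩
    have hr1 : r ≤ 1 := hrη.le.trans (min_le_right _ _)
    have h3 := hmod r 0 a (by
      rw [sub_zero, abs_of_pos hr]; exact hrη.le.trans (min_le_left _ _))
    rw [clip_of_mem ⟨hr.le, hr1⟩, clip_of_nonpos le_rfl] at h3
    have h4 : M.speed γ j 0 a < -b := by
      rw [speed_zero_eq, hb, ← neg_div]
      exact div_lt_div_of_pos_right h2 (by positivity)
    rw [Real.rpow_zero]
    linarith [(abs_le.1 h3).2]
  · obtain ⟨β, η, κ, hβ, hη, hη1, hκ, hκ1, ⟨a, ha, h2⟩, -⟩ := hinact j γ h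
    -- The hypothesis is stated with inner products, and the inner product of r e_j with e_j is
    -- r‖e_j‖². Passing to the coordinate produces these factors.
    refine ⟨a, ha, β * (‖M.e j‖ ^ 2) ^ κ / ‖M.e j‖ ^ 2, min (η / ‖M.e j‖) 1, κ, by positivity,
      lt_min (by positivity) one_pos, min_le_right _ _, hκ, hκ1, fun r hr hrη => ?_⟩
    have hr1 : r < 1 := hrη.trans_le (min_le_right _ _)
    have hre : r < η / ‖M.e j‖ := hrη.trans_le (min_le_left _ _)
    have h3 := h2 (r • M.e j) ⟨r, ⟨hr, hr1⟩, rfl⟩ (by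
      rw [norm_smul, Real.norm_eq_abs, abs_of_pos hr]
      exact ((lt_div_iff₀ he).1 hre).le)
    rw [inner_smul_left, real_inner_self_eq_norm_sq] at h3
    simp only [conj_trivial] at h3
    rw [Real.mul_rpow hr.le (by positivity)] at h3
    rw [speed, div_le_iff₀ (by positivity)]
    refine h3.trans (le_of_eq ?_)
    field_simp

/-- From r e_j the origin is reached in the time r^(1-κ)/((1-κ)β), which tends to 0 with r because κ
< 1. -/
lemma discValue_le_value_zero (hf : M.FieldRegular) (hstar : M.IsStar)
    (hctrl : M.CtrlStructure) (hact : M.ActiveCtrl) (hinact : M.InactiveCtrl)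
    (hq : M.RegularCost γ q C)
    (hδ : ∀ x a, δ ≤ q x a) (hδ0 : 0 < δ) (hL : M.RegularCost γ L B)
    (hne : ∀ x ∈ M.network, (M.detCtrl γ x).Nonempty) (j : Fin N) {ε : ℝ} (hε : 0 < ε) :
    ∃ ρ > 0, ∀ r : ℝ, 0 ≤ r → r ≤ ρ →
      M.discValue γ q L (r • M.e j) ≤ M.discValue γ q L 0 + ε := by
  obtain ⟨a, ha, β, η, κ, hβ, hη, hη1, hκ, hκ1, hsp⟩ :=
    exists_ctrl_toward_zero hf hstar hact hinact γ j
  have hκ' : 0 < 1 - κ := by linarith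
  have hK := reachConst_nonneg hq hδ0 hL j a
  set k := B + C * (B / δ)
  have hlim : Tendsto (fun r : ℝ => r ^ (1 - κ) / ((1 - κ) * β) * k) (𝓝 0) (𝓝 0) := by
    have : Tendsto (fun r : ℝ => r ^ (1 - κ)) (𝓝 0) (𝓝 0) := by
      have := (Real.continuous_rpow_const hκ'.le).tendsto 0
      rwa [Real.zero_rpow hκ'.ne'] at this
    simpa using (this.div_const ((1 - κ) * β)).mul_const k
  obtain ⟨ρ, hρ, hball⟩ := Metric.eventually_nhds_iff.1 (hlim.eventually (ge_mem_nhds hε))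
  refine ⟨min (ρ / 2) (η / 2), by positivity, fun r hr0 hr => ?_⟩
  have hrη : r < η := hr.trans_lt ((min_le_right _ _).trans_lt (half_lt_self hη))
  have hθε := hball (y := r) (by
    rw [Real.dist_eq, sub_zero, abs_of_nonneg hr0]
    exact hr.trans_lt ((min_le_left _ _).trans_lt (half_lt_self hρ)))
  set θ := r ^ (1 - κ) / ((1 - κ) * β) with hθdef
  have hθ : 0 ≤ θ := by positivity
  obtain ⟨ζ, rfl, hζ⟩ := exists_edge_curve hf hstar γ j (α := fun _ => a) measurable_const r
  have hζ := hζ θ hθ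
  have hneg : ∀ s : ℝ, 0 < s → s < η → M.speed γ j (clip s) a ≤ -β * s ^ κ := fun s h1 h2 => by
    rw [clip_of_mem ⟨h1.le, h2.le.trans hη1⟩]
    exact hsp s h1 h2
  -- The speed is negative only between 0 and η, which suffices to keep the curve below its starting
  -- point, and thus inside that range.
  have hle : ∀ t ∈ Icc 0 θ, ζ t ≤ ζ 0 := fun t ht =>
    hζ.le_of_nonpos_slightly_above le_rfl hrη (Eventually.of_forall fun s _ h1 h2 =>
      (hneg _ (hr0.trans_lt h1) h2).trans (by
        have := Real.rpow_nonneg (hr0.trans h1.le) κ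
        nlinarith)) ht
  obtain ⟨τ, hτ, hτ0, hnn⟩ := hζ.exists_hit_zero hθ hr0 hκ1
    (by rw [hθdef]; field_simp; rfl) (Eventually.of_forall fun s hs h1 =>
      hneg _ h1 ((hle s (Ioo_subset_Icc_self hs)).trans_lt hrη))
  have := discValue_le_of_edge_curve hf hstar hctrl hq hδ hδ0 hL hne ha hζ hτ hτ0
    (fun t ht => ⟨hnn t ht, (hle t ⟨ht.1, ht.2.trans hτ.2⟩).trans (hrη.le.trans hη1)⟩)
  rw [zero_smul] at this
  linarith

/-- An outward control has speed at least b/2 near `O`, so r e_j is reached from `O` in the time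
2r/b. The bound on r makes this time cost at most ε. -/
lemma value_zero_le_of_active (hf : M.FieldRegular) (hstar : M.IsStar)
    (hctrl : M.CtrlStructure) (hact : M.ActiveCtrl)
    (hq : M.RegularCost γ q C)
    (hδ : ∀ x a, δ ≤ q x a) (hδ0 : 0 < δ) (hL : M.RegularCost γ L B)
    (hne : ∀ x ∈ M.network, (M.detCtrl γ x).Nonempty) (hj : γ ∈ M.active j) {ε : ℝ}
    (hε : 0 < ε) : ∃ ρ > 0, ∀ r : ℝ, 0 ≤ r → r ≤ ρ →
      M.discValue γ q L 0 ≤ M.discValue γ q L (r • M.e j) + ε := by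
  have he : 0 < ‖M.e j‖ := norm_pos_iff.2 (hstar.1 j)
  obtain ⟨β, hβ, a, ha, -, -, h2, -⟩ := hact j γ hj
  set b := β / ‖M.e j‖ ^ 2 with hb
  have hb0 : 0 < b := by positivity
  obtain ⟨ρ, hρ, hmod⟩ := speed_clip_modulus hf hstar γ j (half_pos hb0)
  have h4 : b < M.speed γ j 0 a := by
    rw [speed_zero_eq, hb]
    exact div_lt_div_of_pos_right h2 (by positivity)
  have hK := reachConst_nonneg hq hδ0 hL j a
  set k := B + C * (B / δ)
  refine ⟨min (min ρ 1) (ε * (b / 2) / (k + 1)), by positivity, fun r hr0 hr => ?_⟩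
  have hr1 : r ≤ 1 := hr.trans ((min_le_left _ _).trans (min_le_right _ _))
  have hrρ : r ≤ ρ := hr.trans ((min_le_left _ _).trans (min_le_left _ _))
  have hrε : r ≤ ε * (b / 2) / (k + 1) := hr.trans (min_le_right _ _)
  set θ := r / (b / 2) with hθdef
  have hθ : 0 ≤ θ := by positivity
  obtain ⟨ζ, hζ0, hζ⟩ := exists_edge_curve hf hstar γ j (α := fun _ => a) measurable_const 0
  have hζ := hζ θ hθ
  have hpos : ∀ s : ℝ, s < r → b / 2 ≤ M.speed γ j (clip s) a := fun s hs => by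
    rcases le_total s 0 with h | h
    · rw [clip_of_nonpos h]; linarith
    · have h3 := hmod s 0 a (by rw [sub_zero, abs_of_nonneg h]; linarith)
      rw [clip_of_nonpos (le_refl (0 : ℝ))] at h3
      linarith [(abs_le.1 h3).1]
  have hge : ∀ t ∈ Icc 0 θ, 0 ≤ ζ t := fun t ht =>
    hζ.ge_of_nonneg_below hζ0.ge (Eventually.of_forall fun s _ h1 => by
      simp only [clip_of_nonpos h1.le]; linarith) ht
  obtain ⟨τ, hτ, hτr, hle⟩ := hζ.exists_hit_of_le (p := r) (β := b / 2) hθ (by rw [hζ0]; exact hr0)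
    (by rw [hζ0, hθdef]; field_simp; linarith)
    (Eventually.of_forall fun s _ h1 => hpos _ h1)
  have := discValue_le_of_edge_curve hf hstar hctrl hq hδ hδ0 hL hne ha hζ hτ hτr
    (fun t ht => ⟨hge t ⟨ht.1, ht.2.trans hτ.2⟩, (hle t ht).trans hr1⟩)
  rw [hζ0, zero_smul] at this
  refine this.trans (add_le_add le_rfl ?_)
  rw [le_div_iff₀ (by positivity)] at hrε
  rw [hθdef, div_mul_eq_mul_div, div_le_iff₀ (by positivity)]
  linarith

/-- The mirror image of the active case at `O`: if not all controls of the edge are admissible at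
the vertex, one of them points strictly inwards. -/
lemma value_end_le (hf : M.FieldRegular) (hstar : M.IsStar)
    (hctrl : M.CtrlStructure) (hq : M.RegularCost γ q C)
    (hδ : ∀ x a, δ ≤ q x a) (hδ0 : 0 < δ) (hL : M.RegularCost γ L B)
    (hne : ∀ x ∈ M.network, (M.detCtrl γ x).Nonempty)
    (hj : M.localCtrl γ (M.e j) ≠ M.edgeCtrl γ j) {ε : ℝ}
    (hε : 0 < ε) : ∃ ρ > 0, ∀ r : ℝ, r ≤ 1 → 1 - ρ ≤ r →
      M.discValue γ q L (M.e j) ≤ M.discValue γ q L (r • M.e j) + ε := by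
  have he : 0 < ‖M.e j‖ := norm_pos_iff.2 (hstar.1 j)
  obtain ⟨β, hβ, a, ha, h2⟩ := (hctrl.2.2.2.2.2 γ j).resolve_left hj
  set b := β / ‖M.e j‖ ^ 2 with hb
  have hb0 : 0 < b := by positivity
  obtain ⟨ρ, hρ, hmod⟩ := speed_clip_modulus hf hstar γ j (half_pos hb0)
  have h4 : M.speed γ j 1 a < -b := by
    rw [speed_one_eq, hb, ← neg_div]
    exact div_lt_div_of_pos_right h2 (by positivity)
  have hK := reachConst_nonneg hq hδ0 hL j a
  set k := B + C * (B / δ)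
  refine ⟨min (min ρ 1) (ε * (b / 2) / (k + 1)), by positivity, fun r hr1 hr => ?_⟩
  have hr0 : 0 ≤ r := by linarith [(min_le_left (min ρ 1) (ε * (b / 2) / (k + 1))).trans (min_le_right _ _)]
  have hrρ : 1 - r ≤ ρ := by
    linarith [(min_le_left (min ρ 1) (ε * (b / 2) / (k + 1))).trans (min_le_left _ _)]
  have hrε : 1 - r ≤ ε * (b / 2) / (k + 1) := by
    linarith [min_le_right (min ρ 1) (ε * (b / 2) / (k + 1))]
  set θ := (1 - r) / (b / 2) with hθdef
  have hθ : 0 ≤ θ := div_nonneg (by linarith) (by positivity)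
  obtain ⟨ζ, hζ0, hζ⟩ := exists_edge_curve hf hstar γ j (α := fun _ => a) measurable_const 1
  have hζ := hζ θ hθ
  have hneg : ∀ s : ℝ, r < s → M.speed γ j (clip s) a ≤ -(b / 2) := fun s hs => by
    rcases le_total 1 s with h | h
    · rw [clip_of_one_le h]; linarith
    · have h3 := hmod s 1 a (by rw [abs_sub_comm, abs_of_nonneg (sub_nonneg.2 h)]; linarith)
      rw [clip_of_one_le (le_refl (1 : ℝ))] at h3
      linarith [(abs_le.1 h3).2]
  have hle : ∀ t ∈ Icc 0 θ, ζ t ≤ 1 := fun t ht =>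
    hζ.le_of_nonpos_above hζ0.le (Eventually.of_forall fun s _ h1 => by
      simp only [clip_of_one_le h1.le]; linarith) ht
  obtain ⟨τ, hτ, hτr, hge⟩ := hζ.exists_hit_of_ge (p := r) (β := b / 2) hθ (by rw [hζ0]; exact hr1)
    (by rw [hζ0, hθdef]; field_simp; linarith)
    (Eventually.of_forall fun s _ h1 => hneg _ h1)
  have := discValue_le_of_edge_curve hf hstar hctrl hq hδ hδ0 hL hne ha hζ hτ hτr
    (fun t ht => ⟨hr0.trans (hge t ht), hle t ⟨ht.1, ht.2.trans hτ.2⟩⟩)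
  rw [hζ0, one_smul] at this
  refine this.trans (add_le_add le_rfl ?_)
  rw [le_div_iff₀ (by positivity)] at hrε
  rw [hθdef, div_mul_eq_mul_div, div_le_iff₀ (by positivity)]
  linarith

lemma exists_horizon (hδ0 : 0 < δ) (k : ℝ) {ε : ℝ} (hε : 0 < ε) :
    ∃ T : ℝ, 0 ≤ T ∧ Real.exp (-(δ * T)) * k ≤ ε := by
  have h1 : Tendsto (fun T : ℝ => Real.exp (-(δ * T)) * k) atTop (𝓝 0) := by
    have : Tendsto (fun T : ℝ => Real.exp (-(δ * T))) atTop (𝓝 0) :=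
      Real.tendsto_exp_neg_atTop_nhds_zero.comp (tendsto_id.const_mul_atTop hδ0)
    simpa using this.mul_const k
  obtain ⟨T, hT, h⟩ := ((eventually_ge_atTop (0 : ℝ)).and (h1.eventually (ge_mem_nhds hε))).exists
  exact ⟨T, hT, h⟩

lemma exp_mul_value_sub_le (hf : M.FieldRegular) (hq : M.RegularCost γ q C)
    (hδ : ∀ x a, δ ≤ q x a) (hδ0 : 0 < δ) (hL : M.RegularCost γ L B)
    (hne : ∀ x ∈ M.network, (M.detCtrl γ x).Nonempty) {x z : EuclideanSpace ℝ (Fin m)}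
    (hx : x ∈ M.network) (hz : z ∈ M.network) (T : ℝ) :
    Real.exp (-(δ * T)) * (M.discValue γ q L z - M.discValue γ q L x) ≤
      Real.exp (-(δ * T)) * (2 * (B / δ)) := by
  refine mul_le_mul_of_nonneg_left ?_ (Real.exp_pos _).le
  linarith [(abs_le.1 (abs_discValue_le hf hq hδ hδ0 hL hne hz)).2,
    (abs_le.1 (abs_discValue_le hf hq hδ hδ0 hL hne hx)).1]

lemma exp_mul_le_of_le (hδ0 : 0 < δ) {τ c ε : ℝ} (hτ : 0 ≤ τ) (hε : 0 ≤ ε) (h : c ≤ ε) :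
    Real.exp (-(δ * τ)) * c ≤ ε := by
  have h1 : Real.exp (-(δ * τ)) ≤ 1 :=
    Real.exp_le_one_iff.2 (neg_nonpos.2 (mul_nonneg hδ0.le hτ))
  calc _ ≤ Real.exp (-(δ * τ)) * ε := mul_le_mul_of_nonneg_left h (Real.exp_pos _).le
    _ ≤ 1 * ε := mul_le_mul_of_nonneg_right h1 hε
    _ = ε := one_mul ε

/-- A common modulus for the discount rate and the running cost. -/
lemma exists_common_modulus (hq : M.RegularCost γ q C) (hL : M.RegularCost γ L B) {ε k : ℝ}
    (hε : 0 < ε) (hk : 0 ≤ k) : ∃ η : ℝ, 0 ≤ η ∧ η * k ≤ ε ∧ ∃ ρ > 0, ∀ x ∈ M.network,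
      ∀ z ∈ M.network, ‖x - z‖ ≤ ρ → ∀ a, |q x a - q z a| ≤ η ∧ |L x a - L z a| ≤ η := by
  have hη : 0 < ε / (k + 1) := by positivity
  obtain ⟨ρ₁, h1, h1'⟩ := hq.modulus _ hη
  obtain ⟨ρ₂, h2, h2'⟩ := hL.modulus _ hη
  refine ⟨ε / (k + 1), hη.le, ?_, min ρ₁ ρ₂, lt_min h1 h2, fun x hx z hz h a =>
    ⟨h1' x hx z hz (h.trans (min_le_left _ _)) a, h2' x hx z hz (h.trans (min_le_right _ _)) a⟩⟩
  rw [div_mul_eq_mul_div, div_le_iff₀ (by positivity)]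
  nlinarith

/-- The point r e_j may be unreachable from `O`, so the competitor at `O` is the control that stays
there. No control moves the other trajectory away from `O`, so it remains in [0,r] e_j until it hits
`O`. Meanwhile the data at `O` for the resting control equal those for the control in use, by
compatibility, and continuity in the position finishes the comparison. -/
lemma value_zero_le_of_inactive (hf : M.FieldRegular) (hstar : M.IsStar)
    (hinact : M.InactiveCtrl) (hedge : M.CtrlOnEdges)
    (hq : M.RegularCost γ q C)
    (hδ : ∀ x a, δ ≤ q x a) (hδ0 : 0 < δ) (hL : M.RegularCost γ L B)
    (hne : ∀ x ∈ M.network, (M.detCtrl γ x).Nonempty) (hj : γ ∉ M.active j) {ε : ℝ}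
    (hε : 0 < ε) : ∃ ρ > 0, ∀ r : ℝ, 0 ≤ r → r ≤ ρ →
      M.discValue γ q L 0 ≤ M.discValue γ q L (r • M.e j) + ε := by
  have he : 0 < ‖M.e j‖ := norm_pos_iff.2 (hstar.1 j)
  obtain ⟨-, η₀, -, -, hη₀, -, -, -, -, ⟨a, ha, ha0⟩, hin⟩ := hinact j γ hj
  have hB := hL.nonneg (M.zero_mem_network j) a
  obtain ⟨T, hT, hTε⟩ := exists_horizon hδ0 (2 * (B / δ)) (half_pos hε)
  obtain ⟨η, hη, hηε, ρ, hρ, hmod⟩ := exists_common_modulus hq hL (half_pos hε)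
    (show 0 ≤ T * (1 + T * B) + T * (B / δ) by positivity)
  refine ⟨min (ρ / ‖M.e j‖) (min (η₀ / ‖M.e j‖) 1 / 2), by positivity, fun r hr0 hr => ?_⟩
  have hrρ : r * ‖M.e j‖ ≤ ρ := by
    rw [← le_div_iff₀ he]; exact hr.trans (min_le_left _ _)
  set b := min (η₀ / ‖M.e j‖) 1 with hb
  have hb0 : 0 < b := by positivity
  have hrb : r < b := hr.trans_lt ((min_le_right _ _).trans_lt (half_lt_self hb0))
  have hb1 : b ≤ 1 := min_le_right _ _
  have hx : r • M.e j ∈ M.seg j := M.smul_mem_seg j ⟨hr0, hrb.le.trans hb1⟩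
  have hz : (fun _ => a) ∈ M.detCtrl γ 0 := by
    refine ⟨measurable_const, fun t ht => ?_⟩
    rw [traj_eq_of_aeDeriv hf (y := fun _ => 0) (K := 0) measurable_const
      ⟨fun s _ t _ => by simp, Eventually.of_forall fun s _ => by
        simpa [ha0] using hasDerivAt_const s (0 : EuclideanSpace ℝ (Fin m))⟩ rfl ⟨ht, le_rfl⟩]
    exact M.zero_mem_network j
  have hz0 : ∀ t, 0 ≤ t → M.traj γ 0 (fun _ => a) t = 0 := fun t ht =>
    traj_eq_of_aeDeriv hf (y := fun _ => 0) (K := 0) measurable_const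
      ⟨fun s _ t _ => by simp, Eventually.of_forall fun s _ => by
        simpa [ha0] using hasDerivAt_const s (0 : EuclideanSpace ℝ (Fin m))⟩ rfl ⟨ht, le_rfl⟩
  have := (hne _ (M.seg_subset_network j hx)).to_subtype
  rw [← sub_le_iff_le_add]
  refine le_ciInf fun α => ?_
  rw [sub_le_iff_le_add]
  obtain ⟨α, hα⟩ := α
  set y := M.traj γ (r • M.e j) α with hy
  have hyc : ContinuousOn y (Ici 0) := traj_continuousOn hf γ _ hα.1
  have hycT : ContinuousOn y (Icc 0 T) := hyc.mono Icc_subset_Ici_self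
  -- The first time at which the trajectory hits `O`, or the horizon `T` if that comes earlier.
  obtain ⟨τ, hτ, hfirst⟩ := exists_first_mem (S := {T} ∪ Icc 0 T ∩ y ⁻¹' {0})
    (isClosed_singleton.union
      (hycT.preimage_isClosed_of_isClosed isClosed_Icc isClosed_singleton))
    ⟨T, Or.inl rfl⟩ (by rintro t (rfl | ht); exacts [hT, ht.1.1])
  have hτT : τ ∈ Icc 0 T := by
    rcases hτ with h | h
    · rw [mem_singleton_iff.1 h]; exact ⟨hT, le_rfl⟩
    · exact h.1
  have hyne : ∀ t ∈ Ico 0 τ, y t ≠ 0 := fun t ht h0 =>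
    hfirst t ht.2 (Or.inr ⟨⟨ht.1, ht.2.le.trans hτT.2⟩, h0⟩)
  have hyseg : ∀ t ∈ Icc 0 τ, y t ∈ M.seg j := fun t ht =>
    mem_seg_of_ne_zero hstar hτT.1 (hycT.mono (Icc_subset_Icc_right hτT.2))
      (fun s hs => hα.2 s hs.1) hyne (by rw [hy, traj_zero hf γ _ hα.1]; exact hx) ht
  have hctl : ∀ᵐ t, t ∈ Ioo 0 τ → α t ∈ M.edgeCtrl γ j := by
    filter_upwards [hedge γ _ α hα j] with t ht hm
    exact ht hm.1 (hyseg t (Ioo_subset_Icc_self hm)) (hyne t ⟨hm.1.le, hm.2⟩)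
  let φ : EuclideanSpace ℝ (Fin m) →L[ℝ] ℝ := (‖M.e j‖ ^ 2)⁻¹ • innerSL ℝ (M.e j)
  have hφ : ∀ s : ℝ, φ (s • M.e j) = s := fun s => by
    simp only [φ, smul_apply, innerSL_apply_apply, inner_smul_right,
      real_inner_self_eq_norm_sq, smul_eq_mul]
    field_simp
  have hcoord : ∀ t ∈ Icc 0 τ, y t = φ (y t) • M.e j ∧ φ (y t) ∈ Icc (0 : ℝ) 1 := fun t ht => by
    obtain ⟨s, hs, hst⟩ := hyseg t ht
    simp only at hst
    rw [← hst, hφ]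
    exact ⟨rfl, hs⟩
  -- The inward condition is known only within distance `η₀` of `O`, so a bound on the speed
  -- slightly above the level r has to suffice.
  have hle : ∀ t ∈ Icc 0 τ, φ (y t) ≤ r := fun t ht => by
    have hD := (traj_aeDeriv hf γ (r • M.e j) hα.1 hτT.1).clm_comp φ
    refine hD.le_of_nonpos_slightly_above ?_ hrb ?_ ht
    · rw [traj_zero hf γ _ hα.1, hφ]
    · filter_upwards [hctl] with s hs hm h1 h2
      obtain ⟨e1, e2⟩ := hcoord s (Ioo_subset_Icc_self hm)
      have hmem : y s ∈ M.edge j := ⟨φ (y s), ⟨hr0.trans_lt h1, h2.trans_le hb1⟩, e1.symm⟩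
      have hnorm : ‖y s‖ ≤ η₀ := by
        rw [e1, norm_smul, Real.norm_eq_abs, abs_of_nonneg e2.1, ← le_div_iff₀ he]
        exact h2.le.trans (min_le_left _ _)
      have h3 := hin (α s) (hs hm) (y s) hmem hnorm
      simp only [φ, smul_apply, innerSL_apply_apply, smul_eq_mul]
      rw [real_inner_comm]
      exact mul_nonpos_of_nonneg_of_nonpos (by positivity) h3
  have hnear : ∀ t ∈ Icc 0 τ, ‖(0 : EuclideanSpace ℝ (Fin m)) - y t‖ ≤ ρ := fun t ht => by
    obtain ⟨e1, e2⟩ := hcoord t ht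
    rw [zero_sub, norm_neg, e1, norm_smul, Real.norm_eq_abs, abs_of_nonneg e2.1]
    exact (mul_le_mul_of_nonneg_right (hle t ht) he.le).trans hrρ
  have hcmp : ∀ᵐ t, t ∈ Ioo 0 τ →
      |q (M.traj γ 0 (fun _ => a) t) a - q (y t) (α t)| ≤ η ∧
      |L (M.traj γ 0 (fun _ => a) t) a - L (y t) (α t)| ≤ η := by
    filter_upwards [hctl] with t ht hm
    have hm' := Ioo_subset_Icc_self hm
    rw [hz0 t hm.1.le, hq.compatible j hj a ha _ (ht hm), hL.compatible j hj a ha _ (ht hm)]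
    exact hmod 0 (M.zero_mem_network j) _ (M.seg_subset_network j (hyseg t hm')) (hnear t hm') _
  have hfinal := discValue_le_discCost_add hf hq hδ hδ0 hL hne hα hz (ε := ε / 2) hτT.1 hτT.2 hη
    (half_pos hε).le (hcmp.mono fun t ht hm => (ht hm).1) (hcmp.mono fun t ht hm => (ht hm).2)
    (by
      rcases hτ with h | h
      · rw [mem_singleton_iff.1 h]
        exact (exp_mul_value_sub_le hf hq hδ hδ0 hL hne (hα.2 T hT) (hz.2 T hT) T).trans hTε
      · rw [show M.traj γ (r • M.e j) α τ = 0 from h.2, hz0 τ hτT.1, sub_self, mul_zero]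
        exact (half_pos hε).le)
  refine hfinal.trans (add_le_add le_rfl ?_)
  linarith

/-- Comparison of the values at two close points of an edge, one of which is an end point. -/
lemma exists_endpoint_modulus (hf : M.FieldRegular) (hstar : M.IsStar)
    (hctrl : M.CtrlStructure) (hact : M.ActiveCtrl) (hinact : M.InactiveCtrl)
    (hedge : M.CtrlOnEdges) (hq : M.RegularCost γ q C)
    (hδ : ∀ x a, δ ≤ q x a) (hδ0 : 0 < δ) (hL : M.RegularCost γ L B)
    (hne : ∀ x ∈ M.network, (M.detCtrl γ x).Nonempty) (j : Fin N) {ε : ℝ} (hε : 0 < ε) :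
    ∃ ρ > 0, ∀ s ∈ Icc (0 : ℝ) 1, ∀ r ∈ Icc (0 : ℝ) 1, |s - r| ≤ ρ →
      (r = 0 ∨ s = 0 ∨ M.localCtrl γ (M.e j) ≠ M.edgeCtrl γ j ∧ s = 1) →
      M.discValue γ q L (s • M.e j) - M.discValue γ q L (r • M.e j) ≤ ε := by
  obtain ⟨ρ₁, hρ₁, hdown⟩ :=
    discValue_le_value_zero hf hstar hctrl hact hinact hq hδ hδ0 hL hne j hε
  obtain ⟨ρ₂, hρ₂, hup⟩ : ∃ ρ > 0, ∀ r : ℝ, 0 ≤ r → r ≤ ρ →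
      M.discValue γ q L 0 ≤ M.discValue γ q L (r • M.e j) + ε := by
    by_cases hj : γ ∈ M.active j
    · exact value_zero_le_of_active hf hstar hctrl hact hq hδ hδ0 hL hne hj hε
    · exact value_zero_le_of_inactive hf hstar hinact hedge hq hδ hδ0 hL hne hj hε
  obtain ⟨ρ₃, hρ₃, hend⟩ : ∃ ρ > 0, M.localCtrl γ (M.e j) ≠ M.edgeCtrl γ j → ∀ r : ℝ, r ≤ 1 →
      1 - ρ ≤ r → M.discValue γ q L (M.e j) ≤ M.discValue γ q L (r • M.e j) + ε := by
    by_cases hj : M.localCtrl γ (M.e j) = M.edgeCtrl γ j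
    · exact ⟨1, one_pos, fun h => absurd hj h⟩
    · obtain ⟨ρ, hρ, h⟩ := value_end_le hf hstar hctrl hq hδ hδ0 hL hne hj hε
      exact ⟨ρ, hρ, fun _ => h⟩
  refine ⟨min ρ₁ (min ρ₂ ρ₃), lt_min hρ₁ (lt_min hρ₂ hρ₃), fun s hs r hr hsr h => ?_⟩
  have h1 := hsr.trans (min_le_left _ _)
  have h2 := hsr.trans ((min_le_right _ _).trans (min_le_left _ _))
  have h3 := hsr.trans ((min_le_right _ _).trans (min_le_right _ _))
  rw [sub_le_iff_le_add, add_comm]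
  rcases h with rfl | rfl | ⟨hj, rfl⟩
  · rw [zero_smul]
    exact hdown s hs.1 (by rwa [sub_zero, abs_of_nonneg hs.1] at h1)
  · rw [zero_smul]
    exact hup r hr.1 (by rwa [zero_sub, abs_neg, abs_of_nonneg hr.1] at h2)
  · rw [one_smul]
    exact hend hj r hr.2 (by linarith [(le_abs_self _).trans h3])

/-- The value function is uniformly continuous on each edge. -/
theorem discValue_edge_le (hf : M.FieldRegular) (hstar : M.IsStar)
    (hctrl : M.CtrlStructure) (hact : M.ActiveCtrl) (hinact : M.InactiveCtrl)
    (hedge : M.CtrlOnEdges) (hq : M.RegularCost γ q C)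
    (hδ : ∀ x a, δ ≤ q x a) (hδ0 : 0 < δ) (hL : M.RegularCost γ L B)
    (hne : ∀ x ∈ M.network, (M.detCtrl γ x).Nonempty) (j : Fin N) {ε : ℝ} (hε : 0 < ε) :
    ∃ ρ > 0, ∀ r ∈ Icc (0 : ℝ) 1, ∀ s ∈ Icc (0 : ℝ) 1, |s - r| ≤ ρ →
      M.discValue γ q L (s • M.e j) ≤ M.discValue γ q L (r • M.e j) + ε := by
  have he : 0 < ‖M.e j‖ := norm_pos_iff.2 (hstar.1 j)
  have hε2 := half_pos hε
  obtain ⟨a, -⟩ := hctrl.1 γ j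
  have hB := hL.nonneg (M.zero_mem_network j) a
  obtain ⟨T, hT, hTε⟩ := exists_horizon hδ0 (2 * (B / δ)) hε2
  obtain ⟨η, hη, hηε, ρ₀, hρ₀, hmod⟩ := exists_common_modulus hq hL hε2
    (show 0 ≤ T * (1 + T * B) + T * (B / δ) by positivity)
  obtain ⟨ρ₁, hρ₁, hendpt⟩ :=
    exists_endpoint_modulus hf hstar hctrl hact hinact hedge hq hδ hδ0 hL hne j hε2
  set ρ := min (ρ₀ / ‖M.e j‖) ρ₁
  have hρ : 0 < ρ := lt_min (by positivity) hρ₁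
  have hρ0 : ρ * ‖M.e j‖ ≤ ρ₀ := by
    rw [← le_div_iff₀ he]; exact min_le_left _ _
  have hρ1 : ρ ≤ ρ₁ := min_le_right _ _
  -- The distance of two trajectories with the same control grows at most by the factor exp(CT) up
  -- to the horizon.
  refine ⟨Real.exp (-(hf.const * T)) * ρ, by positivity, fun r hr s hs hrs => ?_⟩
  have hx : r • M.e j ∈ M.seg j := M.smul_mem_seg j hr
  have := (hne _ (M.seg_subset_network j hx)).to_subtype
  rw [← sub_le_iff_le_add]
  refine le_ciInf fun α => ?_
  rw [sub_le_iff_le_add]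
  obtain ⟨α, hα⟩ := α
  obtain ⟨y, hy⟩ : ∃ y, y = M.traj γ (r • M.e j) α := ⟨_, rfl⟩
  have hynet : ∀ t, 0 ≤ t → y t ∈ M.network := by rw [hy]; exact hα.2
  have hy0 : y 0 = r • M.e j := by rw [hy, traj_zero hf γ _ hα.1]
  have hycT : ContinuousOn y (Icc 0 T) := by
    rw [hy]; exact (traj_continuousOn hf γ _ hα.1).mono Icc_subset_Ici_self
  obtain ⟨ζ, hζ0, hζ⟩ := exists_edge_curve hf hstar γ j hα.1 s
  have hζT := hζ T hT
  -- The copied control ceases to be usable when the original trajectory reaches `O`, after which it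
  -- may enter another edge, when the copy reaches `O`, or when the copy reaches the vertex while
  -- some control of the edge is inadmissible there. The horizon `T` is included to make the set
  -- nonempty.
  obtain ⟨τ, hτ, hfirst⟩ := exists_first_mem
    (S := ({T} ∪ Icc 0 T ∩ y ⁻¹' {0}) ∪ ((Icc 0 T ∩ ζ ⁻¹' Iic 0) ∪
      (Icc 0 T ∩ ζ ⁻¹' {b | M.localCtrl γ (M.e j) ≠ M.edgeCtrl γ j ∧ 1 ≤ b})))
    ((isClosed_singleton.union
      (hycT.preimage_isClosed_of_isClosed isClosed_Icc isClosed_singleton)).union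
      ((hζT.continuousOn.preimage_isClosed_of_isClosed isClosed_Icc isClosed_Iic).union
      (hζT.continuousOn.preimage_isClosed_of_isClosed isClosed_Icc
        (isClosed_const.and isClosed_Ici))))
    ⟨T, Or.inl (Or.inl rfl)⟩
    (by rintro t ((rfl | ht) | (ht | ht)); exacts [hT, ht.1.1, ht.1.1, ht.1.1])
  have hτT : τ ∈ Icc 0 T := by
    rcases hτ with (h | h) | (h | h)
    · rw [mem_singleton_iff.1 h]; exact ⟨hT, le_rfl⟩
    · exact h.1
    · exact h.1
    · exact h.1
  have hyne : ∀ t ∈ Ico 0 τ, y t ≠ 0 := fun t ht h0 =>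
    hfirst t ht.2 (Or.inl (Or.inr ⟨⟨ht.1, ht.2.le.trans hτT.2⟩, h0⟩))
  have hζpos : ∀ t ∈ Ico 0 τ, 0 < ζ t := fun t ht => by
    by_contra! h0
    exact hfirst t ht.2 (Or.inr (Or.inl ⟨⟨ht.1, ht.2.le.trans hτT.2⟩, h0⟩))
  have hyseg : ∀ t ∈ Icc 0 τ, y t ∈ M.seg j := fun t ht =>
    mem_seg_of_ne_zero hstar hτT.1 (hycT.mono (Icc_subset_Icc_right hτT.2))
      (fun s hs => hynet s hs.1) hyne (by rw [hy0]; exact hx) ht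
  have hctl : ∀ᵐ t, t ∈ Ioo 0 τ → α t ∈ M.edgeCtrl γ j := by
    filter_upwards [hedge γ _ α hα j] with t ht hm
    rw [← hy] at ht
    exact ht hm.1 (hyseg t (Ioo_subset_Icc_self hm)) (hyne t ⟨hm.1.le, hm.2⟩)
  have hζτ := hζ τ hτT.1
  -- If every control of the edge is admissible at the vertex, then none points outwards there and
  -- the copy cannot pass it; otherwise `τ` stops the copy in time.
  have hζ1 : ∀ t ∈ Icc 0 τ, ζ t ≤ 1 := by
    by_cases hj : M.localCtrl γ (M.e j) = M.edgeCtrl γ j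
    · refine fun t ht => hζτ.le_of_nonpos_above (by rw [hζ0]; exact hs.2) ?_ ht
      filter_upwards [hctl] with u hu hm h1
      have h2 := hu hm
      rw [← hj, hctrl.2.2.2.1 γ j] at h2
      rw [clip_of_one_le h1.le, speed_one_eq]
      exact div_nonpos_of_nonpos_of_nonneg h2.2 (by positivity)
    · refine fun t ht => mem_Icc_of_mem_Ico hζτ.continuousOn isClosed_Iic
        (show ζ 0 ∈ Iic 1 by rw [hζ0]; exact hs.2) (fun u hu => ?_) ht
      by_contra h1
      have h1 : 1 < ζ u := not_le.1 h1
      exact hfirst u hu.2 (Or.inr (Or.inr ⟨⟨hu.1, hu.2.le.trans hτT.2⟩, hj, h1.le⟩))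
  have hζmem : ∀ t ∈ Icc 0 τ, ζ t ∈ Icc (0 : ℝ) 1 := fun t ht =>
    ⟨mem_Icc_of_mem_Ico hζτ.continuousOn isClosed_Ici
      (show ζ 0 ∈ Ici 0 by rw [hζ0]; exact hs.1) (fun u hu => (hζpos u hu).le) ht, hζ1 t ht⟩
  have htr : ∀ t ∈ Icc 0 τ, M.traj γ (s • M.e j) α t = ζ t • M.e j := fun t ht => by
    rw [← hζ0]; exact traj_eq_smul hf hstar hctrl hα.1 hζτ hζmem hctl ht
  have hnet : ∀ t ∈ Icc 0 τ, M.traj γ (s • M.e j) α t ∈ M.network := fun t ht => by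
    rw [htr t ht]; exact M.seg_subset_network j (M.smul_mem_seg j (hζmem t ht))
  -- Any feasible continuation after `τ` will do: from then on only the value function at the
  -- position reached enters the comparison.
  obtain ⟨β, hβ⟩ := hne _ (hnet τ ⟨hτT.1, le_rfl⟩)
  obtain ⟨c, hc, hctr, hcα⟩ : ∃ c ∈ M.detCtrl γ (s • M.e j),
      (∀ t ∈ Icc 0 τ, M.traj γ (s • M.e j) c t = ζ t • M.e j) ∧ ∀ t < τ, c t = α t :=
    ⟨concat τ α β, concat_mem_detCtrl hf hα.1 hτT.1 hnet hβ,
      fun t ht => by rw [traj_concat_left hf γ _ hα.1 hβ.1 ht, htr t ht],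
      fun t ht => concat_of_lt α β ht⟩
  have hclose : ∀ t ∈ Icc 0 τ, ‖ζ t • M.e j - y t‖ ≤ ρ * ‖M.e j‖ := fun t ht => by
    have h1 := norm_traj_sub_le hf γ (s • M.e j) (r • M.e j) hα.1 ht.1
    rw [htr t ht, ← sub_smul, norm_smul, Real.norm_eq_abs, ← hy] at h1
    refine h1.trans ?_
    rw [← mul_assoc]
    refine mul_le_mul_of_nonneg_right ?_ he.le
    have h2 : Real.exp (hf.const * t) ≤ Real.exp (hf.const * T) :=
      Real.exp_le_exp.2 (mul_le_mul_of_nonneg_left (ht.2.trans hτT.2) (NNReal.coe_nonneg _))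
    calc _ ≤ Real.exp (hf.const * T) * (Real.exp (-(hf.const * T)) * ρ) :=
          mul_le_mul h2 hrs (abs_nonneg _) (Real.exp_pos _).le
      _ = ρ := by rw [← mul_assoc, ← Real.exp_add]; simp
  have hcmp : ∀ t ∈ Ioo 0 τ, |q (M.traj γ (s • M.e j) c t) (c t) - q (y t) (α t)| ≤ η ∧
      |L (M.traj γ (s • M.e j) c t) (c t) - L (y t) (α t)| ≤ η := by
    intro t hm
    have hm' := Ioo_subset_Icc_self hm
    rw [hctr t hm', hcα t hm.2]
    exact hmod _ (M.seg_subset_network j (M.smul_mem_seg j (hζmem t hm'))) _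
      (hynet t hm.1.le) ((hclose t hm').trans hρ0) _
  have hττ : τ ∈ Icc 0 τ := ⟨hτT.1, le_rfl⟩
  have hend : Real.exp (-(δ * τ)) * (M.discValue γ q L (M.traj γ (s • M.e j) c τ) -
      M.discValue γ q L (y τ)) ≤ ε / 2 := by
    -- At the horizon the discount factor is small. Otherwise the stopping condition places one of
    -- the two points at an end of the edge.
    by_cases hτeq : τ = T
    · refine (exp_mul_value_sub_le hf hq hδ hδ0 hL hne (hynet τ hτT.1) (hc.2 τ hτT.1) τ).trans ?_
      rw [hτeq]; exact hTε
    · obtain ⟨b, hb, hby⟩ := hyseg τ hττ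
      have hby : b • M.e j = y τ := hby
      have hcl := hclose τ hττ
      rw [← hby, ← sub_smul, norm_smul, Real.norm_eq_abs] at hcl
      rw [hctr τ hττ, ← hby]
      refine exp_mul_le_of_le hδ0 hτT.1 hε2.le (hendpt _ (hζmem τ hττ) _ hb
        ((le_of_mul_le_mul_right hcl he).trans hρ1) ?_)
      rcases hτ with (h | h) | (h | h)
      · exact absurd h hτeq
      · left
        have h0 : y τ = 0 := h.2
        rw [h0] at hby
        exact (smul_eq_zero.1 hby).resolve_right (hstar.1 j)
      · exact Or.inr (Or.inl (le_antisymm h.2 (hζmem τ hττ).1))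
      · exact Or.inr (Or.inr ⟨h.2.1, le_antisymm (hζmem τ hττ).2 h.2.2⟩)
  subst hy
  have hfinal := discValue_le_discCost_add hf hq hδ hδ0 hL hne hα hc (ε := ε / 2) hτT.1 hτT.2 hη
    hε2.le (Eventually.of_forall fun t hm => (hcmp t hm).1)
    (Eventually.of_forall fun t hm => (hcmp t hm).2) hend
  refine hfinal.trans (add_le_add le_rfl ?_)
  linarith

/-- The closed edges form a finite closed cover of the network, so continuity on each of them
suffices, also at their common point `O`. -/
theorem continuousOn_discValue (hf : M.FieldRegular) (hstar : M.IsStar)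
    (hctrl : M.CtrlStructure) (hact : M.ActiveCtrl) (hinact : M.InactiveCtrl)
    (hedge : M.CtrlOnEdges) (hq : M.RegularCost γ q C)
    (hδ : ∀ x a, δ ≤ q x a) (hδ0 : 0 < δ) (hL : M.RegularCost γ L B)
    (hne : ∀ x ∈ M.network, (M.detCtrl γ x).Nonempty) :
    ContinuousOn (M.discValue γ q L) M.network := by
  have hseg : ∀ j, ContinuousOn (M.discValue γ q L) (M.seg j) := by
    intro j
    have he : 0 < ‖M.e j‖ := norm_pos_iff.2 (hstar.1 j)
    rw [Metric.continuousOn_iff]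
    intro x hx ε hε
    obtain ⟨ρ, hρ, h⟩ := discValue_edge_le hf hstar hctrl hact hinact hedge hq hδ hδ0 hL hne j
      (half_pos hε)
    refine ⟨ρ * ‖M.e j‖, by positivity, fun z hz hdist => ?_⟩
    obtain ⟨r, hr, rfl⟩ := hx
    obtain ⟨s, hs, rfl⟩ := hz
    rw [dist_eq_norm, ← sub_smul, norm_smul, Real.norm_eq_abs] at hdist
    have hrs := (lt_of_mul_lt_mul_right hdist he.le).le
    have h1 := h r hr s hs hrs
    have h2 := h s hs r hr (by rwa [abs_sub_comm])
    rw [Real.dist_eq]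
    exact (abs_le.2 ⟨by linarith, by linarith⟩ : _ ≤ ε / 2).trans_lt (half_lt_self hε)
  exact (locallyFinite_of_finite _).continuousOn_iUnion
    (fun j => (M.isCompact_seg j).isClosed) hseg

end EdgeContinuity

end TrafficModel

/-! ### The law of the first jump time -/

section WaitingTime

open Filter Topology

/-- The survival function with the rate `r`. -/
noncomputable def surv (r : ℝ → ℝ) (t : ℝ) : ℝ := Real.exp (-∫ s in (0 : ℝ)..t, r s)

/-- The time with survival function `surv r`, as a function of a uniform variable. -/
noncomputable def wait (r : ℝ → ℝ) (u : unitInterval) : ℝ≥0∞ :=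
  ⨅ (t : ℝ≥0) (_ : surv r t ≤ u), (t : ℝ≥0∞)

variable {r g h : ℝ → ℝ} {C : ℝ≥0}

lemma surv_pos (r : ℝ → ℝ) (t : ℝ) : 0 < surv r t := Real.exp_pos _

lemma surv_zero (r : ℝ → ℝ) : surv r 0 = 1 := by simp [surv]

lemma intervalIntegrable_rate (hr : Measurable r) (h0 : ∀ t, 0 ≤ r t) (hC : ∀ t, r t ≤ C)
    (a b : ℝ) : IntervalIntegrable r volume a b :=
  intervalIntegrable_of_bounded (C := C) hr (fun t => by
    rw [Real.norm_eq_abs, abs_of_nonneg (h0 t)]; exact hC t) a b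

lemma continuous_surv (hr : Measurable r) (h0 : ∀ t, 0 ≤ r t) (hC : ∀ t, r t ≤ C) :
    Continuous (surv r) :=
  Real.continuous_exp.comp (intervalIntegral.continuous_primitive
    (intervalIntegrable_rate hr h0 hC) 0).neg

lemma surv_antitone (hr : Measurable r) (h0 : ∀ t, 0 ≤ r t) (hC : ∀ t, r t ≤ C) :
    Antitone (surv r) := by
  intro s t hst
  refine Real.exp_le_exp.2 (neg_le_neg ?_)
  rw [← intervalIntegral.integral_add_adjacent_intervals
    (intervalIntegrable_rate hr h0 hC 0 s) (intervalIntegrable_rate hr h0 hC s t)]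
  exact le_add_of_nonneg_right (intervalIntegral.integral_nonneg hst fun r _ => h0 _)

lemma surv_le_one (hr : Measurable r) (h0 : ∀ t, 0 ≤ r t) (hC : ∀ t, r t ≤ C) {t : ℝ}
    (ht : 0 ≤ t) : surv r t ≤ 1 :=
  (surv_antitone hr h0 hC ht).trans_eq (surv_zero r)

/-- The survival function is Lipschitz and satisfies S' = -rS almost everywhere, so it is the
integral of its derivative although the rate is only measurable. -/
lemma surv_eq_one_sub (hr : Measurable r) (h0 : ∀ t, 0 ≤ r t) (hC : ∀ t, r t ≤ C) {t : ℝ}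
    (ht : 0 ≤ t) : ∫ s in (0 : ℝ)..t, r s * surv r s = 1 - surv r t := by
  have hb : ∀ s, ‖r s‖ ≤ C := fun s => by
    rw [Real.norm_eq_abs, abs_of_nonneg (h0 s)]; exact hC s
  have hint := intervalIntegrable_rate hr h0 hC 0 t
  have hΛ : AEDeriv (fun s => ∫ a in (0 : ℝ)..s, r a) r C 0 t :=
    AEDeriv.of_integral (x := 0) hint ht hb fun s _ => (zero_add _).symm
  have hnn : ∀ s ∈ Icc 0 t, 0 ≤ ∫ a in (0 : ℝ)..s, r a := fun s hs =>
    intervalIntegral.integral_nonneg hs.1 fun _ _ => h0 _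
  have hS : AEDeriv (surv r) (fun s => -(r s * surv r (max 0 s))) C 0 t := by
    refine ⟨LipschitzOnWith.of_dist_le_mul fun s hs s' hs' => ?_, ?_⟩
    · exact (TrafficModel.abs_exp_neg_sub_le (hnn s hs) (hnn s' hs')).trans
        (hΛ.1.dist_le_mul s hs s' hs')
    · filter_upwards [hΛ.2] with s hs hm
      rw [max_eq_right hm.1.le]
      have h1 : HasDerivAt (surv r) _ s := (hs hm).neg.exp
      exact h1.congr_deriv (by rw [surv]; simp only [Pi.neg_apply]; ring)
  have hmeas : Measurable fun s => -(r s * surv r (max 0 s)) :=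
    (hr.mul ((continuous_surv hr h0 hC).comp (by fun_prop)).measurable).neg
  have hbd : ∀ s, ‖-(r s * surv r (max 0 s))‖ ≤ C := fun s => by
    rw [norm_neg, norm_mul, Real.norm_eq_abs (surv _ _), abs_of_pos (surv_pos _ _)]
    calc _ ≤ (C : ℝ) * 1 := mul_le_mul (hb s) (surv_le_one hr h0 hC (le_max_left _ _))
          (surv_pos _ _).le C.2
      _ = C := mul_one _
  have := hS.eq_integral (intervalIntegrable_of_bounded hmeas hbd 0 t) hbd ⟨ht, le_rfl⟩
  rw [surv_zero, intervalIntegral.integral_neg] at this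
  have h2 : ∫ s in (0 : ℝ)..t, r s * surv r (max 0 s) = ∫ s in (0 : ℝ)..t, r s * surv r s := by
    refine intervalIntegral.integral_congr fun s hs => ?_
    rw [uIcc_of_le ht] at hs
    simp only [max_eq_right hs.1]
  linarith

/-- Continuity and monotonicity of the survival function turn the infimum into a sublevel condition:
if `u` is below the survival at `t`, it still is slightly later, so the infimum exceeds `t`
strictly. -/
lemma lt_wait_iff (hr : Measurable r) (h0 : ∀ t, 0 ≤ r t) (hC : ∀ t, r t ≤ C) {t : ℝ}
    (ht : 0 ≤ t) (u : unitInterval) : ENNReal.ofReal t < wait r u ↔ (u : ℝ) < surv r t := by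
  constructor
  · intro h
    by_contra! hle
    refine absurd h (not_lt.2 ?_)
    lift t to ℝ≥0 using ht
    rw [ENNReal.ofReal_coe_nnreal]
    exact iInf₂_le t hle
  · intro h
    have hev : ∀ᶠ s in 𝓝[>] t, (u : ℝ) < surv r s :=
      (((continuous_surv hr h0 hC).tendsto t).mono_left nhdsWithin_le_nhds).eventually
        (lt_mem_nhds h)
    obtain ⟨s, hs, hts⟩ := (hev.and self_mem_nhdsWithin).exists
    have hts : t < s := hts
    refine ((ENNReal.ofReal_lt_ofReal_iff (ht.trans_lt hts)).2 hts).trans_le ?_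
    refine le_iInf₂ fun a ha => ?_
    by_contra! hlt
    have h1 : (a : ℝ) < s := by
      rw [← ENNReal.ofReal_coe_nnreal] at hlt
      exact (ENNReal.ofReal_lt_ofReal_iff_of_nonneg a.2).1 hlt
    exact absurd (ha.trans_lt hs) (not_lt.2 (surv_antitone hr h0 hC h1.le))

lemma measurable_wait (r : ℝ → ℝ) : Measurable (wait r) := by
  refine Antitone.measurable fun u v huv => ?_
  exact le_iInf₂ fun t ht => iInf₂_le t (ht.trans huv)

lemma measureReal_lt (c : ℝ) (h0 : 0 ≤ c) (h1 : c ≤ 1) :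
    volume.real {u : unitInterval | (u : ℝ) < c} = c := by
  have : {u : unitInterval | (u : ℝ) < c} = Iio ⟨c, h0, h1⟩ := rfl
  rw [this, measureReal_def, unitInterval.volume_Iio, ENNReal.toReal_ofReal h0]

/-- The contribution of the running cost before the jump. -/
lemma integral_integral_lt_wait (hr : Measurable r) (h0 : ∀ t, 0 ≤ r t) (hC : ∀ t, r t ≤ C)
    (hg : Measurable g) (hgi : IntegrableOn g (Ioi 0)) :
    Integrable (fun u : unitInterval => ∫ t in {t : ℝ | 0 ≤ t ∧ ENNReal.ofReal t < wait r u}, g t)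
      volume ∧
    ∫ u : unitInterval, ∫ t in {t : ℝ | 0 ≤ t ∧ ENNReal.ofReal t < wait r u}, g t =
      ∫ t in Ioi 0, surv r t * g t := by
  set G : unitInterval → ℝ → ℝ := fun u t => if (u : ℝ) < surv r t then g t else 0 with hG
  have hmeasG : Measurable (Function.uncurry G) :=
    Measurable.ite (measurableSet_lt (measurable_subtype_coe.comp measurable_fst)
      ((continuous_surv hr h0 hC).measurable.comp measurable_snd))
      (hg.comp measurable_snd) measurable_const
  have hint : Integrable (Function.uncurry G)
      ((volume : Measure unitInterval).prod (volume.restrict (Ioi 0))) := by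
    refine Integrable.mono' (g := fun p => |g p.2|) (hgi.abs.comp_snd _)
      hmeasG.aestronglyMeasurable (Eventually.of_forall fun p => ?_)
    simp only [Function.uncurry, hG]
    split_ifs
    · rw [Real.norm_eq_abs]
    · simp
  have hinner : ∀ u : unitInterval,
      ∫ t in {t : ℝ | 0 ≤ t ∧ ENNReal.ofReal t < wait r u}, g t = ∫ t in Ioi 0, G u t := by
    intro u
    have hset : {t : ℝ | 0 ≤ t ∧ ENNReal.ofReal t < wait r u} =
        Ici 0 ∩ {t | (u : ℝ) < surv r t} := by
      ext t
      simp only [mem_ofPred_eq, mem_inter_iff, mem_Ici]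
      exact and_congr_right fun ht => lt_wait_iff hr h0 hC ht u
    have hms : MeasurableSet {t | (u : ℝ) < surv r t} :=
      measurableSet_lt measurable_const (continuous_surv hr h0 hC).measurable
    rw [hset, ← setIntegral_indicator hms, integral_Ici_eq_integral_Ioi]
    rfl
  simp_rw [hinner]
  refine ⟨hint.integral_prod_left, ?_⟩
  -- After the exchange, the inner integral is the measure of {u < S(t)}, that is S(t), times g(t).
  rw [integral_integral_swap hint]
  refine setIntegral_congr_fun measurableSet_Ioi fun t ht => ?_
  have ht0 : 0 ≤ t := le_of_lt ht
  have hms : MeasurableSet {u : unitInterval | (u : ℝ) < surv r t} :=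
    measurableSet_lt measurable_subtype_coe measurable_const
  calc ∫ u : unitInterval, G u t
      = ∫ u : unitInterval, {u : unitInterval | (u : ℝ) < surv r t}.indicator (fun _ => g t) u :=
        rfl
    _ = surv r t * g t := by
        rw [integral_indicator hms, setIntegral_const,
          measureReal_lt _ (surv_pos r t).le (surv_le_one hr h0 hC ht0), smul_eq_mul]

/-- The law of the jump time has the density `r * surv r`. -/
lemma map_wait_eq (hr : Measurable r) (h0 : ∀ t, 0 ≤ r t) (hC : ∀ t, r t ≤ C) :
    ((volume : Measure unitInterval).restrict {u | wait r u ≠ ∞}).map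
        (fun u => (wait r u).toReal) =
      (volume.restrict (Ioi 0)).withDensity fun t => ENNReal.ofReal (r t * surv r t) := by
  have hmS := (continuous_surv hr h0 hC).measurable
  have hmT : Measurable fun u => (wait r u).toReal := (measurable_wait r).ennreal_toReal
  have hms : MeasurableSet {u | wait r u ≠ ∞} :=
    (measurable_wait r (measurableSet_singleton ∞)).compl
  have hfin : IsFiniteMeasure (((volume : Measure unitInterval).restrict {u | wait r u ≠ ∞}).map
        (fun u => (wait r u).toReal)) := inferInstance
  -- The total mass may be less than 1, since possibly no jump occurs, but finite measures on the
  -- line are determined by half-lines; up to a time t ≥ 0 both have the mass 1 - S(t).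
  refine Measure.ext_of_Iic _ _ fun t => ?_
  rw [Measure.map_apply hmT measurableSet_Iic,
    Measure.restrict_apply (hmT measurableSet_Iic), withDensity_apply _ measurableSet_Iic,
    Measure.restrict_restrict measurableSet_Iic]
  rcases lt_or_ge t 0 with ht | ht
  · have e1 : (fun u : unitInterval => (wait r u).toReal) ⁻¹' Iic t ∩ {u | wait r u ≠ ∞} = ∅ := by
      ext u
      simp only [mem_inter_iff, mem_preimage, mem_Iic, mem_empty_iff_false, iff_false]
      exact fun h => absurd (ht.trans_le ENNReal.toReal_nonneg) (not_lt.2 h.1)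
    have e2 : Iic t ∩ Ioi 0 = ∅ := by
      ext s
      simp only [mem_inter_iff, mem_Iic, mem_Ioi, mem_empty_iff_false, iff_false]
      exact fun h => absurd (h.2.trans_le h.1) (not_lt.2 ht.le)
    rw [e1, e2]; simp
  · have e1 : (fun u : unitInterval => (wait r u).toReal) ⁻¹' Iic t ∩ {u | wait r u ≠ ∞} =
        Ici ⟨surv r t, (surv_pos r t).le, surv_le_one hr h0 hC ht⟩ := by
      ext u
      have h1 : u ∈ Ici (⟨surv r t, (surv_pos r t).le, surv_le_one hr h0 hC ht⟩ : unitInterval) ↔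
          ¬ (u : ℝ) < surv r t := by rw [not_lt]; rfl
      rw [h1, ← lt_wait_iff hr h0 hC ht, not_lt]
      simp only [mem_inter_iff, mem_preimage, mem_Iic, mem_ofPred_eq]
      constructor
      · rintro ⟨h2, h3⟩
        exact (ENNReal.le_ofReal_iff_toReal_le h3 ht).2 h2
      · intro h2
        have h3 : wait r u ≠ ∞ := ne_top_of_le_ne_top ENNReal.ofReal_ne_top h2
        exact ⟨(ENNReal.le_ofReal_iff_toReal_le h3 ht).1 h2, h3⟩
    rw [e1, unitInterval.volume_Ici, inter_comm, Ioi_inter_Iic,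
      ← ofReal_integral_eq_lintegral_ofReal, ← intervalIntegral.integral_of_le ht,
      surv_eq_one_sub hr h0 hC ht]
    · rw [← IntegrableOn, ← intervalIntegrable_iff_integrableOn_Ioc_of_le ht]
      exact (intervalIntegrable_rate hr h0 hC 0 t).mul_continuousOn
        (continuous_surv hr h0 hC).continuousOn
    · exact Eventually.of_forall fun s => mul_nonneg (h0 s) (surv_pos r s).le

lemma integral_wait (hr : Measurable r) (h0 : ∀ t, 0 ≤ r t) (hC : ∀ t, r t ≤ C)
    (hh : Measurable h) :
    ∫ u : unitInterval, (if wait r u = ∞ then 0 else h (wait r u).toReal) =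
      ∫ t in Ioi 0, r t * surv r t * h t := by
  have hms : MeasurableSet {u | wait r u ≠ ∞} :=
    (measurable_wait r (measurableSet_singleton ∞)).compl
  have hmS := (continuous_surv hr h0 hC).measurable
  calc ∫ u : unitInterval, (if wait r u = ∞ then 0 else h (wait r u).toReal)
      = ∫ u : unitInterval, {u | wait r u ≠ ∞}.indicator (fun u => h (wait r u).toReal) u := by
        refine integral_congr_ae (Eventually.of_forall fun u => ?_)
        by_cases hu : wait r u = ∞ <;> simp [hu]
    _ = ∫ t, h t ∂((volume : Measure unitInterval).restrict {u | wait r u ≠ ∞}).map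
          (fun u => (wait r u).toReal) := by
        rw [integral_indicator hms, integral_map
          (measurable_wait r).ennreal_toReal.aemeasurable hh.aestronglyMeasurable]
    _ = _ := by
        rw [map_wait_eq hr h0 hC, integral_withDensity_eq_integral_toReal_smul
          (show Measurable fun t => ENNReal.ofReal (r t * surv r t) from
            (hr.mul hmS).ennreal_ofReal) (Eventually.of_forall fun t => ENNReal.ofReal_lt_top)]
        refine integral_congr_ae (Eventually.of_forall fun t => ?_)
        simp only [smul_eq_mul]
        rw [ENNReal.toReal_ofReal (mul_nonneg (h0 t) (surv_pos r t).le)]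

end WaitingTime

/-! ### Discrete distributions on a finite type -/

section PostMode

open Filter

variable {ι : Type*} [Fintype ι]

/-- The total weight of the elements whose rank precedes that of `i`. -/
noncomputable def cumLt (p : ι → ℝ) (i : ι) : ℝ :=
  ∑ k with Fintype.equivFin ι k < Fintype.equivFin ι i, p k

/-- The total weight of the elements whose rank is at most that of `i`. -/
noncomputable def cumLe (p : ι → ℝ) (i : ι) : ℝ :=
  ∑ k with Fintype.equivFin ι k ≤ Fintype.equivFin ι i, p k

variable {p : ι → ℝ}

lemma cumLe_eq (p : ι → ℝ) (i : ι) : cumLe p i = cumLt p i + p i := by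
  classical
  rw [cumLe, cumLt, add_comm, ← Finset.sum_insert (by simp)]
  refine Finset.sum_congr ?_ fun _ _ => rfl
  ext k
  simp only [Finset.mem_filter, Finset.mem_univ, true_and, Finset.mem_insert, le_iff_lt_or_eq,
    EmbeddingLike.apply_eq_iff_eq]
  exact or_comm

lemma cumLt_nonneg (hp : ∀ i, 0 ≤ p i) (i : ι) : 0 ≤ cumLt p i :=
  Finset.sum_nonneg fun _ _ => hp _

lemma cumLe_le_one (hp : ∀ i, 0 ≤ p i) (h1 : ∑ i, p i = 1) (i : ι) : cumLe p i ≤ 1 := by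
  rw [← h1]
  exact Finset.sum_le_sum_of_subset_of_nonneg (Finset.filter_subset _ _) fun _ _ _ => hp _

lemma cumLe_le_cumLt (hp : ∀ i, 0 ≤ p i) {i k : ι}
    (h : Fintype.equivFin ι i < Fintype.equivFin ι k) : cumLe p i ≤ cumLt p k := by
  refine Finset.sum_le_sum_of_subset_of_nonneg (fun l hl => ?_) fun _ _ _ => hp _
  simp only [Finset.mem_filter, Finset.mem_univ, true_and] at hl ⊢
  exact hl.trans_lt h

/-- If `u` lay in none of the intervals, induction on the rank would place it above every cumulative
weight, including the last one, which is 1. -/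
lemma exists_cum_mem (h1 : ∑ i, p i = 1) {u : ℝ} (hu0 : 0 < u) (hu1 : u ≤ 1) :
    ∃ i, cumLt p i < u ∧ u ≤ cumLe p i := by
  by_contra! hno
  have key : ∀ (n : ℕ) (i : ι), (Fintype.equivFin ι i : ℕ) = n → cumLe p i < u := by
    intro n
    induction n with
    | zero =>
      intro i hi
      refine hno i ?_
      rw [cumLt, Finset.filter_false_of_mem, Finset.sum_empty]
      · exact hu0
      · intro k _ hk
        have : (Fintype.equivFin ι k : ℕ) < Fintype.equivFin ι i := hk
        omega
    | succ n ih =>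
      intro i hi
      refine hno i ?_
      have hn : n < Fintype.card ι := by
        have := (Fintype.equivFin ι i).2
        omega
      have h2 := ih ((Fintype.equivFin ι).symm ⟨n, hn⟩) (by simp)
      refine lt_of_eq_of_lt ?_ h2
      rw [cumLt, cumLe]
      refine Finset.sum_congr (Finset.filter_congr fun k _ => ?_) fun _ _ => rfl
      rw [Equiv.apply_symm_apply, Fin.lt_def, Fin.le_def, hi]
      exact Nat.lt_succ_iff
  have hne : Nonempty ι := by
    by_contra hemp
    rw [not_nonempty_iff] at hemp
    rw [Finset.univ_eq_empty, Finset.sum_empty] at h1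
    exact zero_ne_one h1
  have hcard : 0 < Fintype.card ι := Fintype.card_pos
  have h3 := key _ ((Fintype.equivFin ι).symm ⟨Fintype.card ι - 1, by omega⟩) rfl
  refine absurd h3 (not_lt.2 ?_)
  rw [cumLe, Finset.filter_true_of_mem, h1]
  · exact hu1
  · intro k _
    rw [Equiv.apply_symm_apply, Fin.le_def]
    have := (Fintype.equivFin ι k).2
    simp only
    omega

end PostMode

namespace TrafficModel

/-! ### The mode selected at a jump. -/

section FirstJump

open Filter

variable {d m N : ℕ} {E : Type*} [Fintype E] {M : TrafficModel d m N E}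

/-- The intervals are disjoint and cover (0,1], so the choice in the definition is forced; `u > 0`
excludes the default value. -/
lemma postMode_eq_iff (hQ : M.TransitionRegular) (γ γ₁ : E) (x : EuclideanSpace ℝ (Fin m))
    (a : M.A) {u : unitInterval} (hu : 0 < (u : ℝ)) : M.postMode γ x a u = γ₁ ↔
      cumLt (fun γ₂ => M.Q x γ γ₂ a) γ₁ < u ∧ u ≤ cumLe (fun γ₂ => M.Q x γ γ₂ a) γ₁ := by
  have hp : ∀ γ₂, 0 ≤ M.Q x γ γ₂ a := fun γ₂ => (hQ.1 x γ γ₂ a).1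
  have hex := exists_cum_mem (hQ.2.1 x γ a) hu u.2.2
  have h : ∃ γ₁ : E, cumLt (fun γ₂ => M.Q x γ γ₂ a) γ₁ < u ∧
      (u : ℝ) ≤ cumLe (fun γ₂ => M.Q x γ γ₂ a) γ₁ := hex
  have heq : M.postMode γ x a u = h.choose := dif_pos h
  have huniq : ∀ γ₁ γ₂, (cumLt (fun γ₂ => M.Q x γ γ₂ a) γ₁ < u ∧
      (u : ℝ) ≤ cumLe (fun γ₂ => M.Q x γ γ₂ a) γ₁) → (cumLt (fun γ₂ => M.Q x γ γ₂ a) γ₂ < u ∧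
      (u : ℝ) ≤ cumLe (fun γ₂ => M.Q x γ γ₂ a) γ₂) → γ₁ = γ₂ := by
    intro γ₁ γ₂ h1 h2
    by_contra hne
    rcases lt_or_gt_of_ne ((Fintype.equivFin E).injective.ne hne) with hlt | hlt
    · exact absurd (h1.2.trans (cumLe_le_cumLt hp hlt)) (not_le.2 h2.1)
    · exact absurd (h2.2.trans (cumLe_le_cumLt hp hlt)) (not_le.2 h1.1)
  rw [heq]
  exact ⟨fun hγ => hγ ▸ h.choose_spec, fun h1 => huniq _ _ h.choose_spec h1⟩

end FirstJump

end TrafficModel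

namespace TrafficModel

section RegularCosts

open Filter

variable {d m N : ℕ} {E : Type*} {M : TrafficModel d m N E}
  {γ : E} {g g₁ g₂ : EuclideanSpace ℝ (Fin m) → M.A → ℝ} {B B₁ B₂ : ℝ}

/-! ### Examples of regular costs -/

namespace RegularCost

lemma of_lipschitz {K : ℝ≥0} (hB : ∀ x a, |g x a| ≤ B)
    (hK : ∀ x z a, |g x a - g z a| ≤ K * ‖x - z‖)
    (hmeas : ∀ y : ℝ → EuclideanSpace ℝ (Fin m), Continuous y →
      ∀ α : ℝ → M.A, Measurable α → Measurable fun t => g (y t) (α t))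
    (hcomp : ∀ j, γ ∉ M.active j → ∀ a ∈ M.edgeCtrl γ j, ∀ b ∈ M.edgeCtrl γ j,
      g 0 a = g 0 b) : M.RegularCost γ g B where
  abs_le x _ a := hB x a
  modulus ε hε := by
    have hK1 : 0 < (K : ℝ) + 1 := by positivity
    refine ⟨ε / (K + 1), by positivity, fun x _ z _ hxz a => (hK x z a).trans ?_⟩
    calc (K : ℝ) * ‖x - z‖ ≤ (K + 1) * (ε / (K + 1)) :=
          mul_le_mul (by linarith) hxz (norm_nonneg _) hK1.le
      _ = ε := mul_div_cancel₀ _ hK1.ne'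
  measurable y hy _ α hα := hmeas y hy α hα
  compatible := hcomp

lemma const (M : TrafficModel d m N E) (γ : E) (c : ℝ) :
    M.RegularCost γ (fun _ _ => c) |c| :=
  of_lipschitz (K := 0) (fun _ _ => le_rfl) (fun _ _ _ => by simp)
    (fun _ _ _ _ => measurable_const) fun _ _ _ _ _ _ => rfl

lemma of_continuousOn {w : EuclideanSpace ℝ (Fin m) → ℝ} (hw : ContinuousOn w M.network)
    (hB : ∀ x ∈ M.network, |w x| ≤ B) : M.RegularCost γ (fun x _ => w x) B where
  abs_le x hx _ := hB x hx
  modulus ε hε := by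
    obtain ⟨ρ, hρ, h⟩ := Metric.uniformContinuousOn_iff.1
      (M.isCompact_network.uniformContinuousOn_of_continuous hw) ε hε
    refine ⟨ρ / 2, half_pos hρ, fun x hx z hz hxz _ => (h x hx z hz ?_).le⟩
    rw [dist_eq_norm]
    exact hxz.trans_lt (half_lt_self hρ)
  measurable y hy hmem _ _ := (hw.comp_continuous hy hmem).measurable
  compatible _ _ _ _ _ _ := rfl

lemma add (h₁ : M.RegularCost γ g₁ B₁) (h₂ : M.RegularCost γ g₂ B₂) :
    M.RegularCost γ (fun x a => g₁ x a + g₂ x a) (B₁ + B₂) where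
  abs_le x hx a := (abs_add_le _ _).trans (add_le_add (h₁.abs_le x hx a) (h₂.abs_le x hx a))
  modulus ε hε := by
    obtain ⟨ρ₁, hρ₁, H₁⟩ := h₁.modulus (ε / 2) (half_pos hε)
    obtain ⟨ρ₂, hρ₂, H₂⟩ := h₂.modulus (ε / 2) (half_pos hε)
    refine ⟨min ρ₁ ρ₂, lt_min hρ₁ hρ₂, fun x hx z hz hxz a => ?_⟩
    rw [add_sub_add_comm]
    refine (abs_add_le _ _).trans ((add_le_add (H₁ x hx z hz (hxz.trans (min_le_left _ _)) a)
      (H₂ x hx z hz (hxz.trans (min_le_right _ _)) a)).trans_eq (add_halves ε))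
  measurable y hy hmem α hα :=
    (h₁.measurable y hy hmem α hα).add (h₂.measurable y hy hmem α hα)
  compatible j hj a ha b hb := by
    simp only [h₁.compatible j hj a ha b hb, h₂.compatible j hj a ha b hb]

lemma mul (h₁ : M.RegularCost γ g₁ B₁) (h₂ : M.RegularCost γ g₂ B₂) :
    M.RegularCost γ (fun x a => g₁ x a * g₂ x a) (B₁ * B₂) where
  abs_le x hx a := by
    rw [abs_mul]
    exact mul_le_mul (h₁.abs_le x hx a) (h₂.abs_le x hx a) (abs_nonneg _) (h₁.nonneg hx a)
  modulus ε hε := by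
    have hpos : 0 < |B₁| + |B₂| + 1 := by positivity
    set η := ε / (|B₁| + |B₂| + 1) with hη
    have hη0 : 0 < η := by positivity
    obtain ⟨ρ₁, hρ₁, H₁⟩ := h₁.modulus η hη0
    obtain ⟨ρ₂, hρ₂, H₂⟩ := h₂.modulus η hη0
    refine ⟨min ρ₁ ρ₂, lt_min hρ₁ hρ₂, fun x hx z hz hxz a => ?_⟩
    have e1 := H₁ x hx z hz (hxz.trans (min_le_left _ _)) a
    have e2 := H₂ x hx z hz (hxz.trans (min_le_right _ _)) a
    have e3 := (h₁.abs_le x hx a).trans (le_abs_self B₁)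
    have e4 := (h₂.abs_le z hz a).trans (le_abs_self B₂)
    have e5 : g₁ x a * g₂ x a - g₁ z a * g₂ z a =
        g₁ x a * (g₂ x a - g₂ z a) + (g₁ x a - g₁ z a) * g₂ z a := by ring
    rw [e5]
    refine (abs_add_le _ _).trans ?_
    rw [abs_mul, abs_mul]
    calc _ ≤ |B₁| * η + η * |B₂| :=
          add_le_add (mul_le_mul e3 e2 (abs_nonneg _) (abs_nonneg _))
            (mul_le_mul e1 e4 (abs_nonneg _) hη0.le)
      _ ≤ (|B₁| + |B₂| + 1) * η := by linarith
      _ = ε := mul_div_cancel₀ _ hpos.ne'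
  measurable y hy hmem α hα :=
    (h₁.measurable y hy hmem α hα).mul (h₂.measurable y hy hmem α hα)
  compatible j hj a ha b hb := by
    simp only [h₁.compatible j hj a ha b hb, h₂.compatible j hj a ha b hb]

lemma sum {ι : Type*} (s : Finset ι) {g : ι → EuclideanSpace ℝ (Fin m) → M.A → ℝ} {B : ι → ℝ}
    (h : ∀ i, M.RegularCost γ (g i) (B i)) :
    M.RegularCost γ (fun x a => ∑ i ∈ s, g i x a) (∑ i ∈ s, B i) := by
  classical
  induction s using Finset.induction_on with
  | empty => simpa using RegularCost.const M γ 0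
  | insert i s hi ih => simpa only [Finset.sum_insert hi] using (h i).add ih

end RegularCost

lemma CostRegular.regularCost (hl : M.CostRegular) (hcost : M.CostCompatible) (γ : E) :
    ∃ B, M.RegularCost γ (M.l γ) B := by
  obtain ⟨hcont, C, hC, h⟩ := hl
  exact ⟨C, .of_lipschitz (K := ⟨C, hC.le⟩) (fun x a => (h γ x x a).2)
    (fun x z a => (h γ x z a).1)
    (fun y hy α hα => (hcont γ).continuous.measurable.comp (hy.measurable.prodMk hα))
    fun j hj => hcost j γ hj⟩

lemma RateRegular.regularCost (hlam : M.RateRegular) (hjump : M.JumpCompatible) (γ : E) :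
    M.RegularCost γ (fun x a => M.lam x γ a) hlam.const :=
  .of_lipschitz (K := hlam.const)
    (fun x a => by rw [abs_of_nonneg (hlam.2.1 x γ a)]; exact hlam.le_const x γ a)
    (fun x z a => hlam.abs_sub_le x z γ a)
    (fun _ hy _ hα => measurable_lam hlam γ hy.measurable hα)
    fun j hj a ha b hb => (hjump j γ hj a ha b hb).1

variable [Fintype E]

/-- The transition matrix is continuous in the position and measurable in the control, a
Carathéodory function, hence jointly measurable. -/
lemma measurable_transition (hQ : M.TransitionRegular) (γ γ₁ : E)
    {y : ℝ → EuclideanSpace ℝ (Fin m)} (hy : Measurable y) {α : ℝ → M.A} (hα : Measurable α) :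
    Measurable fun t => M.Q (y t) γ γ₁ (α t) := by
  obtain ⟨-, -, -, hmeas, C, hC, h⟩ := hQ
  have hcont : ∀ a, Continuous fun x => M.Q x γ γ₁ a := fun a =>
    (LipschitzWith.of_dist_le_mul (K := ⟨C, hC.le⟩) fun x z => by
      rw [Real.dist_eq, dist_eq_norm]; exact h γ γ₁ x z a).continuous
  have := measurable_uncurry_of_continuous_of_measurable (u := fun x a => M.Q x γ γ₁ a) hcont
    fun x => hmeas x γ γ₁
  exact this.comp (hy.prodMk hα)

lemma TransitionRegular.regularCost (hQ : M.TransitionRegular) (hjump : M.JumpCompatible)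
    (γ γ₁ : E) : M.RegularCost γ (fun x a => M.Q x γ γ₁ a) 1 := by
  obtain ⟨C, hC, h⟩ := hQ.2.2.2.2
  refine .of_lipschitz (K := ⟨C, hC.le⟩) (fun x a => ?_) (fun x z a => h γ γ₁ x z a)
    (fun _ hy _ hα => measurable_transition hQ γ γ₁ hy.measurable hα)
    fun j hj a ha b hb => (hjump j γ hj a ha b hb).2 γ₁
  rw [abs_of_nonneg (hQ.1 x γ γ₁ a).1]
  exact (hQ.1 x γ γ₁ a).2

/-- The running cost of the control problem satisfied by the value functions after the first
jump. -/
noncomputable def jumpCost (M : TrafficModel d m N E) (v : EuclideanSpace ℝ (Fin m) → E → ℝ)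
    (γ : E) (x : EuclideanSpace ℝ (Fin m)) (a : M.A) : ℝ :=
  M.l γ x a + M.lam x γ a * ∑ γ₁, M.Q x γ γ₁ a * v x γ₁

/-- This is what makes the induction run: only continuity of `v` on the compact network is needed,
not a Lipschitz bound. Since `v` does not depend on the control, compatibility at `O` is inherited
from λ, Q and l. -/
lemma regularCost_jumpCost (hlam : M.RateRegular) (hQ : M.TransitionRegular)
    (hl : M.CostRegular) (hcost : M.CostCompatible) (hjump : M.JumpCompatible)
    {v : EuclideanSpace ℝ (Fin m) → E → ℝ} (hv : ∀ γ, ContinuousOn (fun x => v x γ) M.network)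
    (γ : E) : ∃ B, M.RegularCost γ (M.jumpCost v γ) B := by
  obtain ⟨Bl, hBl⟩ := hl.regularCost hcost γ
  choose b hb using fun γ₁ => M.isCompact_network.exists_bound_of_continuousOn (hv γ₁)
  exact ⟨_, hBl.add ((hlam.regularCost hjump γ).mul (RegularCost.sum Finset.univ fun γ₁ =>
    (hQ.regularCost hjump γ γ₁).mul (.of_continuousOn (hv γ₁) (hb γ₁))))⟩

end RegularCosts

end TrafficModel

/-! ### The joint law of the first jump time and the mode after it. -/

section FirstJumpLaw

open Filter

variable {ι : Type*} [Fintype ι] {r g : ℝ → ℝ} {C : ℝ≥0} {P w : ι → ℝ → ℝ} {B : ℝ}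

lemma measurable_cumLt (hP : ∀ i, Measurable (P i)) (i : ι) :
    Measurable fun t => cumLt (fun k => P k t) i :=
  Finset.measurable_sum _ fun k _ => hP k

lemma measurable_cumLe (hP : ∀ i, Measurable (P i)) (i : ι) :
    Measurable fun t => cumLe (fun k => P k t) i :=
  Finset.measurable_sum _ fun k _ => hP k

lemma integral_ite_cum {p : ι → ℝ} (hp : ∀ i, 0 ≤ p i) (h1 : ∑ i, p i = 1) (c : ι → ℝ) :
    ∫ u : unitInterval, ∑ i, (if cumLt p i < (u : ℝ) ∧ (u : ℝ) ≤ cumLe p i then c i else 0) =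
      ∑ i, p i * c i := by
  have hle : ∀ i, cumLt p i ≤ cumLe p i := fun i => by
    rw [cumLe_eq]; exact le_add_of_nonneg_right (hp i)
  have hset : ∀ i, MeasurableSet {u : unitInterval | cumLt p i < (u : ℝ) ∧ (u : ℝ) ≤ cumLe p i} :=
    fun i => (measurableSet_lt measurable_const measurable_subtype_coe).inter
      (measurableSet_le measurable_subtype_coe measurable_const)
  have hind : ∀ i, (fun u : unitInterval =>
      if cumLt p i < (u : ℝ) ∧ (u : ℝ) ≤ cumLe p i then c i else 0) =
      {u : unitInterval | cumLt p i < (u : ℝ) ∧ (u : ℝ) ≤ cumLe p i}.indicator fun _ => c i :=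
    fun i => by ext u; simp only [indicator, mem_ofPred_eq]
  rw [integral_finsetSum _ fun i _ => by
    rw [hind]; exact (integrable_const _).indicator (hset i)]
  refine Finset.sum_congr rfl fun i _ => ?_
  have h3 : {u : unitInterval | cumLt p i < (u : ℝ) ∧ (u : ℝ) ≤ cumLe p i} =
      Ioc ⟨cumLt p i, cumLt_nonneg hp i, (hle i).trans (cumLe_le_one hp h1 i)⟩
        ⟨cumLe p i, (cumLt_nonneg hp i).trans (hle i), cumLe_le_one hp h1 i⟩ := rfl
  rw [hind, integral_indicator (hset i), setIntegral_const, h3, measureReal_def,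
    unitInterval.volume_Ioc, smul_eq_mul]
  simp only
  rw [ENNReal.toReal_ofReal (sub_nonneg.2 (hle i)), cumLe_eq, add_sub_cancel_left]

/-- The expected cost up to the first jump and at the first jump. -/
lemma integral_first_jump (hr : Measurable r) (h0 : ∀ t, 0 ≤ r t) (hC : ∀ t, r t ≤ C)
    (hg : Measurable g) (hgi : IntegrableOn g (Ioi 0)) (hP : ∀ i, Measurable (P i))
    (hP0 : ∀ i t, 0 ≤ P i t) (hP1 : ∀ t, ∑ i, P i t = 1) (hw : ∀ i, Measurable (w i))
    (hB : ∀ i t, 0 ≤ t → |w i t| ≤ B) {F : unitInterval × unitInterval → ℝ}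
    (hF : ∀ p, F p = (∫ t in {t : ℝ | 0 ≤ t ∧ ENNReal.ofReal t < wait r p.1}, g t) +
      if wait r p.1 = ∞ then 0 else ∑ i,
        if cumLt (fun k => P k (wait r p.1).toReal) i < (p.2 : ℝ) ∧
            (p.2 : ℝ) ≤ cumLe (fun k => P k (wait r p.1).toReal) i
          then w i (wait r p.1).toReal else 0) :
    Integrable F ((volume : Measure unitInterval).prod volume) ∧
      ∫ p, F p ∂(volume : Measure unitInterval).prod volume =
        (∫ t in Ioi 0, surv r t * g t) + ∫ t in Ioi 0, r t * surv r t * ∑ i, P i t * w i t := by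
  obtain ⟨hint1, heq1⟩ := integral_integral_lt_wait hr h0 hC hg hgi
  set G : unitInterval → ℝ := fun u =>
    ∫ t in {t : ℝ | 0 ≤ t ∧ ENNReal.ofReal t < wait r u}, g t with hG
  set T : unitInterval → ℝ := fun u => (wait r u).toReal with hT
  have hTm : Measurable T := (measurable_wait r).ennreal_toReal
  set K : unitInterval × unitInterval → ℝ := fun p => if wait r p.1 = ∞ then 0 else ∑ i,
    if cumLt (fun k => P k (T p.1)) i < (p.2 : ℝ) ∧
      (p.2 : ℝ) ≤ cumLe (fun k => P k (T p.1)) i then w i (T p.1) else 0 with hK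
  have hFK : F = fun p => G p.1 + K p := funext hF
  have hp2 : Measurable fun p : unitInterval × unitInterval => (p.2 : ℝ) :=
    measurable_subtype_coe.comp measurable_snd
  have hT1 : Measurable fun p : unitInterval × unitInterval => T p.1 := hTm.comp measurable_fst
  have hKm : Measurable K := by
    refine Measurable.ite (((measurable_wait r).comp measurable_fst) (measurableSet_singleton ∞))
      measurable_const (Finset.measurable_sum _ fun i _ => ?_)
    refine Measurable.ite (MeasurableSet.inter
      (measurableSet_lt ((measurable_cumLt hP i).comp hT1) hp2)
      (measurableSet_le hp2 ((measurable_cumLe hP i).comp hT1)))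
      ((hw i).comp hT1) measurable_const
  have hKi : Integrable K ((volume : Measure unitInterval).prod volume) := by
    refine Integrable.of_bound hKm.aestronglyMeasurable (∑ _i : ι, |B|)
      (Eventually.of_forall fun p => ?_)
    rw [hK]
    simp only
    split_ifs
    · rw [norm_zero]
      positivity
    · refine (norm_sum_le _ _).trans (Finset.sum_le_sum fun i _ => ?_)
      split_ifs
      · exact (hB i _ ENNReal.toReal_nonneg).trans (le_abs_self B)
      · rw [norm_zero]
        exact abs_nonneg B
  have hGi : Integrable (fun p : unitInterval × unitInterval => G p.1)
      ((volume : Measure unitInterval).prod volume) := hint1.comp_fst _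
  rw [hFK]
  refine ⟨hGi.add hKi, ?_⟩
  rw [integral_add hGi hKi, integral_prod _ hGi, integral_prod _ hKi]
  congr 1
  · simpa using heq1
  · rw [← integral_wait hr h0 hC (h := fun t => ∑ i, P i t * w i t) (Finset.measurable_sum _
      fun i _ => (hP i).mul (hw i))]
    refine integral_congr_ae (Eventually.of_forall fun u => ?_)
    simp only [hK]
    by_cases hu : wait r u = ∞
    · simp [hu]
    · simp only [hu, if_false]
      exact integral_ite_cum (fun i => hP0 i _) (hP1 _) _

end FirstJumpLaw

namespace TrafficModel

/-! ### Reduction of the cost up to the first jump to a deterministic cost. -/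

section FirstJumpCost

open Filter

variable {d m N : ℕ} {E : Type*} {M : TrafficModel d m N E} {δ : ℝ}
  {v : EuclideanSpace ℝ (Fin m) → E → ℝ} {x : EuclideanSpace ℝ (Fin m)} {γ : E}

lemma waitingTime_eq_wait (γ : E) (x : EuclideanSpace ℝ (Fin m)) (α : ℝ → M.A)
    (u : unitInterval) : M.waitingTime γ x α u =
      wait (fun t => M.lam (M.traj γ x α (max 0 t)) γ (α t)) u := by
  rw [waitingTime, wait]
  refine iInf_congr fun t => ?_
  have : M.survival γ x α t = surv (fun t => M.lam (M.traj γ x α (max 0 t)) γ (α t)) t :=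
    disc_eq_along (q := fun x a => M.lam x γ a) t.2
  rw [this]

/-- Everything up to the first jump depends on the coordinates 0 and 1 only, which are independent
and uniform. -/
lemma map_cubeMeasure_pair : cubeMeasure.map (fun ω : ℕ → unitInterval => (ω 0, ω 1)) =
    (volume : Measure unitInterval).prod volume := by
  refine (Measure.prod_eq fun s t hs ht => ?_).symm
  have hm : Measurable fun ω : ℕ → unitInterval => (ω 0, ω 1) := by fun_prop
  rw [Measure.map_apply hm (hs.prod ht)]
  have h1 : (fun ω : ℕ → unitInterval => (ω 0, ω 1)) ⁻¹' s ×ˢ t =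
      Set.pi (({0, 1} : Finset ℕ) : Set ℕ) fun n => if n = 0 then s else t := by
    ext ω
    simp
  rw [h1, cubeMeasure, Measure.infinitePi_pi _ fun i _ => by split_ifs <;> assumption]
  simp

variable [Fintype E]

/-- The cost up to the first jump is the cost of a deterministic control problem in which the
jump rate contributes to the discount rate and to the running cost. -/
theorem firstJumpCost_eq (hf : M.FieldRegular) (hlam : M.RateRegular) (hQ : M.TransitionRegular)
    (hl : M.CostRegular) (hcost : M.CostCompatible) (hjump : M.JumpCompatible) (hδ : 0 < δ)
    (hv : ∀ γ, ContinuousOn (fun x => v x γ) M.network)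
    {π : ℝ → EuclideanSpace ℝ (Fin m) → E → M.A} (hπ : π ∈ M.admissible) (hx : x ∈ M.network) :
    M.firstJumpCost δ v x γ π =
      M.discCost γ (fun x a => δ + M.lam x γ a) (M.jumpCost v γ) x fun t => π t x γ := by
  have hα := detCtrl_of_admissible hf hlam hπ hx γ
  set α : ℝ → M.A := fun t => π t x γ with hαdef
  set y : ℝ → EuclideanSpace ℝ (Fin m) := fun t => M.traj γ x α (max 0 t) with hy
  have hyc : Continuous y := continuous_comp_max (traj_continuousOn hf γ x hα.1)
  have hymem : ∀ t, y t ∈ M.network := fun t => hα.2 _ (le_max_left _ _)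
  have hyt : ∀ t, 0 ≤ t → y t = M.traj γ x α t := fun t ht => by simp only [hy, max_eq_right ht]
  obtain ⟨Bl, hBl⟩ := hl.regularCost hcost γ
  obtain ⟨BL, hBL⟩ := regularCost_jumpCost hlam hQ hl hcost hjump hv γ
  choose b hb using fun γ₁ => M.isCompact_network.exists_bound_of_continuousOn (hv γ₁)
  set r : ℝ → ℝ := fun t => M.lam (y t) γ (α t) with hr
  set g : ℝ → ℝ := fun t => Real.exp (-δ * t) * M.l γ (y t) (α t) with hg
  set P : E → ℝ → ℝ := fun γ₁ t => M.Q (y t) γ γ₁ (α t) with hP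
  set w : E → ℝ → ℝ := fun γ₁ t => Real.exp (-δ * t) * v (y t) γ₁ with hw
  have hexp : Measurable fun t => Real.exp (-δ * t) := by fun_prop
  have hrm : Measurable r := measurable_lam hlam γ hyc.measurable hα.1
  have hr0 : ∀ t, 0 ≤ r t := fun t => hlam.2.1 _ _ _
  have hrC : ∀ t, r t ≤ hlam.const := fun t => hlam.le_const _ _ _
  have hgm : Measurable g := hexp.mul (hBl.measurable_along hf hα)
  have hdisc0 : ∀ t, M.disc γ (fun _ _ => δ) x α t = Real.exp (-δ * t) := fun t => by
    simp [disc, mul_comm]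
  have hgi : IntegrableOn g (Ioi 0) := by
    refine (integrableOn_disc_mul hf (RegularCost.const M γ δ) (fun _ _ => le_rfl) hδ hBl
      hα).congr_fun (fun t ht => ?_) measurableSet_Ioi
    simp only [hdisc0, hg, hyt t (le_of_lt ht)]
  have hPm : ∀ γ₁, Measurable (P γ₁) := fun γ₁ =>
    measurable_transition hQ γ γ₁ hyc.measurable hα.1
  have hwm : ∀ γ₁, Measurable (w γ₁) := fun γ₁ =>
    hexp.mul ((hv γ₁).comp_continuous hyc hymem).measurable
  have hbw : ∀ γ₁ t, 0 ≤ t → |w γ₁ t| ≤ ∑ γ₂, |b γ₂| := fun γ₁ t ht => by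
    rw [hw, abs_mul, abs_of_pos (Real.exp_pos _)]
    have h1 : Real.exp (-δ * t) ≤ 1 := Real.exp_le_one_iff.2 (by nlinarith)
    calc _ ≤ 1 * |b γ₁| := mul_le_mul h1 ((hb γ₁ _ (hymem t)).trans (le_abs_self _))
          (abs_nonneg _) zero_le_one
      _ ≤ ∑ γ₂, |b γ₂| := by
        rw [one_mul]
        exact Finset.single_le_sum (f := fun γ₂ => |b γ₂|) (fun _ _ => abs_nonneg _)
          (Finset.mem_univ γ₁)
  obtain ⟨hFi, hFeq⟩ := integral_first_jump hrm hr0 hrC hgm hgi hPm (fun γ₁ t => (hQ.1 _ _ _ _).1)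
    (fun t => hQ.2.1 _ _ _) hwm hbw fun p => rfl
  rw [← map_cubeMeasure_pair] at hFi hFeq
  have hpm : AEMeasurable (fun ω : ℕ → unitInterval => (ω 0, ω 1)) cubeMeasure := by fun_prop
  rw [integral_map hpm hFi.1] at hFeq
  -- The value 0 of the second uniform variable, at which the mode takes its default value, is
  -- negligible.
  have hpos : ∀ᵐ ω ∂cubeMeasure, 0 < ((ω : ℕ → unitInterval) 1 : ℝ) := by
    have h1 : ∀ᵐ u : unitInterval, 0 < (u : ℝ) := by
      have h2 : ∀ᵐ u : unitInterval, u ≠ 0 := by simp [ae_iff]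
      filter_upwards [h2] with u hu
      exact lt_of_le_of_ne u.2.1 fun h => hu (Subtype.ext h.symm)
    exact (measurePreserving_eval_infinitePi (fun _ : ℕ => (volume : Measure unitInterval))
      1).quasiMeasurePreserving.ae h1
  have hcostF : M.firstJumpCost δ v x γ π =
      (∫ t in Ioi 0, surv r t * g t) + ∫ t in Ioi 0, r t * surv r t * ∑ i, P i t * w i t := by
    rw [← hFeq, firstJumpCost]
    refine integral_congr_ae ?_
    filter_upwards [hpos] with ω hω
    have hτ : M.jumpTime π x γ ω 1 = wait r (ω 0) :=
      (jumpTime_one π x γ ω).trans (waitingTime_eq_wait γ x α (ω 0))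
    have hwt : M.waitingTime γ x α (ω 0) = wait r (ω 0) := waitingTime_eq_wait γ x α (ω 0)
    congr 1
    · rw [← hτ]
      have hms : MeasurableSet {t : ℝ | 0 ≤ t ∧ ENNReal.ofReal t < M.jumpTime π x γ ω 1} :=
        (measurableSet_le measurable_const measurable_id).inter
          (measurableSet_lt ENNReal.measurable_ofReal measurable_const)
      refine setIntegral_congr_fun hms fun t ht => ?_
      simp only [process_of_lt π x γ ω ht.2, hg, hyt t ht.1]
      rfl
    · rw [hτ]
      by_cases htop : wait r (ω 0) = ∞
      · simp only [htop, if_true]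
      · simp only [htop, if_false]
        set T := (wait r (ω 0)).toReal with hT
        have hT0 : 0 ≤ T := ENNReal.toReal_nonneg
        have hY : M.postPos π x γ ω 1 = y T := by
          rw [hyt T hT0, hT, ← hwt]; rfl
        have hG : M.postJumpMode π x γ ω 1 = M.postMode γ (y T) (α T) (ω 1) := by
          rw [hyt T hT0, hT, ← hwt]; rfl
        rw [hY, hG]
        have hmode := postMode_eq_iff hQ γ (M.postMode γ (y T) (α T) (ω 1)) (y T) (α T) hω
        have hother := fun γ₁ => postMode_eq_iff hQ γ γ₁ (y T) (α T) hω
        rw [Finset.sum_eq_single (M.postMode γ (y T) (α T) (ω 1))]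
        · rw [if_pos (hmode.1 rfl)]
        · intro γ₁ _ hne
          exact if_neg fun h => hne ((hother γ₁).2 h).symm
        · exact fun h => absurd (Finset.mem_univ _) h
  have hdisc : ∀ t, 0 ≤ t → M.disc γ (fun x a => δ + M.lam x γ a) x α t =
      Real.exp (-δ * t) * surv r t := fun t ht => by
    rw [disc_eq_along ht, surv, ← Real.exp_add, intervalIntegral.integral_add
      intervalIntegrable_const (intervalIntegrable_rate hrm hr0 hrC 0 t),
      intervalIntegral.integral_const, neg_add, sub_zero, smul_eq_mul]
    congr 2
    ring
  have hq : M.RegularCost γ (fun x a => δ + M.lam x γ a) (|δ| + hlam.const) :=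
    (RegularCost.const M γ δ).add (hlam.regularCost hjump γ)
  have hqδ : ∀ x a, δ ≤ δ + M.lam x γ a := fun x a => le_add_of_nonneg_right (hlam.2.1 x γ a)
  have hi1 : IntegrableOn (fun t => surv r t * g t) (Ioi 0) := by
    refine (integrableOn_disc_mul hf hq hqδ hδ hBl hα).congr_fun (fun t ht => ?_)
      measurableSet_Ioi
    simp only [hdisc t (le_of_lt ht), hg, hyt t (le_of_lt ht)]
    ring
  -- The jump term is the total discounted cost minus the running cost before the jump, and both are
  -- integrable.
  have hi2 : IntegrableOn (fun t => r t * surv r t * ∑ i, P i t * w i t) (Ioi 0) := by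
    refine ((integrableOn_disc_mul hf hq hqδ hδ hBL hα).sub hi1).congr_fun (fun t ht => ?_)
      measurableSet_Ioi
    simp only [Pi.sub_apply, hdisc t (le_of_lt ht), hg, hr, hP, hw, jumpCost,
      hyt t (le_of_lt ht), mul_left_comm _ (Real.exp _), ← Finset.mul_sum]
    ring
  rw [hcostF, discCost, ← integral_add hi1 hi2]
  refine setIntegral_congr_fun measurableSet_Ioi fun t ht => ?_
  simp only [hdisc t (le_of_lt ht), hg, hr, hP, hw, jumpCost,
    hyt t (le_of_lt ht), mul_left_comm _ (Real.exp _), ← Finset.mul_sum]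
  ring

end FirstJumpCost

end TrafficModel

namespace TrafficModel

section IteratedValues

variable {d m N : ℕ} {E : Type*} {M : TrafficModel d m N E} {δ : ℝ}

/-! ### The value functions -/

lemma detValue_eq_discValue (M : TrafficModel d m N E) (δ : ℝ) (x : EuclideanSpace ℝ (Fin m))
    (γ : E) : M.detValue δ x γ = M.discValue γ (fun _ _ => δ) (M.l γ) x := by
  simp [detValue, discValue, discCost, disc, mul_comm]

/-- The slice map from admissible policies to feasible controls at (x,γ) is surjective and the cost
depends on the slice only, so both infima agree and the continuity of the deterministic value
applies with the rate δ + λ. -/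
theorem continuousOn_iterValue [Fintype E] (hN : 2 ≤ N) (hstar : M.IsStar)
    (hf : M.FieldRegular) (hlam : M.RateRegular) (hQ : M.TransitionRegular)
    (hl : M.CostRegular)
    (hctrl : M.CtrlStructure) (hact : M.ActiveCtrl) (hinact : M.InactiveCtrl)
    (hcost : M.CostCompatible) (hjump : M.JumpCompatible) (hedge : M.EdgeAdmissible)
    (hδ : 0 < δ) (k : ℕ) (γ : E) : ContinuousOn (fun x => M.iterValue δ k x γ) M.network := by
  have hon := ctrlOnEdges hN hf hstar hctrl hact hinact hedge
  have hne := fun γ x (hx : x ∈ M.network) =>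
    detCtrl_nonempty hN hf hstar hctrl hact hinact γ hx
  induction k generalizing γ with
  | zero =>
    obtain ⟨B, hB⟩ := hl.regularCost hcost γ
    simp only [iterValue, detValue_eq_discValue]
    exact continuousOn_discValue hf hstar hctrl hact hinact hon (.const M γ δ)
      (fun _ _ => le_rfl) hδ hB (hne γ)
  | succ k ih =>
    obtain ⟨B, hB⟩ := regularCost_jumpCost hlam hQ hl hcost hjump ih γ
    refine (continuousOn_discValue hf hstar hctrl hact hinact hon
      ((RegularCost.const M γ δ).add (hlam.regularCost hjump γ))
      (fun x a => le_add_of_nonneg_right (hlam.2.1 x γ a)) hδ hB (hne γ)).congr fun x hx => ?_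
    have hsurj : Function.Surjective fun π : M.admissible =>
        (⟨fun t => π.1 t x γ, detCtrl_of_admissible hf hlam π.2 hx γ⟩ : M.detCtrl γ x) := by
      rintro ⟨α, hα⟩
      obtain ⟨π, hπ, h⟩ := exists_admissible_extending hN hf hstar hctrl hact hinact hα
      exact ⟨⟨π, hπ⟩, Subtype.ext h⟩
    simp only [iterValue]
    rw [discValue, ← hsurj.iInf_comp]
    exact iInf_congr fun π => firstJumpCost_eq hf hlam hQ hl hcost hjump hδ ih π.2 hx

end IteratedValues

end TrafficModel

/-! ### Uniform continuity from compactness of the network and finiteness of the set of modes. -/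

theorem mainTheorem5 {d m N : ℕ} {E : Type*} [Fintype E] (hN : 2 ≤ N)
    (M : TrafficModel d m N E) (hA : IsCompact M.A) (hstar : M.IsStar)
    (hf : M.FieldRegular) (hlam : M.RateRegular) (hQ : M.TransitionRegular)
    (hl : M.CostRegular)
    (hctrl : M.CtrlStructure) (hact : M.ActiveCtrl) (hinact : M.InactiveCtrl)
    (hcost : M.CostCompatible) (hjump : M.JumpCompatible) (hedge : M.EdgeAdmissible)
    (δ : ℝ) (hδ : 0 < δ) (k : ℕ) :
    UniformEquicontinuousOn (fun (γ : E) (x : EuclideanSpace ℝ (Fin m)) => M.iterValue δ k x γ)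
      M.network := by
  exact uniformEquicontinuousOn_finite.2 fun γ =>
    M.isCompact_network.uniformContinuousOn_of_continuous
      (TrafficModel.continuousOn_iterValue hN hstar hf hlam hQ hl hctrl hact hinact hcost hjump
        hedge hδ k γ)
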